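/- Let $C$ be a braided monoidal category, with braiding $\Psi$, in which every object $X$ has a dual $X^*$ with evaluation $\mathrm{ev}:X^*\otimes X\to 1$ and coevaluation $1\to X\otimes X^*$. We suppress associators. A braided group is a Hopf algebra in $C$. *Representability and reconstruction.* For a functor $F:D\to C$, an object $A$ of $C$ and a natural transformation $\beta_X:F(X)\to F(X)\otimes A$, write $F^n(X_1,\dots,X_n)=F(X_1)\otimes\cdots\otimes F(X_n)$ and let $\beta^{(n)}:F^n\to F^n\otimes A^{\otimes n}$ be obtained by applying $\beta$ to each factor and moving the copies of $A$ to the right by the braidings $\Psi_{A,F(X_i)}$. We say that $(A,\beta)$ represents $F$ if for all $n\ge 0$ and all objects $V$ the map $\mathrm{Mor}(A^{\otimes n},V)\to\mathrm{Nat}(F^n,F^n\otimes V)$, $\phi\mapsto(\mathrm{id}\otimes\phi)\beta^{(n)}$, is a bijection. If $D$ is monoidal and $F$ is a monoidal functor, then a braided group structure on $A$ is said to be reconstructed from $F$ (with $\beta$) if $(A,\beta)$ represents $F$ and, with the identifications $F(X)\otimes F(Y)\cong F(X\otimes Y)$ and $1\cong F(1)$, $$(\mathrm{id}\otimes\Delta)\beta_X=(\beta_X\otimes\mathrm{id})\beta_X,\quad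 (\mathrm{id}\otimes\epsilon)\beta_X=\mathrm{id},\quad (\mathrm{id}\otimes\mu)(\mathrm{id}\otimes\Psi_{A,F(Y)}\otimes\mathrm{id})(\beta_X\otimes\beta_Y)=\beta_{X\otimes Y},\quad \beta_{1}=\mathrm{id}_1\otimes\eta .$$ *Dual-quasitriangular structures.* Such a structure on a braided group $K$ consists of a second (opposite) product $\mu^{op}$ making $K$, with the same unit, coproduct and counit, a braided group, and a morphism $R:K\otimes K\to 1$, invertible under the convolution product $*$ defined by the braided tensor product coalgebra $K\otimes K$, such that $$R*\mu=\mu^{op}*R,\quad R(\mu^{op}\otimes\mathrm{id})=R(\mathrm{id}\otimes R\otimes\mathrm{id})(\mathrm{id}\otimes\mathrm{id}\otimes\Delta),\quad R(\mathrm{id}\otimes\mu)=R(\mathrm{id}\otimes R\otimes\mathrm{id})(\Delta\otimes\mathrm{id}\otimes\mathrm{id}).$$ *The dual category.* Let $C^\circ$ be the dual (centre) of $C$: its objects are pairs $(V,\lambda)$ with $V$ in $C$ and $\lambda_X:V\otimes X\to X\otimes V$ a natural isomorphism such that $\lambda_{1}=\mathrm{id}$ and $\lambda_{X\otimes Y}=(\mathrm{id}_X\otimes\lambda_Y)(\lambda_X\otimes\mathrm{id}_Y)$;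 its morphisms are the morphisms of $C$ that intertwine the $\lambda$'s. It is monoidal and is braided by $c_{(V,\lambda),(W,\nu)}=\lambda_W$. **Proposition 3.1.** Suppose that the identity functor of $C$ is represented by $(A,\beta)$ with $A$ an object of $C$. Then: 1. $A$ has a braided group structure reconstructed from the identity functor of $C$; this braided group is $\mathrm{Aut}(C)$. The object $A^*$ has the dual braided group structure: for $\mathrm{ev}_2=\mathrm{ev}(\mathrm{id}\otimes\mathrm{ev}\otimes\mathrm{id}):A^*\otimes A^*\otimes A\otimes A\to 1$ one has $$\mathrm{ev}(\mu_{A^*}\otimes\mathrm{id})=\mathrm{ev}_2(\mathrm{id}\otimes\mathrm{id}\otimes\Delta_A),\quad \mathrm{ev}_2(\Delta_{A^*}\otimes\mathrm{id}\otimes\mathrm{id})=\mathrm{ev}(\mathrm{id}\otimes\mu_A),$$ and the unit, counit and antipode of $A^*$ are adjoint under $\mathrm{ev}$ to the counit, unit and antipode of $A$. 2. Let $\mathrm{Ad}=(\mathrm{id}\otimes\mu)(\Psi_{A,A}\otimes\mathrm{id})(S\otimes\mathrm{id}\otimes\mathrm{id})(\mathrm{id}\otimes\Delta)\Delta:A\to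 A\otimes A$ be the braided adjoint coaction. Let the braided coadjoint coaction $c:A^*\to A^*\otimes A$ be the dual of $\mathrm{Ad}$, that is, the composite $$A^*\to A^*\otimes A\otimes A^*\xrightarrow{\ \mathrm{id}\otimes\mathrm{Ad}\otimes\mathrm{id}\ }A^*\otimes A\otimes A\otimes A^*\xrightarrow{\ \mathrm{ev}\otimes\mathrm{id}\otimes\mathrm{id}\ }A\otimes A^*\xrightarrow{\ S\otimes\mathrm{id}\ }A\otimes A^*\xrightarrow{\ \Psi\ }A^*\otimes A$$ whose first map is coevaluation. Then $c$ makes $A^*$ a right $A$-comodule coalgebra, and $A\otimes A^*$ is a braided group, denoted $\mathrm{Aut}(C)\rtimes\mathrm{Aut}(C)^*$, with the braided tensor product algebra structure (product $(\mu_A\otimes\mu_{A^*})(\mathrm{id}\otimes\Psi_{A^*,A}\otimes\mathrm{id})$), the counit $\epsilon_A\otimes\epsilon_{A^*}$, and the cross coproduct $$\Delta=(\mathrm{id}\otimes\mathrm{id}\otimes\mu_A\otimes\mathrm{id})(\mathrm{id}\otimes\Psi_{A,A^*}\otimes\mathrm{id}\otimes\mathrm{id})(\mathrm{id}\otimes\mathrm{id}\otimes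 c\otimes\mathrm{id})(\Delta_A\otimes\Delta_{A^*}).$$ 3. The braided group $K=\mathrm{Aut}(C)\rtimes\mathrm{Aut}(C)^*$ is reconstructed from the forgetful functor $F:C^\circ\to C$, with a suitable universal natural transformation $\beta'$. 4. $K$ has a dual-quasitriangular structure $(\mu^{op},R)$ given by the braiding of $C^\circ$: for all objects $X=(V,\lambda)$ and $Y=(W,\nu)$ of $C^\circ$, $$(\mathrm{id}\otimes\mu^{op})(\mathrm{id}\otimes\Psi_{K,W}\otimes\mathrm{id})(\beta'_X\otimes\beta'_Y)=(\Psi_{V,W}^{-1}\otimes\mathrm{id})\,\beta'_{Y\otimes X}\,\Psi_{V,W},$$ $$(\mathrm{id}\otimes R)(\mathrm{id}\otimes\Psi_{K,W}\otimes\mathrm{id})(\beta'_X\otimes\beta'_Y)=\Psi_{V,W}^{-1}\circ\lambda_W .$$ -/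

import Mathlib

open CategoryTheory MonoidalCategory BraidedCategory Functor.LaxMonoidal Functor.OplaxMonoidal

open scoped MonObj ComonObj HopfObj

noncomputable section

namespace BraidedReconstruction

universe v₁ v₂ u₁ u₂

section Reconstruction

variable {D : Type u₂} [Category.{v₂} D] {C : Type u₁} [Category.{v₁} C] [MonoidalCategory C]

/-- The functor `F^n : (X₁, …, Xₙ) ↦ F X₁ ⊗ ⋯ ⊗ F Xₙ` (bracketed to the left, starting with the
unit object) on the `n`-fold power of the category `D`. -/
def tensorPower (F : D ⥤ C) : (n : ℕ) → ((Fin n → D) ⥤ C)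
  | 0 => (Functor.const _).obj (𝟙_ C)
  | n + 1 =>
    { obj := fun X => (tensorPower F n).obj (fun i => X i.castSucc) ⊗ F.obj (X (Fin.last n))
      map := fun {X Y} f =>
        (tensorPower F n).map (X := fun i => X i.castSucc) (Y := fun i => Y i.castSucc)
          (fun i => f i.castSucc) ⊗ₘ F.map (f (Fin.last n))
      map_id := fun X => by
        have h := (tensorPower F n).map_id (fun i => X i.castSucc)
        simp only [Pi.id_apply]
        erw [h]
        simp
      map_comp := fun {X Y Z} f g => by
        have h := (tensorPower F n).map_comp (X := fun i => X i.castSucc)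
          (Y := fun i => Y i.castSucc) (Z := fun i => Z i.castSucc)
          (fun i => f i.castSucc) (fun i => g i.castSucc)
        simp only [Pi.comp_apply, Functor.map_comp]
        erw [h]
        simp [tensorHom_comp_tensorHom] }

/-- The object `A^n = A ⊗ ⋯ ⊗ A`, bracketed as in `tensorPower`. -/
def objPower (A : C) : ℕ → C
  | 0 => 𝟙_ C
  | n + 1 => objPower A n ⊗ A

variable [BraidedCategory C]

/-- The map `F X₁ ⊗ ⋯ ⊗ F Xₙ ⟶ (F X₁ ⊗ ⋯ ⊗ F Xₙ) ⊗ A^n` which applies `β` to each factor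
and moves the copies of `A` to the right, past the objects `F Xᵢ`, by the braiding `Ψ_{A, F Xᵢ}`. -/
def powerCoaction (F : D ⥤ C) (A : C) (β : F ⟶ F ⋙ tensorRight A) : (n : ℕ) → (X : Fin n → D) →
    ((tensorPower F n).obj X ⟶ (tensorPower F n).obj X ⊗ objPower A n)
  | 0, _ => (λ_ (𝟙_ C)).inv
  | n + 1, X =>
      (powerCoaction F A β n (fun i => X i.castSucc) ⊗ₘ β.app (X (Fin.last n))) ≫
        tensorμ _ _ _ _

theorem powerCoaction_naturality (F : D ⥤ C) (A : C) (β : F ⟶ F ⋙ tensorRight A) (n : ℕ)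
    {X Y : Fin n → D} (f : X ⟶ Y) :
    (tensorPower F n).map f ≫ powerCoaction F A β n Y =
      powerCoaction F A β n X ≫ (tensorPower F n).map f ▷ objPower A n := by
  induction n with
  | zero =>
    change 𝟙 (𝟙_ C) ≫ _ = _ ≫ (𝟙 (𝟙_ C)) ▷ _
    rw [id_whiskerRight]
    exact (Category.id_comp _).trans (Category.comp_id _).symm
  | succ n ih =>
    have h := ih (X := fun i => X i.castSucc) (Y := fun i => Y i.castSucc)
      (fun i => f i.castSucc)
    have hb := β.naturality (f (Fin.last n))
    change (_ ⊗ₘ _) ≫ (_ ⊗ₘ _) ≫ tensorμ _ _ _ _ =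
      ((_ ⊗ₘ _) ≫ tensorμ _ _ _ _) ≫ (_ ⊗ₘ _) ▷ (objPower A n ⊗ A)
    rw [tensorHom_comp_tensorHom_assoc]
    erw [h, hb]
    rw [← tensorHom_comp_tensorHom_assoc, Category.assoc]
    congr 1
    have h2 := tensorμ_natural ((tensorPower F n).map (X := fun i => X i.castSucc)
      (Y := fun i => Y i.castSucc) (fun i => f i.castSucc)) (𝟙 (objPower A n))
      (F.map (f (Fin.last n))) (𝟙 A)
    rw [id_tensorHom_id, tensorHom_id, tensorHom_id, tensorHom_id] at h2
    exact h2

/-- The map `θₙ : Mor(A^n, V) ⟶ Nat(F^n, F^n ⊗ V)` induced by `β`. -/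
def theta (F : D ⥤ C) (A : C) (β : F ⟶ F ⋙ tensorRight A) (n : ℕ) (V : C)
    (φ : objPower A n ⟶ V) : tensorPower F n ⟶ tensorPower F n ⋙ tensorRight V where
  app X := powerCoaction F A β n X ≫ (tensorPower F n).obj X ◁ φ
  naturality X Y f := by
    change _ ≫ _ ≫ _ = (_ ≫ _) ≫ (tensorPower F n).map f ▷ V
    rw [← Category.assoc, powerCoaction_naturality, Category.assoc, Category.assoc,
      whisker_exchange]

/-- `F` satisfies the representability condition for comodules, with representing object `A` and
universal natural transformation `β_X : F X ⟶ F X ⊗ A`: all `θₙ` are bijections. -/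
def IsRepresentedBy (F : D ⥤ C) (A : C) (β : F ⟶ F ⋙ tensorRight A) : Prop :=
  ∀ (n : ℕ) (V : C), Function.Bijective (theta F A β n V)

/-- The coaction on a tensor product of two coactions of `A`, before multiplying the two copies of
`A`: `F X ⊗ F Y ⟶ (F X ⊗ F Y) ⊗ (A ⊗ A)`. -/
def pairCoaction (F : D ⥤ C) (A : C) (β : F ⟶ F ⋙ tensorRight A) (X Y : D) :
    F.obj X ⊗ F.obj Y ⟶ (F.obj X ⊗ F.obj Y) ⊗ (A ⊗ A) :=
  (β.app X ⊗ₘ β.app Y) ≫ tensorμ (F.obj X) A (F.obj Y) A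

/-- The braided group (Hopf algebra in `C`) structure `hA` on `A` is the one obtained by
reconstruction from the monoidal functor `F`, with universal natural transformation `β`:
`A` with `β` represents `F`, each `β_X` is a right coaction (which determines the coproduct and the
counit), and `β` on a tensor product and on the unit object is the tensor product coaction and the
trivial coaction (which determines the product and the unit). The antipode of a bialgebra is
unique, so it needs no further condition. -/
structure IsReconstruction [MonoidalCategory D] (F : D ⥤ C) [F.Monoidal] (A : C)
    (β : F ⟶ F ⋙ tensorRight A) (hA : HopfObj A) : Prop where
  represented : IsRepresentedBy F A β
  comul (X : D) : β.app X ≫ F.obj X ◁ Δ[A] = β.app X ≫ β.app X ▷ A ≫ (α_ (F.obj X) A A).hom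
  counit (X : D) : β.app X ≫ F.obj X ◁ ε[A] = (ρ_ (F.obj X)).inv
  mul (X Y : D) : pairCoaction F A β X Y ≫ (F.obj X ⊗ F.obj Y) ◁ μ[A] =
    Functor.LaxMonoidal.μ F X Y ≫ β.app (X ⊗ Y) ≫ Functor.OplaxMonoidal.δ F X Y ▷ A
  one : (λ_ (𝟙_ C)).inv ≫ 𝟙_ C ◁ η[A] =
    Functor.LaxMonoidal.ε F ≫ β.app (𝟙_ D) ≫ Functor.OplaxMonoidal.η F ▷ A

end Reconstruction

section BraidedGroups

variable {C : Type u₁} [Category.{v₁} C] [MonoidalCategory C]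

/-- For `p : X ⊗ Y ⟶ 1`, the nested pairing `(X ⊗ X) ⊗ (Y ⊗ Y) ⟶ 1`, which pairs the two inner
factors by `p`, and then the two outer factors by `p`. -/
def nested {X Y : C} (p : X ⊗ Y ⟶ 𝟙_ C) : (X ⊗ X) ⊗ (Y ⊗ Y) ⟶ 𝟙_ C :=
  (α_ X X (Y ⊗ Y)).hom ≫ X ◁ (α_ X Y Y).inv ≫ X ◁ (p ▷ Y) ≫ X ◁ (λ_ Y).hom ≫ p

variable [BraidedCategory C]

/-- The braided group structure `hA'` on the dual object `Aᘁ` is the dual of the braided group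
structure `hA` on `A`: each structure map of `Aᘁ` is adjoint to one of `A` by the evaluation
`Aᘁ ⊗ A ⟶ 1`. -/
structure IsDualBraidedGroup (A : C) [HasRightDual A] (hA : HopfObj A) (hA' : HopfObj (Aᘁ)) :
    Prop where
  mul : μ[Aᘁ] ▷ A ≫ ε_ A (Aᘁ) = (Aᘁ ⊗ Aᘁ) ◁ Δ[A] ≫ nested (ε_ A (Aᘁ))
  one : η[Aᘁ] ▷ A ≫ ε_ A (Aᘁ) = (λ_ A).hom ≫ ε[A]
  comul : Δ[Aᘁ] ▷ (A ⊗ A) ≫ nested (ε_ A (Aᘁ)) = Aᘁ ◁ μ[A] ≫ ε_ A (Aᘁ)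
  counit : ε[Aᘁ] = (ρ_ (Aᘁ)).inv ≫ Aᘁ ◁ η[A] ≫ ε_ A (Aᘁ)
  antipode : 𝒮[Aᘁ] ▷ A ≫ ε_ A (Aᘁ) = Aᘁ ◁ 𝒮[A] ≫ ε_ A (Aᘁ)

/-- The braided right adjoint coaction `a ↦ Ψ(S a₁ ⊗ a₂) a₃` of `A` on itself, the product being
taken in the last two factors of `A ⊗ A ⊗ A`. -/
def adjointCoaction (A : C) (_hA : HopfObj A) : A ⟶ A ⊗ A :=
  Δ[A] ≫ A ◁ Δ[A] ≫ 𝒮[A] ▷ (A ⊗ A) ≫ (α_ A A A).inv ≫ (β_ A A).hom ▷ A ≫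
    (α_ A A A).hom ≫ A ◁ μ[A]

/-- The right coaction on the dual object `Xᘁ` which is conjugate, by the antipode of `A`, to a
right coaction `δ` of `A` on `X`:
`Xᘁ ⟶ Xᘁ ⊗ X ⊗ Xᘁ ⟶ Xᘁ ⊗ X ⊗ A ⊗ Xᘁ ⟶ A ⊗ Xᘁ ⟶ Xᘁ ⊗ A`, by coevaluation, `δ`, evaluation,
and the braiding after the antipode. -/
def dualCoaction {A : C} (_hA : HopfObj A) {X : C} [HasRightDual X] (δ : X ⟶ X ⊗ A) :
    Xᘁ ⟶ Xᘁ ⊗ A :=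
  (ρ_ (Xᘁ)).inv ≫ Xᘁ ◁ η_ X (Xᘁ) ≫ Xᘁ ◁ (δ ▷ Xᘁ) ≫ Xᘁ ◁ (α_ X A (Xᘁ)).hom ≫
    (α_ (Xᘁ) X (A ⊗ Xᘁ)).inv ≫ ε_ X (Xᘁ) ▷ (A ⊗ Xᘁ) ≫ (λ_ (A ⊗ Xᘁ)).hom ≫
    𝒮[A] ▷ Xᘁ ≫ (β_ A (Xᘁ)).hom

/-- The braided coadjoint coaction of `A` on `Aᘁ`: the dual of the braided adjoint coaction. -/
def coadjointCoaction (A : C) [HasRightDual A] (hA : HopfObj A) : Aᘁ ⟶ Aᘁ ⊗ A :=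
  dualCoaction hA (adjointCoaction A hA)

/-- The cross coproduct `A ⊗ B ⟶ (A ⊗ B) ⊗ (A ⊗ B)` by a right coaction `c` of `A` on `B`:
`a ⊗ b ↦ a₁ ⊗ Ψ(a₂ ⊗ b₁⁽⁰⁾) b₁⁽¹⁾ ⊗ b₂` where `c b = b⁽⁰⁾ ⊗ b⁽¹⁾`. -/
def crossComul (A B : C) (_hA : HopfObj A) (_hB : HopfObj B) (c : B ⟶ B ⊗ A) :
    A ⊗ B ⟶ (A ⊗ B) ⊗ (A ⊗ B) :=
  (Δ[A] ⊗ₘ Δ[B]) ≫ (A ⊗ A) ◁ (c ▷ B) ≫ (α_ A A ((B ⊗ A) ⊗ B)).hom ≫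
    A ◁ (A ◁ (α_ B A B).hom) ≫ A ◁ (α_ A B (A ⊗ B)).inv ≫ A ◁ ((β_ A B).hom ▷ (A ⊗ B)) ≫
    A ◁ (α_ B A (A ⊗ B)).hom ≫ A ◁ (B ◁ (α_ A A B).inv) ≫ A ◁ (B ◁ (μ[A] ▷ B)) ≫
    (α_ A B (A ⊗ B)).inv

/-- The braided group structure `hK` on `A ⊗ B` is the cross coproduct of the braided groups `A` and
`B` by the morphism `c : B ⟶ B ⊗ A`. This means that `c` makes `B` a right `A`-comodule coalgebra,
and that `A ⊗ B` has the braided tensor product algebra structure and the cross coproduct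
coalgebra structure. -/
structure IsCrossCoproduct (A B : C) (hA : HopfObj A) (hB : HopfObj B) (c : B ⟶ B ⊗ A)
    (hK : HopfObj (A ⊗ B)) : Prop where
  coaction_comul : c ≫ B ◁ Δ[A] = c ≫ c ▷ A ≫ (α_ B A A).hom
  coaction_counit : c ≫ B ◁ ε[A] = (ρ_ B).inv
  comul_equivariant :
    Δ[B] ≫ (c ⊗ₘ c) ≫ tensorμ B A B A ≫ (B ⊗ B) ◁ μ[A] = c ≫ Δ[B] ▷ A
  counit_equivariant : c ≫ ε[B] ▷ A = ε[B] ≫ (λ_ (𝟙_ C)).inv ≫ 𝟙_ C ◁ η[A]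
  mul : hK.mul = tensorμ A B A B ≫ (μ[A] ⊗ₘ μ[B])
  one : hK.one = (λ_ (𝟙_ C)).inv ≫ (η[A] ⊗ₘ η[B])
  comul : hK.comul = crossComul A B hA hB c
  counit : hK.counit = (ε[A] ⊗ₘ ε[B]) ≫ (λ_ (𝟙_ C)).hom

/-- The braided tensor product coproduct of `A ⊗ A`. -/
def tensorComul (A : C) (_hA : HopfObj A) : A ⊗ A ⟶ (A ⊗ A) ⊗ (A ⊗ A) :=
  (Δ[A] ⊗ₘ Δ[A]) ≫ tensorμ A A A A

/-- A dual-quasitriangular structure on a braided group `A`: a second, opposite, product on the same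
unital coalgebra which again gives a braided group, and a convolution-invertible `R : A ⊗ A ⟶ 1`
which intertwines the two products (`R * μ = μᵒᵖ * R` for convolution on the braided tensor product
coalgebra `A ⊗ A`), and is multiplicative in each argument, for the opposite product
in the first argument. For ordinary dual-quasitriangular Hopf algebras (in vector
spaces) `μᵒᵖ(a ⊗ b) = ba`, and these are
`R(a₁ ⊗ b₁) a₂ b₂ = b₁ a₁ R(a₂ ⊗ b₂)`, `R(ba ⊗ c) = R(b ⊗ c₁) R(a ⊗ c₂)` and
`R(a ⊗ bc) = R(a₁ ⊗ c) R(a₂ ⊗ b)`. -/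
structure DualQuasitriangular (A : C) (hA : HopfObj A) where
  /-- The braided group with the opposite product. -/
  op : HopfObj A
  op_one : op.one = hA.one
  op_comul : op.comul = hA.comul
  op_counit : op.counit = hA.counit
  /-- The pairing. -/
  R : A ⊗ A ⟶ 𝟙_ C
  /-- The convolution inverse of the pairing. -/
  Rinv : A ⊗ A ⟶ 𝟙_ C
  R_mul_Rinv : tensorComul A hA ≫ (R ⊗ₘ Rinv) ≫ (λ_ (𝟙_ C)).hom =
    (hA.counit ⊗ₘ hA.counit) ≫ (λ_ (𝟙_ C)).hom
  Rinv_mul_R : tensorComul A hA ≫ (Rinv ⊗ₘ R) ≫ (λ_ (𝟙_ C)).hom =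
    (hA.counit ⊗ₘ hA.counit) ≫ (λ_ (𝟙_ C)).hom
  intertwines : tensorComul A hA ≫ (R ⊗ₘ hA.mul) ≫ (λ_ A).hom =
    tensorComul A hA ≫ (op.mul ⊗ₘ R) ≫ (ρ_ A).hom
  mul_left : op.mul ▷ A ≫ R = (A ⊗ A) ◁ hA.comul ≫ nested R
  mul_right : A ◁ hA.mul ≫ R = hA.comul ▷ (A ⊗ A) ≫ nested R

/-- The dual-quasitriangular structure `Q` on the reconstructed braided group `A` is the one given
by reconstruction from the braiding of `D`, `F : D ⥤ C` being a monoidal functor (in general not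
braided): the opposite product corresponds to the coaction `β` on `Y ⊗ X` carried over to
`F X ⊗ F Y` by the braiding of `C`, and `R` to the natural automorphism
`Ψ⁻¹ ∘ F(Ψ_{X, Y})` of `F X ⊗ F Y`, which compares the braidings of `D` and of `C`. -/
structure IsReconstructedFromBraiding {D : Type u₂} [Category.{v₂} D] [MonoidalCategory D]
    [BraidedCategory D] (F : D ⥤ C) [F.Monoidal] (A : C) (β : F ⟶ F ⋙ tensorRight A)
    (hA : HopfObj A) (Q : DualQuasitriangular A hA) : Prop where
  op_mul (X Y : D) : pairCoaction F A β X Y ≫ (F.obj X ⊗ F.obj Y) ◁ Q.op.mul =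
    (β_ (F.obj X) (F.obj Y)).hom ≫ Functor.LaxMonoidal.μ F Y X ≫ β.app (Y ⊗ X) ≫
      Functor.OplaxMonoidal.δ F Y X ▷ A ≫ (β_ (F.obj X) (F.obj Y)).inv ▷ A
  R (X Y : D) : pairCoaction F A β X Y ≫ (F.obj X ⊗ F.obj Y) ◁ Q.R ≫
      (ρ_ (F.obj X ⊗ F.obj Y)).hom =
    Functor.LaxMonoidal.μ F X Y ≫ F.map (β_ X Y).hom ≫ Functor.OplaxMonoidal.δ F Y X ≫
      (β_ (F.obj X) (F.obj Y)).inv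

end BraidedGroups

end BraidedReconstruction

end

/-! Since `C` has duals, representability for `n = 1` gives all `n`: a map `A ⊗ W ⟶ V` is the same
as a natural family `F X ⊗ W ⟶ F X ⊗ V`, and several variables are peeled off one at a time
(`Universal.pair_ext`, `Universal.exists_pair`, `Universal.tensor`). So morphisms out of tensor
powers of `A` can be defined and compared through the natural families which they induce. Coproduct,
counit and product represent the iterated, the trivial and the tensor product coaction, and the
bialgebra axioms reduce to the coaction laws and to naturality at unitors and associators. The
antipode represents the transposed coaction of the dual object; it works because evaluation and
coevaluation are comodule maps (`Reconstructs.exists_antipode`). The dual structure on `Aᘁ` consists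
of the adjoints under the nested evaluation, which are unique (`exists_dual_hopfObj`).

For the identity functor every object carries a coaction of `A` and every morphism is a comodule
map. Naturality of `β` at the morphism `β_X` itself forces `β_A` to be the adjoint coaction
(`Reconstructs.adjointCoaction_eq`); the description of the antipode then forces `β_{Aᘁ}` to be the
coadjoint one.

Put `B = Aᘁ`. A half braiding on `V`, compared with the braiding of `C`, is a natural family of
endomorphisms of `V ⊗ X`. By universality of `A` and the perfect pairing it is a map `V ⟶ V ⊗ B`,
and the tensor product rule for half braidings becomes coassociativity. Conversely a `B`-comodule
gives a half braiding, invertible because of duals. Thus the centre consists of the `B`-comodules in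
`C`. The coaction of `B` followed by that of `A` is universal for the forgetful functor, since each
comodule `V` maps equivariantly to the cofree comodule `V ⊗ B` with a retraction in `C`
(`IsCenterCoaction.universal`). The general reconstruction then yields `K`; its cross coproduct
records how a coaction of `A` is moved past a coaction of `B`.

The dual-quasitriangular structure exists for any monoidal functor from a braided category with
duals which has a universal coaction (`Reconstructs.exists_dualQuasitriangular`): the opposite
product is reconstructed for the reversed tensor product, `R` represents the comparison of the two
braidings, the intertwining relation is naturality of the coaction at the braiding, and
multiplicativity is the two hexagons. -/

open CategoryTheory MonoidalCategory BraidedCategory Functor.LaxMonoidal Functor.OplaxMonoidal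

open scoped MonObj ComonObj HopfObj

noncomputable section

namespace BraidedReconstruction

universe v₁ v₂ v₃ u₁ u₂ u₃

/-! ### Operators induced by coactions in one and two variables -/

section Actions

variable {C : Type u₁} [Category.{v₁} C] [MonoidalCategory C]

/-- A morphism `φ : A ⊗ W ⟶ V` acts on `P` by a coaction-like morphism `p : P ⟶ P ⊗ A`. -/
def act {P A W V : C} (p : P ⟶ P ⊗ A) (φ : A ⊗ W ⟶ V) : P ⊗ W ⟶ P ⊗ V :=
  p ▷ W ≫ (α_ P A W).hom ≫ P ◁ φ

theorem act_comp {P A W V V' : C} (p : P ⟶ P ⊗ A) (φ : A ⊗ W ⟶ V) (f : V ⟶ V') :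
    act p (φ ≫ f) = act p φ ≫ P ◁ f := by
  simp [act]

theorem act_whiskerLeft_comp {P A W W' V : C} (p : P ⟶ P ⊗ A) (f : W' ⟶ W) (φ : A ⊗ W ⟶ V) :
    act p (A ◁ f ≫ φ) = P ◁ f ≫ act p φ := by
  simp [act, whisker_exchange_assoc]

theorem act_whiskerRight_comp {P A A' W V : C} (p : P ⟶ P ⊗ A) (f : A ⟶ A') (φ : A' ⊗ W ⟶ V) :
    act p (f ▷ W ≫ φ) = act (p ≫ P ◁ f) φ := by
  simp [act]

theorem act_naturality {P P' A W V : C} {p : P ⟶ P ⊗ A} {p' : P' ⟶ P' ⊗ A} {f : P ⟶ P'}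
    (h : f ≫ p' = p ≫ f ▷ A) (φ : A ⊗ W ⟶ V) :
    f ▷ W ≫ act p' φ = act p φ ≫ f ▷ V := by
  simp only [act, ← comp_whiskerRight_assoc, h]
  simp [whisker_exchange]

/-- The second `p` touches only `P`, so it may be performed before `φ`. This converts composition of
operators into iterated coactions. -/
theorem act_act {P A W V U : C} (p : P ⟶ P ⊗ A) (φ : A ⊗ W ⟶ V) (ψ : A ⊗ V ⟶ U) :
    act p φ ≫ act p ψ =
      act (p ≫ p ▷ A ≫ (α_ P A A).hom) ((α_ A A W).hom ≫ A ◁ φ ≫ ψ) := by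
  simp only [act]
  calc _ = 𝟙 _ ⊗≫ p ▷ W ⊗≫ (P ◁ φ ≫ p ▷ V) ⊗≫ P ◁ ψ := by monoidal
    _ = _ := by rw [whisker_exchange]; monoidal

theorem act_rightUnitor {P A V : C} (p : P ⟶ P ⊗ A) (φ : A ⟶ V) :
    act p ((ρ_ A).hom ≫ φ) = (ρ_ P).hom ≫ p ≫ P ◁ φ := by
  simp only [act]
  monoidal

variable [BraidedCategory C]

/-- The map `P ⊗ Q ⟶ (P ⊗ Q) ⊗ (A ⊗ B)` obtained from `p : P ⟶ P ⊗ A` and `q : Q ⟶ Q ⊗ B`. -/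
def pair {P Q A B : C} (p : P ⟶ P ⊗ A) (q : Q ⟶ Q ⊗ B) : P ⊗ Q ⟶ (P ⊗ Q) ⊗ (A ⊗ B) :=
  (p ⊗ₘ q) ≫ tensorμ P A Q B

/-- Moves `A` past `Q`, while `Q` emits `B` by `q : Q ⟶ Q ⊗ B`, and then applies `φ`. -/
def push {Q A B V : C} (q : Q ⟶ Q ⊗ B) (φ : A ⊗ B ⟶ V) : A ⊗ Q ⟶ Q ⊗ V :=
  A ◁ q ≫ (α_ A Q B).inv ≫ (β_ A Q).hom ▷ B ≫ (α_ Q A B).hom ≫ Q ◁ φ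

/-- Separates the two variables: `act` uses only `p`, and `push` only `q`, so that universality can
be applied to one at a time. -/
theorem pair_comp {P Q A B V : C} (p : P ⟶ P ⊗ A) (q : Q ⟶ Q ⊗ B) (φ : A ⊗ B ⟶ V) :
    pair p q ≫ (P ⊗ Q) ◁ φ = act p (push q φ) ≫ (α_ P Q V).inv := by
  simp only [pair, act, push, tensorμ, MonoidalCategory.tensorHom_def]
  monoidal

/-- By naturality `A` may cross `Q` before `B` is emitted. Up to invertible braidings `push` is then
an action by `q`, to which universality in the second variable applies. -/
theorem push_eq {Q A B V : C} (q : Q ⟶ Q ⊗ B) (φ : A ⊗ B ⟶ V) :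
    push q φ = (β_ A Q).hom ≫ act q ((β_ A B).inv ≫ φ) := by
  simp only [act, push, whiskerLeft_comp]
  rw [← braiding_naturality_right_assoc, braiding_tensor_right_hom]
  simp [← whiskerLeft_comp_assoc]

theorem pair_naturality {P P' Q Q' A B : C} {p : P ⟶ P ⊗ A} {p' : P' ⟶ P' ⊗ A}
    {q : Q ⟶ Q ⊗ B} {q' : Q' ⟶ Q' ⊗ B} {f : P ⟶ P'} {g : Q ⟶ Q'}
    (hf : f ≫ p' = p ≫ f ▷ A) (hg : g ≫ q' = q ≫ g ▷ B) :
    (f ⊗ₘ g) ≫ pair p' q' = pair p q ≫ (f ⊗ₘ g) ▷ (A ⊗ B) := by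
  have h := tensorμ_natural f (𝟙 A) g (𝟙 B)
  simp only [pair, tensorHom_comp_tensorHom_assoc, hf, hg, Category.assoc]
  rw [← tensorHom_comp_tensorHom_assoc, ← tensorHom_id f A, ← tensorHom_id g B, h]
  simp

theorem pair_whiskerLeft_tensorHom {P Q A B A' B' : C} (p : P ⟶ P ⊗ A) (q : Q ⟶ Q ⊗ B)
    (f : A ⟶ A') (g : B ⟶ B') :
    pair p q ≫ (P ⊗ Q) ◁ (f ⊗ₘ g) = pair (p ≫ P ◁ f) (q ≫ Q ◁ g) := by
  have h := tensorμ_natural (𝟙 P) f (𝟙 Q) g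
  rw [id_tensorHom_id, id_tensorHom, id_tensorHom, id_tensorHom] at h
  rw [pair, pair, Category.assoc, ← h, tensorHom_comp_tensorHom_assoc]

end Actions

/-! ### Universal coactions, in one and in two variables -/

section Universal

variable {C : Type u₁} [Category.{v₁} C] [MonoidalCategory C]
  {D : Type u₂} [Category.{v₂} D] {E : Type u₃} [Category.{v₃} E]

/-- `b` is a universal natural transformation from `F` to the functors `F ⊗ V`. -/
structure Universal (F : D ⥤ C) (A : C) (b : ∀ X, F.obj X ⟶ F.obj X ⊗ A) : Prop where
  naturality : ∀ {X Y : D} (f : X ⟶ Y), F.map f ≫ b Y = b X ≫ F.map f ▷ A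
  hom_ext : ∀ {V : C} {φ ψ : A ⟶ V},
    (∀ X, b X ≫ F.obj X ◁ φ = b X ≫ F.obj X ◁ ψ) → φ = ψ
  exists_hom : ∀ {V : C} (a : ∀ X, F.obj X ⟶ F.obj X ⊗ V),
    (∀ {X Y : D} (f : X ⟶ Y), F.map f ≫ a Y = a X ≫ F.map f ▷ V) →
      ∃ φ : A ⟶ V, ∀ X, b X ≫ F.obj X ◁ φ = a X

namespace Universal

variable {F : D ⥤ C} {A : C} {b : ∀ X, F.obj X ⟶ F.obj X ⊗ A} (U : Universal F A b)

section

variable {W W' : C} [ExactPairing W W']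

/-- Transposing `W` to the target commutes with the action, so maps out of `A ⊗ W` inherit the
universal property of maps out of `A`. -/
theorem act_eq (p : ∀ X, F.obj X ⟶ F.obj X ⊗ A) {V : C} (φ : A ⊗ W ⟶ V) (X : D) :
    tensorRightHomEquiv (F.obj X) W W' (F.obj X ⊗ V) (act (p X) φ ≫ 𝟙 _) =
      p X ≫ F.obj X ◁ (tensorRightHomEquiv A W W' V φ) ≫ (α_ _ _ _).inv := by
  simp only [tensorRightHomEquiv, act, Equiv.coe_fn_mk]
  calc _ = 𝟙 _ ⊗≫ (F.obj X ◁ η_ W W' ≫ p X ▷ (W ⊗ W')) ⊗≫ F.obj X ◁ φ ▷ W' ⊗≫ 𝟙 _ := by monoidal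
    _ = _ := by rw [whisker_exchange]; monoidal

include U

theorem act_ext (W' : C) [ExactPairing W W'] {V : C} {φ ψ : A ⊗ W ⟶ V}
    (h : ∀ X, act (b X) φ = act (b X) ψ) : φ = ψ := by
  apply (tensorRightHomEquiv A W W' V).injective
  apply U.hom_ext
  intro X
  have h1 := act_eq (W' := W') b φ X
  rw [h X, act_eq (W' := W') b ψ X, ← Category.assoc, ← Category.assoc,
    Iso.cancel_iso_inv_right] at h1
  exact h1.symm

theorem exists_act (W' : C) [ExactPairing W W'] {V : C} (a : ∀ X, F.obj X ⊗ W ⟶ F.obj X ⊗ V)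
    (ha : ∀ {X Y : D} (f : X ⟶ Y), F.map f ▷ W ≫ a Y = a X ≫ F.map f ▷ V) :
    ∃ φ : A ⊗ W ⟶ V, ∀ X, act (b X) φ = a X := by
  obtain ⟨φ, hφ⟩ := U.exists_hom
    (fun X => tensorRightHomEquiv (F.obj X) W W' (F.obj X ⊗ V) (a X) ≫ (α_ _ _ _).hom) (by
      intro X Y f
      simp only [tensorRightHomEquiv, Equiv.coe_fn_mk, Category.assoc]
      calc _ = 𝟙 _ ⊗≫ (F.map f ▷ 𝟙_ C ≫ F.obj Y ◁ η_ W W') ⊗≫ a Y ▷ W' ⊗≫ 𝟙 _ := by monoidal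
        _ = 𝟙 _ ⊗≫ (F.obj X ◁ η_ W W') ⊗≫ (F.map f ▷ W ≫ a Y) ▷ W' ⊗≫ 𝟙 _ := by
          rw [← whisker_exchange]; monoidal
        _ = _ := by rw [ha f]; monoidal)
  refine ⟨(tensorRightHomEquiv A W W' V).symm φ, fun X => ?_⟩
  apply (tensorRightHomEquiv (F.obj X) W W' (F.obj X ⊗ V)).injective
  have h1 := act_eq (W' := W') b ((tensorRightHomEquiv A W W' V).symm φ) X
  rw [Category.comp_id, Equiv.apply_symm_apply] at h1
  rw [h1, ← Category.assoc, hφ X]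
  simp

end

variable [BraidedCategory C] {G : E ⥤ C} {B : C} {d : ∀ Y, G.obj Y ⟶ G.obj Y ⊗ B}

include U

/-- For fixed `Y`, universality in `X` detects `push (d Y) φ`; universality in `Y` then detects `φ`.
-/
theorem pair_ext [RightRigidCategory C] (U' : Universal G B d) {V : C} {φ ψ : A ⊗ B ⟶ V}
    (h : ∀ X Y, pair (b X) (d Y) ≫ (F.obj X ⊗ G.obj Y) ◁ φ =
      pair (b X) (d Y) ≫ (F.obj X ⊗ G.obj Y) ◁ ψ) : φ = ψ := by
  have h1 : ∀ Y, push (d Y) φ = push (d Y) ψ := fun Y =>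
    U.act_ext (G.obj Y)ᘁ fun X => by
      have := h X Y
      rwa [pair_comp, pair_comp, Iso.cancel_iso_inv_right] at this
  have h2 : (β_ A B).inv ≫ φ = (β_ A B).inv ≫ ψ :=
    U'.act_ext Aᘁ fun Y => by
      have := h1 Y
      rwa [push_eq, push_eq, Iso.cancel_iso_hom_left] at this
  rwa [Iso.cancel_iso_inv_left] at h2

theorem exists_pair [RightRigidCategory C] (U' : Universal G B d) {V : C}
    (a : ∀ X Y, F.obj X ⊗ G.obj Y ⟶ (F.obj X ⊗ G.obj Y) ⊗ V)
    (ha : ∀ {X X' : D} (f : X ⟶ X') (Y : E),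
      F.map f ▷ G.obj Y ≫ a X' Y = a X Y ≫ (F.map f ▷ G.obj Y) ▷ V)
    (ha' : ∀ (X : D) {Y Y' : E} (g : Y ⟶ Y'),
      F.obj X ◁ G.map g ≫ a X Y' = a X Y ≫ (F.obj X ◁ G.map g) ▷ V) :
    ∃ φ : A ⊗ B ⟶ V, ∀ X Y, pair (b X) (d Y) ≫ (F.obj X ⊗ G.obj Y) ◁ φ = a X Y := by
  have h1 : ∀ Y, ∃ ψ : A ⊗ G.obj Y ⟶ G.obj Y ⊗ V,
      ∀ X, act (b X) ψ = a X Y ≫ (α_ _ _ _).hom := fun Y =>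
    U.exists_act (G.obj Y)ᘁ _ fun f => by
      rw [← Category.assoc, ha f Y]
      simp
  choose ψ hψ using h1
  obtain ⟨φ, hφ⟩ := U'.exists_act (W := A) Aᘁ (fun Y => (β_ A (G.obj Y)).inv ≫ ψ Y) (by
    -- The maps `ψ Y` were chosen separately for each `Y`; they are natural in `Y` because each is
    -- unique.
    intro Y Y' g
    have h2 : A ◁ G.map g ≫ ψ Y' = ψ Y ≫ G.map g ▷ V :=
      U.act_ext (G.obj Y)ᘁ fun X => by
        rw [act_whiskerLeft_comp, act_comp, hψ, hψ, ← Category.assoc, ha' X g]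
        simp
    rw [Category.assoc, ← h2, braiding_inv_naturality_left_assoc])
  refine ⟨(β_ A B).hom ≫ φ, fun X Y => ?_⟩
  rw [pair_comp, push_eq, Iso.inv_hom_id_assoc, hφ, Iso.hom_inv_id_assoc, hψ]
  simp

/-- Allows maps out of a triple tensor product to be tested on three variables, as associativity and
the hexagon identities require. -/
theorem tensor [RightRigidCategory C] (U' : Universal G B d) :
    Universal (F.prod G ⋙ MonoidalCategory.tensor C) (A ⊗ B)
      (fun Z => pair (b Z.1) (d Z.2)) where
  naturality f := pair_naturality (U.naturality f.1) (U'.naturality f.2)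
  hom_ext h := U.pair_ext U' fun X Y => h (X, Y)
  exists_hom a ha := by
    obtain ⟨φ, hφ⟩ := U.exists_pair U' (fun X Y => a (X, Y))
      (fun {X X'} f Y => by simpa using ha (X := (X, Y)) (Y := (X', Y)) (f, 𝟙 Y))
      (fun X {Y Y'} g => by simpa using ha (X := (X, Y)) (Y := (X, Y')) (𝟙 X, g))
    exact ⟨φ, fun Z => hφ Z.1 Z.2⟩

end Universal

end Universal

/-! ### From one variable to all tensor powers -/

section Powers

variable {D : Type u₂}

/-- Families on `Fin n → D` and `D` which correspond to a family on `Fin (n + 1) → D`. -/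
theorem exists_snoc_family {n : ℕ} {T : (Fin n → D) → D → Sort*}
    (a : ∀ Z : Fin (n + 1) → D, T (fun i => Z i.castSucc) (Z (Fin.last n))) :
    ∃ a' : ∀ X Y, T X Y, ∀ Z : Fin (n + 1) → D,
      a' (fun i => Z i.castSucc) (Z (Fin.last n)) = a Z := by
  have e : ∀ (X : Fin n → D) (Y : D), ∃ Z : Fin (n + 1) → D, ∃ t : T X Y,
      (fun i => Z i.castSucc) = X ∧ Z (Fin.last n) = Y ∧ t ≍ a Z := by
    intro X Y
    have h1 : (fun i => (Fin.snoc X Y : Fin (n + 1) → D) i.castSucc) = X := by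
      funext i; simp
    have h2 : (Fin.snoc X Y : Fin (n + 1) → D) (Fin.last n) = Y := by simp
    -- The restrictions of `Fin.snoc X Y` are identified with `X` and `Y` through the equations `h1`
    -- and `h2`, hence the cast.
    refine ⟨Fin.snoc X Y, cast (by rw [h1, h2]) (a (Fin.snoc X Y)), h1, h2, cast_heq _ _⟩
  choose z a' h1 h2 h3 using e
  refine ⟨a', fun Z => ?_⟩
  have hz : z (fun i => Z i.castSucc) (Z (Fin.last n)) = Z := by
    funext i
    refine Fin.lastCases ?_ (fun i => ?_) i
    · exact h2 _ _
    · exact congrFun (h1 (fun i => Z i.castSucc) (Z (Fin.last n))) i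
  have := h3 (fun i => Z i.castSucc) (Z (Fin.last n))
  rw [hz] at this
  exact eq_of_heq this

theorem exists_snoc {n : ℕ} (X : Fin n → D) (Y : D) :
    ∃ Z : Fin (n + 1) → D, X = (fun i => Z i.castSucc) ∧ Y = Z (Fin.last n) :=
  ⟨Fin.snoc X Y, by funext i; simp, by simp⟩

variable [Category.{v₂} D]

theorem exists_snoc_hom {n : ℕ} {Z Z' : Fin (n + 1) → D}
    (f : (fun i : Fin n => Z i.castSucc) ⟶ (fun i : Fin n => Z' i.castSucc))
    (g : Z (Fin.last n) ⟶ Z' (Fin.last n)) :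
    ∃ k : Z ⟶ Z', f = (fun i : Fin n => k i.castSucc) ∧ g = k (Fin.last n) := by
  refine ⟨fun i => Fin.lastCases (motive := fun i => Z i ⟶ Z' i) g f i, ?_, ?_⟩
  · funext i; simp
  · simp

variable {C : Type u₁} [Category.{v₁} C] [MonoidalCategory C] [BraidedCategory C]
  [RightRigidCategory C]

/-- A power of length `n + 1` is the pair of the power of length `n` with `F`. For `n = 0` the
source has a single object, and nothing but unitors is involved. -/
theorem Universal.tensorPower {F : D ⥤ C} {A : C} (β : F ⟶ F ⋙ tensorRight A)
    (U : Universal F A (fun X => β.app X)) (n : ℕ) :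
    Universal (tensorPower F n) (objPower A n) (powerCoaction F A β n) := by
  induction n with
  | zero =>
    refine ⟨fun f => powerCoaction_naturality F A β 0 f, fun {V φ ψ} h => ?_, fun {V} a ha => ?_⟩
    · have h0 : (λ_ (𝟙_ C)).inv ≫ 𝟙_ C ◁ φ = (λ_ (𝟙_ C)).inv ≫ 𝟙_ C ◁ ψ := h (fun i => i.elim0)
      rw [Iso.cancel_iso_inv_left] at h0
      exact (whiskerLeft_iff _ _).1 h0
    · let a0 : 𝟙_ C ⟶ 𝟙_ C ⊗ V := a (fun i => i.elim0)
      refine ⟨a0 ≫ (λ_ V).hom, fun X => ?_⟩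
      have hX : X = fun i => i.elim0 := funext fun i => i.elim0
      subst hX
      change (λ_ (𝟙_ C)).inv ≫ 𝟙_ C ◁ (a0 ≫ (λ_ V).hom) = a0
      have : a0 = (λ_ (𝟙_ C)).inv ≫ 𝟙_ C ◁ a0 ≫ (λ_ _).hom := by simp
      conv_rhs => rw [this]
      monoidal
  | succ n ih =>
    refine ⟨fun f => powerCoaction_naturality F A β (n + 1) f, fun {V φ ψ} h => ?_,
      fun {V} a ha => ?_⟩
    · refine ih.pair_ext U fun X Y => ?_
      obtain ⟨Z, rfl, rfl⟩ := exists_snoc X Y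
      exact h Z
    · obtain ⟨a', ha'⟩ := exists_snoc_family (T := fun X Y => ((BraidedReconstruction.tensorPower F n).obj X ⊗ F.obj Y ⟶
        ((BraidedReconstruction.tensorPower F n).obj X ⊗ F.obj Y) ⊗ V)) a
      have nat : ∀ {X X' : Fin n → D} {Y Y' : D} (f : X ⟶ X') (g : Y ⟶ Y'),
          ((BraidedReconstruction.tensorPower F n).map f ⊗ₘ F.map g) ≫ a' X' Y' =
            a' X Y ≫ ((BraidedReconstruction.tensorPower F n).map f ⊗ₘ F.map g) ▷ V := by
        intro X X' Y Y' f g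
        obtain ⟨Z, rfl, rfl⟩ := exists_snoc X Y
        obtain ⟨Z', rfl, rfl⟩ := exists_snoc X' Y'
        obtain ⟨k, rfl, rfl⟩ := exists_snoc_hom f g
        rw [ha', ha']
        exact ha k
      obtain ⟨φ, hφ⟩ := ih.exists_pair U a' (fun f Y => by simpa using nat f (𝟙 Y))
        (fun X {Y Y'} g => by simpa using nat (𝟙 X) g)
      refine ⟨φ, fun Z => ?_⟩
      rw [← ha' Z]
      exact hφ _ _

theorem Universal.isRepresentedBy {F : D ⥤ C} {A : C} (β : F ⟶ F ⋙ tensorRight A)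
    (U : Universal F A (fun X => β.app X)) : IsRepresentedBy F A β := by
  intro n V
  have h := U.tensorPower β n
  constructor
  · intro φ ψ hφ
    exact h.hom_ext fun X => congrArg (fun t => t.app X) hφ
  · intro t
    obtain ⟨φ, hφ⟩ := h.exists_hom (fun X => t.app X) (fun f => t.naturality f)
    refine ⟨φ, ?_⟩
    ext X
    exact hφ X

-- Only `n = 1` is used. As `objPower A 1` is `𝟙_ C ⊗ A` and not `A`, left unitors have to be
-- removed on both sides.
omit [RightRigidCategory C] in
theorem IsRepresentedBy.universal {F : D ⥤ C} {A : C} {β : F ⟶ F ⋙ tensorRight A}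
    (h : IsRepresentedBy F A β) : Universal F A (fun X => β.app X) := by
  have key : ∀ {V : C} (φ : A ⟶ V) (Z : Fin 1 → D),
      (theta F A β 1 V ((λ_ A).hom ≫ φ)).app Z =
        (λ_ (F.obj (Z 0))).hom ≫ (β.app (Z 0) ≫ F.obj (Z 0) ◁ φ) ≫
          (λ_ (F.obj (Z 0))).inv ▷ V := by
    intro V φ Z
    change (((λ_ (𝟙_ C)).inv ⊗ₘ β.app (Z 0)) ≫ tensorμ (𝟙_ C) (𝟙_ C) (F.obj (Z 0)) A) ≫
      (𝟙_ C ⊗ F.obj (Z 0)) ◁ ((λ_ A).hom ≫ φ) = _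
    have h2 : ((λ_ (𝟙_ C)).inv ⊗ₘ β.app (Z 0)) ≫ tensorμ (𝟙_ C) (𝟙_ C) (F.obj (Z 0)) A =
        pair (λ_ (𝟙_ C)).inv (β.app (Z 0)) := rfl
    have h3 : push (β.app (Z 0)) ((λ_ A).hom ≫ φ) =
        (λ_ _).hom ≫ β.app (Z 0) ≫ F.obj (Z 0) ◁ φ := by
      simp only [push, braiding_tensorUnit_left]
      simp
    rw [h2, pair_comp, h3, act]
    simp
  refine ⟨fun f => β.naturality f, fun {V φ ψ} hφ => ?_, fun {V} a ha => ?_⟩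
  · have h1 := (h 1 V).1 (a₁ := (λ_ A).hom ≫ φ) (a₂ := (λ_ A).hom ≫ ψ) (by
      ext Z
      rw [key, key, hφ])
    exact (cancel_epi (λ_ A).hom).1 h1
  · have nat : ∀ {X Y : D} (f : X ⟶ Y), (𝟙 (𝟙_ C) ⊗ₘ F.map f) ≫
        (λ_ (F.obj Y)).hom ≫ a Y ≫ (λ_ (F.obj Y)).inv ▷ V =
          ((λ_ (F.obj X)).hom ≫ a X ≫ (λ_ (F.obj X)).inv ▷ V) ≫ (𝟙 (𝟙_ C) ⊗ₘ F.map f) ▷ V := by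
      intro X Y f
      rw [id_tensorHom, leftUnitor_naturality_assoc, reassoc_of% ha f]
      monoidal
    let t : tensorPower F 1 ⟶ tensorPower F 1 ⋙ tensorRight V :=
      { app := fun Z => (λ_ (F.obj (Z 0))).hom ≫ a (Z 0) ≫ (λ_ (F.obj (Z 0))).inv ▷ V
        naturality := fun Z Z' f => nat (f 0) }
    obtain ⟨φ, hφ⟩ := (h 1 V).2 t
    change 𝟙_ C ⊗ A ⟶ V at φ
    obtain ⟨φ, rfl⟩ : ∃ φ', φ = (λ_ A).hom ≫ φ' := ⟨(λ_ A).inv ≫ φ, by simp⟩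
    refine ⟨φ, fun X => ?_⟩
    have h1 := congrArg (fun s => s.app (fun _ => X)) hφ
    have h3 := (key φ (fun _ => X)).symm.trans h1
    have h4 := (cancel_epi (λ_ (F.obj X)).hom).1 h3
    exact (cancel_mono ((λ_ (F.obj X)).inv ▷ V)).1 h4

end Powers

/-! ### Coherence of paired coactions -/

section Pairs

variable {C : Type u₁} [Category.{v₁} C] [MonoidalCategory C] [BraidedCategory C]

theorem pair_leftUnitor {Q B V : C} (q : Q ⟶ Q ⊗ B) (φ : 𝟙_ C ⊗ B ⟶ V) :
    pair (λ_ (𝟙_ C)).inv q ≫ (𝟙_ C ⊗ Q) ◁ φ =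
      (λ_ Q).hom ≫ (q ≫ Q ◁ ((λ_ B).inv ≫ φ)) ≫ (λ_ Q).inv ▷ V := by
  simp only [pair_comp, push, braiding_tensorUnit_left, act]
  monoidal

theorem pair_rightUnitor {Q B V : C} (q : Q ⟶ Q ⊗ B) (φ : B ⊗ 𝟙_ C ⟶ V) :
    pair q (λ_ (𝟙_ C)).inv ≫ (Q ⊗ 𝟙_ C) ◁ φ =
      (ρ_ Q).hom ≫ (q ≫ Q ◁ ((ρ_ B).inv ≫ φ)) ≫ (ρ_ Q).inv ▷ V := by
  simp only [pair_comp, push, braiding_tensorUnit_right, act]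
  monoidal

theorem pair_assoc {P Q S A B E : C} (p : P ⟶ P ⊗ A) (q : Q ⟶ Q ⊗ B) (s : S ⟶ S ⊗ E) :
    pair (pair p q) s ≫ ((α_ P Q S).hom ⊗ₘ (α_ A B E).hom) =
      (α_ P Q S).hom ≫ pair p (pair q s) := by
  have h := tensor_associativity P A Q B S E
  have h1 : pair (pair p q) s = ((p ⊗ₘ q) ⊗ₘ s) ≫ tensorμ P A Q B ▷ (S ⊗ E) ≫
      tensorμ (P ⊗ Q) (A ⊗ B) S E := by
    simp only [pair, MonoidalCategory.tensorHom_def, comp_whiskerRight, Category.assoc]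
    rw [whisker_exchange_assoc]
  have h2 : pair p (pair q s) = (p ⊗ₘ (q ⊗ₘ s)) ≫ (P ⊗ A) ◁ tensorμ Q B S E ≫
      tensorμ P A (Q ⊗ S) (B ⊗ E) := by
    simp only [pair, MonoidalCategory.tensorHom_def, whiskerLeft_comp, Category.assoc]
  rw [h1, h2, Category.assoc, Category.assoc, h]
  simp

/-- Rests on the associativity of the middle exchange, `associator_monoidal`. It is the source of
the braiding in the tensor product coproduct. -/
theorem pair_pair {P Q A B A' B' : C} (p : P ⟶ P ⊗ A) (q : Q ⟶ Q ⊗ B)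
    (p' : P ⟶ P ⊗ A') (q' : Q ⟶ Q ⊗ B') :
    pair p q ≫ pair p' q' ▷ (A ⊗ B) ≫ (α_ _ _ _).hom =
      pair (p ≫ p' ▷ A ≫ (α_ P A' A).hom) (q ≫ q' ▷ B ≫ (α_ Q B' B).hom) ≫
        (P ⊗ Q) ◁ tensorμ A' A B' B := by
  have h := associator_monoidal P A' A Q B' B
  have h2 := tensorμ_natural p' (𝟙 A) q' (𝟙 B)
  rw [id_tensorHom_id, tensorHom_id, tensorHom_id, tensorHom_id] at h2
  simp only [pair, comp_whiskerRight, Category.assoc]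
  rw [← reassoc_of% h2, h]
  simp only [tensorHom_comp_tensorHom_assoc]

end Pairs

/-! ### Coactions -/

section Coaction

variable {C : Type u₁} [Category.{v₁} C] [MonoidalCategory C]

/-- `p` is a right coaction of the comonoid `A`. -/
structure IsCoaction {P A : C} (d : A ⟶ A ⊗ A) (e : A ⟶ 𝟙_ C) (p : P ⟶ P ⊗ A) : Prop where
  comul : p ≫ P ◁ d = p ≫ p ▷ A ≫ (α_ P A A).hom
  counit : p ≫ P ◁ e = (ρ_ P).inv

theorem IsCoaction.of_iso {P Q A : C} {d : A ⟶ A ⊗ A} {e : A ⟶ 𝟙_ C} {p : P ⟶ P ⊗ A}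
    (h : IsCoaction d e p) (i : Q ≅ P) : IsCoaction d e (i.hom ≫ p ≫ i.inv ▷ A) where
  comul := by
    calc _ = i.hom ≫ (p ≫ P ◁ d) ≫ i.inv ▷ (A ⊗ A) := by
          simp only [Category.assoc]; rw [whisker_exchange]
      _ = i.hom ≫ (p ≫ (i.inv ≫ i.hom) ▷ A ≫ p ▷ A ≫ (α_ P A A).hom) ≫ i.inv ▷ (A ⊗ A) := by
          rw [h.comul, Iso.inv_hom_id, id_whiskerRight, Category.id_comp]
      _ = _ := by monoidal
  counit := by
    simp only [Category.assoc]
    rw [← whisker_exchange, reassoc_of% h.counit]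
    simp

end Coaction

/-! ### Reconstruction of the bialgebra -/

section Bialgebra

variable {C : Type u₁} [Category.{v₁} C] [MonoidalCategory C]
  {D : Type u₂} [Category.{v₂} D] [MonoidalCategory D] (F : D ⥤ C) [F.Monoidal] {A : C}

/-- The map on `F X ⊗ F Y` given by a family of maps `F X ⟶ F X ⊗ A` at `X ⊗ Y`. -/
def tensorFamily (b : ∀ X, F.obj X ⟶ F.obj X ⊗ A) (X Y : D) :
    F.obj X ⊗ F.obj Y ⟶ (F.obj X ⊗ F.obj Y) ⊗ A :=
  Functor.LaxMonoidal.μ F X Y ≫ b (X ⊗ Y) ≫ Functor.OplaxMonoidal.δ F X Y ▷ A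

/-- The map on the unit object given by a family of maps `F X ⟶ F X ⊗ A`. -/
def unitFamily (b : ∀ X, F.obj X ⟶ F.obj X ⊗ A) : 𝟙_ C ⟶ 𝟙_ C ⊗ A :=
  Functor.LaxMonoidal.ε F ≫ b (𝟙_ D) ≫ Functor.OplaxMonoidal.η F ▷ A

variable {F} in
theorem tensorFamily_comp_μ (b : ∀ X, F.obj X ⟶ F.obj X ⊗ A) (X Y : D) :
    Functor.LaxMonoidal.μ F X Y ≫ b (X ⊗ Y) =
      tensorFamily F b X Y ≫ Functor.LaxMonoidal.μ F X Y ▷ A := by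
  simp [tensorFamily, ← comp_whiskerRight]

variable {F} in
theorem unitFamily_comp_ε (b : ∀ X, F.obj X ⟶ F.obj X ⊗ A) :
    Functor.LaxMonoidal.ε F ≫ b (𝟙_ D) = unitFamily F b ≫ Functor.LaxMonoidal.ε F ▷ A := by
  simp [unitFamily, ← comp_whiskerRight]

variable [BraidedCategory C]

/-- The structure maps `d`, `e`, `m`, `u` on `A` are those given by the family `b` of coactions. -/
structure Reconstructs (b : ∀ X, F.obj X ⟶ F.obj X ⊗ A) (d : A ⟶ A ⊗ A) (e : A ⟶ 𝟙_ C)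
    (m : A ⊗ A ⟶ A) (u : 𝟙_ C ⟶ A) : Prop where
  coaction (X : D) : IsCoaction d e (b X)
  mul (X Y : D) : pair (b X) (b Y) ≫ (F.obj X ⊗ F.obj Y) ◁ m = tensorFamily F b X Y
  one : (λ_ (𝟙_ C)).inv ≫ 𝟙_ C ◁ u = unitFamily F b

variable {F} {b : ∀ X, F.obj X ⟶ F.obj X ⊗ A} (U : Universal F A b)

include U in
-- Three of the structure maps represent natural families. The unit needs no universality: a map `𝟙_
-- C ⟶ 𝟙_ C ⊗ A` already is a map into `A`.
theorem Universal.exists_reconstructs [RightRigidCategory C] :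
    ∃ d e m u, Reconstructs F b d e m u := by
  obtain ⟨d, hd⟩ := U.exists_hom (fun X => b X ≫ b X ▷ A ≫ (α_ _ _ _).hom) (fun f => by
    rw [reassoc_of% U.naturality f, ← comp_whiskerRight_assoc, U.naturality f]; simp)
  obtain ⟨e, he⟩ := U.exists_hom (fun X => (ρ_ (F.obj X)).inv) (fun f => by simp)
  obtain ⟨m, hm⟩ := U.exists_pair U (tensorFamily F b)
    (fun f Y => by
      simp only [tensorFamily, Functor.LaxMonoidal.μ_natural_left_assoc, Category.assoc]
      rw [reassoc_of% U.naturality (f ▷ Y), ← comp_whiskerRight, ← comp_whiskerRight,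
        Functor.OplaxMonoidal.δ_natural_left])
    (fun X Y Y' f => by
      simp only [tensorFamily, Functor.LaxMonoidal.μ_natural_right_assoc, Category.assoc]
      rw [reassoc_of% U.naturality (X ◁ f), ← comp_whiskerRight, ← comp_whiskerRight,
        Functor.OplaxMonoidal.δ_natural_right])
  refine ⟨d, e, m, unitFamily F b ≫ (λ_ A).hom, fun X => ⟨hd X, he X⟩, hm, ?_⟩
  rw [whiskerLeft_comp]
  have : unitFamily F b = (λ_ (𝟙_ C)).inv ≫ 𝟙_ C ◁ unitFamily F b ≫ (λ_ _).hom := by simp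
  conv_rhs => rw [this]
  monoidal

variable {d : A ⟶ A ⊗ A} {e : A ⟶ 𝟙_ C} {m : A ⊗ A ⟶ A} {u : 𝟙_ C ⟶ A}

namespace Reconstructs

variable (h : Reconstructs F b d e m u)

include h

theorem tensorFamily_coaction (X Y : D) : IsCoaction d e (tensorFamily F b X Y) :=
  (h.coaction (X ⊗ Y)).of_iso (Functor.Monoidal.μIso F X Y)

theorem unitFamily_coaction : IsCoaction d e (unitFamily F b) :=
  (h.coaction (𝟙_ D)).of_iso (Functor.Monoidal.εIso F)

theorem one_eq : u = unitFamily F b ≫ (λ_ A).hom := by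
  rw [← h.one]; simp

include U

/-- Both sides represent the threefold iterated coaction. -/
theorem comul_assoc : d ≫ A ◁ d = d ≫ d ▷ A ≫ (α_ A A A).hom := by
  refine U.hom_ext fun X => ?_
  have h1 := (h.coaction X).comul
  simp only [whiskerLeft_comp]
  rw [reassoc_of% h1]
  calc _ = b X ≫ (b X ▷ A ≫ (F.obj X ⊗ A) ◁ d) ⊗≫ 𝟙 _ := by monoidal
    _ = (b X ≫ F.obj X ◁ d) ≫ b X ▷ (A ⊗ A) ≫ (α_ _ _ _).hom := by
      rw [← whisker_exchange]; monoidal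
    _ = b X ≫ (b X ≫ b X ▷ A ≫ (α_ _ _ _).hom) ▷ A ≫ (α_ _ _ _).hom ≫
        F.obj X ◁ (α_ _ _ _).hom := by
      rw [h1]; monoidal
    _ = _ := by rw [← h1]; simp only [comp_whiskerRight, Category.assoc]; rw [reassoc_of% h1]; monoidal

theorem counit_comul : d ≫ e ▷ A = (λ_ A).inv := by
  refine U.hom_ext fun X => ?_
  rw [whiskerLeft_comp, reassoc_of% (h.coaction X).comul]
  calc _ = b X ≫ (b X ≫ F.obj X ◁ e) ▷ A ⊗≫ 𝟙 _ := by monoidal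
    _ = _ := by rw [(h.coaction X).counit]; monoidal

theorem comul_counit : d ≫ A ◁ e = (ρ_ A).inv := by
  refine U.hom_ext fun X => ?_
  rw [whiskerLeft_comp, reassoc_of% (h.coaction X).comul]
  calc _ = b X ≫ (b X ▷ A ≫ (F.obj X ⊗ A) ◁ e) ⊗≫ 𝟙 _ := by monoidal
    _ = (b X ≫ F.obj X ◁ e) ≫ b X ▷ 𝟙_ C ⊗≫ 𝟙 _ := by
      rw [← whisker_exchange]; monoidal
    _ = _ := by rw [(h.coaction X).counit]; monoidal

/-- Naturality of `b` at the left unitor of `D`: on `𝟙_ ⊗ X` the coaction is computed by `m`, and on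
`𝟙_` it is given by `u`. -/
theorem one_mul : u ▷ A ≫ m = (λ_ A).hom := by
  suffices hs : (λ_ A).inv ≫ u ▷ A ≫ m = 𝟙 A by
    rw [← cancel_epi (λ_ A).inv, hs]; simp
  refine U.hom_ext fun X => ?_
  have h1 : pair (unitFamily F b) (b X) ≫ (𝟙_ C ⊗ F.obj X) ◁ m =
      (λ_ _).hom ≫ (b X ≫ F.obj X ◁ ((λ_ A).inv ≫ u ▷ A ≫ m)) ≫ (λ_ _).inv ▷ A := by
    rw [← pair_leftUnitor, whiskerLeft_comp, ← h.one]
    have := pair_whiskerLeft_tensorHom (λ_ (𝟙_ C)).inv (b X) u (𝟙 A)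
    rw [tensorHom_id] at this
    rw [reassoc_of% this]
    simp
  have h2 := pair_naturality (unitFamily_comp_ε b) (f := Functor.LaxMonoidal.ε F) (p' := b (𝟙_ D))
    (q := b X) (q' := b X) (g := 𝟙 _) (by simp)
  have h3 := h.mul (𝟙_ D) X
  have h4 : (λ_ (F.obj X)).inv ≫ (Functor.LaxMonoidal.ε F ⊗ₘ 𝟙 (F.obj X)) ≫
      Functor.LaxMonoidal.μ F (𝟙_ D) X = F.map (λ_ X).inv := by
    simp
  have h5 := U.naturality (λ_ X).inv
  rw [← h4] at h5
  simp only [Category.assoc] at h5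
  rw [tensorFamily_comp_μ, ← h3, Category.assoc, reassoc_of% h2, ← whisker_exchange_assoc,
    reassoc_of% h1] at h5
  have h6 : IsIso ((λ_ (F.obj X)).inv ≫
      (Functor.LaxMonoidal.ε F ⊗ₘ 𝟙 (F.obj X)) ≫ Functor.LaxMonoidal.μ F (𝟙_ D) X) := by
    rw [h4]; infer_instance
  rw [Iso.inv_hom_id_assoc] at h5
  rw [← cancel_mono (((λ_ (F.obj X)).inv ≫
      (Functor.LaxMonoidal.ε F ⊗ₘ 𝟙 (F.obj X)) ≫ Functor.LaxMonoidal.μ F (𝟙_ D) X) ▷ A)]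
  simp only [Category.assoc, comp_whiskerRight, whiskerLeft_id, Category.id_comp,
    whiskerLeft_comp] at h5 ⊢
  exact h5

theorem mul_one : A ◁ u ≫ m = (ρ_ A).hom := by
  suffices hs : (ρ_ A).inv ≫ A ◁ u ≫ m = 𝟙 A by
    rw [← cancel_epi (ρ_ A).inv, hs]; simp
  refine U.hom_ext fun X => ?_
  have h1 : pair (b X) (unitFamily F b) ≫ (F.obj X ⊗ 𝟙_ C) ◁ m =
      (ρ_ _).hom ≫ (b X ≫ F.obj X ◁ ((ρ_ A).inv ≫ A ◁ u ≫ m)) ≫ (ρ_ _).inv ▷ A := by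
    rw [← pair_rightUnitor, whiskerLeft_comp, ← h.one]
    have := pair_whiskerLeft_tensorHom (b X) (λ_ (𝟙_ C)).inv (𝟙 A) u
    rw [id_tensorHom] at this
    rw [reassoc_of% this]
    simp
  have h2 := pair_naturality (p := b X) (p' := b X) (f := 𝟙 _) (by simp) (unitFamily_comp_ε b)
    (g := Functor.LaxMonoidal.ε F) (q' := b (𝟙_ D))
  have h3 := h.mul X (𝟙_ D)
  have h4 : (ρ_ (F.obj X)).inv ≫ (𝟙 (F.obj X) ⊗ₘ Functor.LaxMonoidal.ε F) ≫
      Functor.LaxMonoidal.μ F X (𝟙_ D) = F.map (ρ_ X).inv := by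
    simp
  have h5 := U.naturality (ρ_ X).inv
  rw [← h4] at h5
  simp only [Category.assoc] at h5
  rw [tensorFamily_comp_μ, ← h3, Category.assoc, reassoc_of% h2, ← whisker_exchange_assoc,
    reassoc_of% h1] at h5
  have h6 : IsIso ((ρ_ (F.obj X)).inv ≫
      (𝟙 (F.obj X) ⊗ₘ Functor.LaxMonoidal.ε F) ≫ Functor.LaxMonoidal.μ F X (𝟙_ D)) := by
    rw [h4]; infer_instance
  rw [Iso.inv_hom_id_assoc] at h5
  rw [← cancel_mono (((ρ_ (F.obj X)).inv ≫
      (𝟙 (F.obj X) ⊗ₘ Functor.LaxMonoidal.ε F) ≫ Functor.LaxMonoidal.μ F X (𝟙_ D)) ▷ A)]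
  simp only [Category.assoc, comp_whiskerRight, whiskerLeft_id, Category.id_comp,
    whiskerLeft_comp] at h5 ⊢
  exact h5

/-- This and `mul_comul` are the two coaction laws for `X ⊗ Y`, read through `m`. -/
theorem mul_counit [RightRigidCategory C] : m ≫ e = (e ⊗ₘ e) ≫ (λ_ (𝟙_ C)).hom := by
  refine U.pair_ext U fun X Y => ?_
  rw [whiskerLeft_comp, reassoc_of% h.mul X Y, (h.tensorFamily_coaction X Y).counit,
    whiskerLeft_comp, reassoc_of% pair_whiskerLeft_tensorHom, (h.coaction X).counit,
    (h.coaction Y).counit]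
  simp only [pair, tensorμ, braiding_tensorUnit_left]
  monoidal

theorem mul_comul [RightRigidCategory C] :
    m ≫ d = (d ⊗ₘ d) ≫ tensorμ A A A A ≫ (m ⊗ₘ m) := by
  refine U.pair_ext U fun X Y => ?_
  rw [whiskerLeft_comp, reassoc_of% h.mul X Y, (h.tensorFamily_coaction X Y).comul, ← h.mul,
    whiskerLeft_comp, reassoc_of% pair_whiskerLeft_tensorHom, whiskerLeft_comp,
    (h.coaction X).comul, (h.coaction Y).comul, ← reassoc_of% pair_pair]
  simp only [MonoidalCategory.tensorHom_def', whiskerLeft_comp, comp_whiskerRight, Category.assoc]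
  rw [whisker_exchange_assoc]
  monoidal

omit U in
theorem one_counit : u ≫ e = 𝟙 (𝟙_ C) := by
  have h1 := h.unitFamily_coaction.counit
  rw [← h.one] at h1
  rw [← whiskerLeft_iff, whiskerLeft_comp, ← cancel_epi (λ_ (𝟙_ C)).inv]
  simpa [unitors_inv_equal] using h1

omit U in
theorem one_comul : u ≫ d = (λ_ (𝟙_ C)).inv ≫ (u ⊗ₘ u) := by
  have h1 := h.unitFamily_coaction.comul
  rw [← h.one] at h1
  rw [← whiskerLeft_iff, whiskerLeft_comp, ← cancel_epi (λ_ (𝟙_ C)).inv]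
  simp only [Category.assoc] at h1
  rw [h1, MonoidalCategory.tensorHom_def']
  monoidal

omit U in
theorem pair_pair_mul_left (X Y S : D) :
    (pair (pair (b X) (b Y)) (b S) ≫ ((F.obj X ⊗ F.obj Y) ⊗ F.obj S) ◁ (m ▷ A ≫ m)) ≫
      (Functor.LaxMonoidal.μ F X Y ▷ F.obj S ≫ Functor.LaxMonoidal.μ F (X ⊗ Y) S) ▷ A =
    (Functor.LaxMonoidal.μ F X Y ▷ F.obj S ≫ Functor.LaxMonoidal.μ F (X ⊗ Y) S) ≫
      b ((X ⊗ Y) ⊗ S) := by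
  have h1 := pair_whiskerLeft_tensorHom (pair (b X) (b Y)) (b S) m (𝟙 A)
  rw [tensorHom_id, whiskerLeft_id, Category.comp_id, h.mul] at h1
  have h2 := pair_naturality (tensorFamily_comp_μ b X Y) (q := b S) (q' := b S) (g := 𝟙 _) (by simp)
  rw [tensorHom_id] at h2
  have h3 := tensorFamily_comp_μ b (X ⊗ Y) S
  rw [← h.mul, Category.assoc] at h3
  rw [whiskerLeft_comp, reassoc_of% h1, comp_whiskerRight, Category.assoc, Category.assoc,
    whisker_exchange_assoc, ← reassoc_of% h2, h3]

omit U in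
theorem pair_pair_mul_right (X Y S : D) :
    (pair (b X) (pair (b Y) (b S)) ≫ (F.obj X ⊗ F.obj Y ⊗ F.obj S) ◁ (A ◁ m ≫ m)) ≫
      (F.obj X ◁ Functor.LaxMonoidal.μ F Y S ≫ Functor.LaxMonoidal.μ F X (Y ⊗ S)) ▷ A =
    (F.obj X ◁ Functor.LaxMonoidal.μ F Y S ≫ Functor.LaxMonoidal.μ F X (Y ⊗ S)) ≫
      b (X ⊗ Y ⊗ S) := by
  have h1 := pair_whiskerLeft_tensorHom (b X) (pair (b Y) (b S)) (𝟙 A) m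
  rw [id_tensorHom, whiskerLeft_id, Category.comp_id, h.mul] at h1
  have h2 := pair_naturality (p := b X) (p' := b X) (f := 𝟙 _) (by simp) (tensorFamily_comp_μ b Y S)
  rw [id_tensorHom] at h2
  have h3 := tensorFamily_comp_μ b X (Y ⊗ S)
  rw [← h.mul, Category.assoc] at h3
  rw [whiskerLeft_comp, reassoc_of% h1, comp_whiskerRight, Category.assoc, Category.assoc,
    whisker_exchange_assoc, ← reassoc_of% h2, h3]

/-- Naturality of `b` at the associator of `D`, tested on three variables. -/
theorem mul_assoc [RightRigidCategory C] : m ▷ A ≫ m = (α_ A A A).hom ≫ A ◁ m ≫ m := by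
  refine (U.tensor U).pair_ext U fun Z S => ?_
  obtain ⟨X, Y⟩ := Z
  change pair (pair (b X) (b Y)) (b S) ≫ ((F.obj X ⊗ F.obj Y) ⊗ F.obj S) ◁ (m ▷ A ≫ m) =
    pair (pair (b X) (b Y)) (b S) ≫ ((F.obj X ⊗ F.obj Y) ⊗ F.obj S) ◁
      ((α_ A A A).hom ≫ A ◁ m ≫ m)
  have hl := h.pair_pair_mul_left X Y S
  have hr := h.pair_pair_mul_right X Y S
  have ha := Functor.LaxMonoidal.associativity F X Y S
  have hn := U.naturality (α_ X Y S).hom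
  have hp := pair_assoc (b X) (b Y) (b S)
  rw [← cancel_mono ((α_ (F.obj X) (F.obj Y) (F.obj S)).hom ▷ A),
    ← cancel_mono ((F.obj X ◁ Functor.LaxMonoidal.μ F Y S ≫ Functor.LaxMonoidal.μ F X (Y ⊗ S)) ▷ A)]
  rw [Category.assoc, ← comp_whiskerRight, ← ha]
  have e1 : (pair (pair (b X) (b Y)) (b S) ≫ ((F.obj X ⊗ F.obj Y) ⊗ F.obj S) ◁
      ((α_ A A A).hom ≫ A ◁ m ≫ m)) ≫ (α_ (F.obj X) (F.obj Y) (F.obj S)).hom ▷ A =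
      (α_ (F.obj X) (F.obj Y) (F.obj S)).hom ≫
        pair (b X) (pair (b Y) (b S)) ≫ (F.obj X ⊗ F.obj Y ⊗ F.obj S) ◁ (A ◁ m ≫ m) := by
    rw [← reassoc_of% hp, MonoidalCategory.tensorHom_def', whiskerLeft_comp, Category.assoc, Category.assoc,
      Category.assoc, whisker_exchange]
  rw [e1]
  simp only [Category.assoc, comp_whiskerRight] at ha hl hr ⊢
  rw [hr, reassoc_of% hl, ← hn, reassoc_of% ha]

end Reconstructs

end Bialgebra

/-! ### Transposes of coactions under duality -/

section Mates

variable {C : Type u₁} [Category.{v₁} C] [MonoidalCategory C] {P Q A : C} [ExactPairing P Q]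

/-- The map `P ⟶ P ⊗ A` which corresponds to `s : Q ⟶ A ⊗ Q` by duality. -/
def coactionMate (s : Q ⟶ A ⊗ Q) : P ⟶ P ⊗ A :=
  (λ_ P).inv ≫ η_ P Q ▷ P ≫ (α_ P Q P).hom ≫ P ◁ (s ▷ P ≫ (α_ A Q P).hom ≫ A ◁ ε_ P Q ≫ (ρ_ A).hom)

/-- Transposing twice gives back `s`, by two zigzags. The transposition on the left is the one which
opens `dualCoaction`. -/
theorem coactionMate_adjoint (s : Q ⟶ A ⊗ Q) :
    (ρ_ Q).inv ≫ Q ◁ η_ P Q ≫ Q ◁ (coactionMate (P := P) s ▷ Q) ≫ Q ◁ (α_ P A Q).hom ≫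
      (α_ Q P (A ⊗ Q)).inv ≫ ε_ P Q ▷ (A ⊗ Q) ≫ (λ_ (A ⊗ Q)).hom = s := by
  have hz' : Q ◁ η_ P Q ⊗≫ ε_ P Q ▷ Q = ⊗𝟙.hom :=
    ExactPairing.coevaluation_evaluation'' P Q
  simp only [coactionMate]
  calc
    _ = 𝟙 _ ⊗≫ Q ◁ (𝟙_ C ◁ η_ P Q ≫ η_ P Q ▷ (P ⊗ Q)) ⊗≫ Q ◁ P ◁ s ▷ (P ⊗ Q) ⊗≫
        Q ◁ P ◁ A ◁ ε_ P Q ▷ Q ⊗≫ ε_ P Q ▷ (A ⊗ Q) ⊗≫ 𝟙 _ := by monoidal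
    _ = 𝟙 _ ⊗≫ Q ◁ η_ P Q ⊗≫ Q ◁ P ◁ (Q ◁ η_ P Q ≫ s ▷ (P ⊗ Q)) ⊗≫
        Q ◁ P ◁ A ◁ ε_ P Q ▷ Q ⊗≫ ε_ P Q ▷ (A ⊗ Q) ⊗≫ 𝟙 _ := by
      rw [whisker_exchange]; monoidal
    _ = 𝟙 _ ⊗≫ Q ◁ η_ P Q ⊗≫ Q ◁ P ◁ s ⊗≫
        Q ◁ P ◁ A ◁ (Q ◁ η_ P Q ⊗≫ ε_ P Q ▷ Q) ⊗≫ ε_ P Q ▷ (A ⊗ Q) ⊗≫ 𝟙 _ := by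
      rw [whisker_exchange]; monoidal
    _ = 𝟙 _ ⊗≫ Q ◁ η_ P Q ⊗≫ ((Q ⊗ P) ◁ s ≫ ε_ P Q ▷ (A ⊗ Q)) ⊗≫ 𝟙 _ := by
      rw [hz']; monoidal
    _ = 𝟙 _ ⊗≫ (Q ◁ η_ P Q ⊗≫ ε_ P Q ▷ Q) ⊗≫ s := by
      rw [whisker_exchange]; monoidal
    _ = s := by rw [hz']; monoidal

variable {m : A ⊗ A ⟶ A} {u : 𝟙_ C ⟶ A} {p : P ⟶ P ⊗ A} {s : Q ⟶ A ⊗ Q}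

/-- If the evaluation is equivariant, the transpose of the coaction on the dual is inverse to `p` on
one side; `coactionMate_comp` gets the other side from the coevaluation. These become the two
antipode identities. -/
theorem comp_coactionMate (h : (s ⊗ₘ p) ≫ (α_ A Q (P ⊗ A)).hom ≫ A ◁ (α_ Q P A).inv ≫
      A ◁ (ε_ P Q ▷ A) ≫ A ◁ (λ_ A).hom ≫ m = ε_ P Q ≫ u) :
    p ≫ coactionMate s ▷ A ≫ (α_ P A A).hom ≫ P ◁ m = (ρ_ P).inv ≫ P ◁ u := by
  have hz : η_ P Q ▷ P ⊗≫ P ◁ ε_ P Q = ⊗𝟙.hom :=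
    ExactPairing.evaluation_coevaluation'' P Q
  simp only [coactionMate]
  rw [MonoidalCategory.tensorHom_def'] at h
  calc
    _ = 𝟙 _ ⊗≫ (𝟙_ C ◁ p ≫ η_ P Q ▷ (P ⊗ A)) ⊗≫ P ◁ (s ▷ (P ⊗ A) ≫ (α_ A Q (P ⊗ A)).hom ≫
        A ◁ (α_ Q P A).inv ≫ A ◁ (ε_ P Q ▷ A) ≫ A ◁ (λ_ A).hom ≫ m) := by monoidal
    _ = 𝟙 _ ⊗≫ η_ P Q ▷ P ⊗≫ P ◁ ((Q ◁ p ≫ s ▷ (P ⊗ A)) ≫ (α_ A Q (P ⊗ A)).hom ≫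
        A ◁ (α_ Q P A).inv ≫ A ◁ (ε_ P Q ▷ A) ≫ A ◁ (λ_ A).hom ≫ m) := by
      rw [whisker_exchange]; monoidal
    _ = 𝟙 _ ⊗≫ (η_ P Q ▷ P ⊗≫ P ◁ ε_ P Q) ⊗≫ P ◁ u := by rw [h]; monoidal
    _ = _ := by rw [hz]; monoidal

theorem coactionMate_comp (h : η_ P Q ≫ (p ⊗ₘ s) ≫ (α_ P A (A ⊗ Q)).hom ≫
      P ◁ (α_ A A Q).inv ≫ P ◁ (m ▷ Q) = η_ P Q ≫ P ◁ (λ_ Q).inv ≫ P ◁ (u ▷ Q)) :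
    coactionMate s ≫ p ▷ A ≫ (α_ P A A).hom ≫ P ◁ m = (ρ_ P).inv ≫ P ◁ u := by
  have hz : η_ P Q ▷ P ⊗≫ P ◁ ε_ P Q = ⊗𝟙.hom :=
    ExactPairing.evaluation_coevaluation'' P Q
  simp only [coactionMate]
  rw [MonoidalCategory.tensorHom_def'] at h
  calc
    _ = 𝟙 _ ⊗≫ η_ P Q ▷ P ⊗≫ P ◁ (s ▷ P) ⊗≫ ((P ⊗ A) ◁ ε_ P Q ≫ p ▷ A ▷ 𝟙_ C) ⊗≫ P ◁ m ⊗≫ 𝟙 _ := by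
      monoidal
    _ = 𝟙 _ ⊗≫ (η_ P Q ≫ (P ◁ s ≫ p ▷ (A ⊗ Q)) ≫ (α_ P A (A ⊗ Q)).hom ≫
      P ◁ (α_ A A Q).inv) ▷ P ⊗≫ (P ◁ ((A ⊗ A) ◁ ε_ P Q ≫ m ▷ 𝟙_ C)) ⊗≫ 𝟙 _ := by
      rw [whisker_exchange]; monoidal
    _ = 𝟙 _ ⊗≫ (η_ P Q ≫ (P ◁ s ≫ p ▷ (A ⊗ Q)) ≫ (α_ P A (A ⊗ Q)).hom ≫
      P ◁ (α_ A A Q).inv ≫ P ◁ (m ▷ Q)) ▷ P ⊗≫ P ◁ (A ◁ ε_ P Q) ⊗≫ 𝟙 _ := by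
      rw [whisker_exchange m (ε_ P Q)]; monoidal
    _ = 𝟙 _ ⊗≫ η_ P Q ▷ P ⊗≫ P ◁ (u ▷ (Q ⊗ P) ≫ A ◁ ε_ P Q) ⊗≫ 𝟙 _ := by rw [h]; monoidal
    _ = 𝟙 _ ⊗≫ (η_ P Q ▷ P ⊗≫ P ◁ ε_ P Q) ⊗≫ P ◁ u := by rw [← whisker_exchange]; monoidal
    _ = _ := by rw [hz]; monoidal

end Mates

/-! ### Monoidal functors preserve duals -/

section MonoidalFunctors

variable {C : Type u₁} [Category.{v₁} C] [MonoidalCategory C]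
  {D : Type u₂} [Category.{v₂} D] [MonoidalCategory D] (F : D ⥤ C) [F.Monoidal]

/-- The image of an exact pairing under a monoidal functor. -/
@[reducible]
def mapExactPairing (X Y : D) [ExactPairing X Y] : ExactPairing (F.obj X) (F.obj Y) where
  coevaluation' := Functor.LaxMonoidal.ε F ≫ F.map (η_ X Y) ≫ Functor.OplaxMonoidal.δ F X Y
  evaluation' := Functor.LaxMonoidal.μ F Y X ≫ F.map (ε_ X Y) ≫ Functor.OplaxMonoidal.η F
  coevaluation_evaluation' := by
    have h := congrArg F.map (ExactPairing.coevaluation_evaluation X Y)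
    simp only [Functor.map_comp, Functor.Monoidal.map_whiskerLeft,
      Functor.Monoidal.map_whiskerRight, Functor.Monoidal.map_associator_inv,
      Functor.Monoidal.map_rightUnitor, Functor.Monoidal.map_leftUnitor_inv, Category.assoc,
      Functor.Monoidal.μ_δ_assoc] at h
    have h2 := congrArg (fun t => F.obj Y ◁ Functor.LaxMonoidal.ε F ≫
      Functor.LaxMonoidal.μ F Y (𝟙_ D) ≫ t ≫ Functor.OplaxMonoidal.δ F (𝟙_ D) Y ≫
        Functor.OplaxMonoidal.η F ▷ F.obj Y) h
    simp only [Category.assoc, Functor.Monoidal.μ_δ_assoc, Functor.Monoidal.whiskerLeft_ε_η_assoc,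
      Functor.Monoidal.whiskerRight_ε_η, Category.comp_id] at h2
    simpa only [whiskerLeft_comp, comp_whiskerRight, Category.assoc] using h2
  evaluation_coevaluation' := by
    have h := congrArg F.map (ExactPairing.evaluation_coevaluation X Y)
    simp only [Functor.map_comp, Functor.Monoidal.map_whiskerLeft,
      Functor.Monoidal.map_whiskerRight, Functor.Monoidal.map_associator,
      Functor.Monoidal.map_rightUnitor_inv, Functor.Monoidal.map_leftUnitor, Category.assoc,
      Functor.Monoidal.μ_δ_assoc] at h
    have h2 := congrArg (fun t => Functor.LaxMonoidal.ε F ▷ F.obj X ≫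
      Functor.LaxMonoidal.μ F (𝟙_ D) X ≫ t ≫ Functor.OplaxMonoidal.δ F X (𝟙_ D) ≫
        F.obj X ◁ Functor.OplaxMonoidal.η F) h
    simp only [Category.assoc, Functor.Monoidal.μ_δ_assoc, Functor.Monoidal.whiskerRight_ε_η_assoc,
      Functor.Monoidal.whiskerLeft_ε_η, Category.comp_id] at h2
    simpa only [whiskerLeft_comp, comp_whiskerRight, Category.assoc] using h2

end MonoidalFunctors

/-! ### Equivariance of evaluation and coevaluation, in transposed form -/

section Braided

variable {C : Type u₁} [Category.{v₁} C] [MonoidalCategory C] [BraidedCategory C]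
  {P Q A : C} {m : A ⊗ A ⟶ A} {u : 𝟙_ C ⟶ A} {p : P ⟶ P ⊗ A} {q : Q ⟶ Q ⊗ A}

/-- The braidings of `A` past `Q` and past `P` combine into one past `Q ⊗ P`, which naturality along
`ev` turns into the trivial braiding with the unit object. -/
theorem evaluation_mate_of_pair {ev : Q ⊗ P ⟶ 𝟙_ C}
    (h : pair q p ≫ (Q ⊗ P) ◁ m ≫ ev ▷ A = ev ≫ (λ_ (𝟙_ C)).inv ≫ 𝟙_ C ◁ u) :
    ((q ≫ (β_ A Q).inv) ⊗ₘ p) ≫ (α_ A Q (P ⊗ A)).hom ≫ A ◁ (α_ Q P A).inv ≫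
      A ◁ (ev ▷ A) ≫ A ◁ (λ_ A).hom ≫ m = ev ≫ u := by
  obtain ⟨s, rfl⟩ : ∃ s, q = s ≫ (β_ A Q).hom := ⟨q ≫ (β_ A Q).inv, by simp⟩
  have e : pair (s ≫ (β_ A Q).hom) p ≫ ev ▷ (A ⊗ A) = (s ⊗ₘ p) ≫ (α_ A Q (P ⊗ A)).hom ≫
      A ◁ (α_ Q P A).inv ≫ A ◁ (ev ▷ A) ≫ A ◁ (λ_ A).hom ≫ (λ_ (A ⊗ A)).inv := by
    simp only [pair, tensorμ]
    calc _ = (s ⊗ₘ p) ⊗≫ ((α_ A Q P).inv ≫ (β_ A Q).hom ▷ P ≫ (α_ Q A P).hom ≫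
          Q ◁ (β_ A P).hom ≫ (α_ Q P A).inv) ▷ A ⊗≫ ev ▷ (A ⊗ A) := by monoidal
      _ = (s ⊗ₘ p) ⊗≫ ((β_ A (Q ⊗ P)).hom ≫ ev ▷ A) ▷ A ⊗≫ 𝟙 _ := by
        rw [braiding_tensor_right_hom]; monoidal
      _ = _ := by
        rw [← braiding_naturality_right, braiding_tensorUnit_right]; monoidal
  rw [Category.assoc, Iso.hom_inv_id, Category.comp_id]
  rw [whisker_exchange, reassoc_of% e] at h
  rw [← cancel_mono (λ_ A).inv]
  simp only [Category.assoc] at h ⊢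
  rw [leftUnitor_inv_naturality, h]
  monoidal

theorem coevaluation_mate_of_pair {coev : 𝟙_ C ⟶ P ⊗ Q}
    (h : coev ≫ pair p q ≫ (P ⊗ Q) ◁ m = (λ_ (𝟙_ C)).inv ≫ 𝟙_ C ◁ u ≫ coev ▷ A) :
    coev ≫ (p ⊗ₘ (q ≫ (β_ A Q).inv)) ≫ (α_ P A (A ⊗ Q)).hom ≫
      P ◁ (α_ A A Q).inv ≫ P ◁ (m ▷ Q) = coev ≫ P ◁ (λ_ Q).inv ≫ P ◁ (u ▷ Q) := by
  obtain ⟨s, rfl⟩ : ∃ s, q = s ≫ (β_ A Q).hom := ⟨q ≫ (β_ A Q).inv, by simp⟩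
  rw [Category.assoc, Iso.hom_inv_id, Category.comp_id]
  rw [← cancel_mono (P ◁ (β_ A Q).hom), ← cancel_mono (α_ P Q A).inv]
  simp only [Category.assoc]
  have e : pair p (s ≫ (β_ A Q).hom) ≫ (P ⊗ Q) ◁ m = (p ⊗ₘ s) ≫ (α_ P A (A ⊗ Q)).hom ≫
      P ◁ (α_ A A Q).inv ≫ P ◁ (m ▷ Q) ≫ P ◁ (β_ A Q).hom ≫ (α_ P Q A).inv := by
    simp only [pair, tensorμ]
    symm
    calc _ = (p ⊗ₘ s) ⊗≫ P ◁ (m ▷ Q ≫ (β_ A Q).hom) ⊗≫ 𝟙 _ := by monoidal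
      _ = (p ⊗ₘ s) ⊗≫ P ◁ ((α_ A A Q).hom ≫ A ◁ (β_ A Q).hom ≫ (α_ A Q A).inv ≫
          (β_ A Q).hom ▷ A ≫ (α_ Q A A).hom ≫ Q ◁ m) ⊗≫ 𝟙 _ := by
        rw [braiding_naturality_left, braiding_tensor_left_hom]; simp
      _ = _ := by monoidal
  rw [← e, h, ← whiskerLeft_comp_assoc P (u ▷ Q), braiding_naturality_left,
    braiding_tensorUnit_left]
  calc _ = 𝟙 _ ⊗≫ (𝟙_ C ◁ u ≫ coev ▷ A) ⊗≫ 𝟙 _ := by monoidal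
    _ = _ := by rw [whisker_exchange]; monoidal

end Braided

/-! ### Naturality of the transpose -/

section Mates

variable {C : Type u₁} [Category.{v₁} C] [MonoidalCategory C] {P Q P' Q' A : C}
  [ExactPairing P Q] [ExactPairing P' Q']

theorem coactionMate_naturality {s : Q ⟶ A ⊗ Q} {s' : Q' ⟶ A ⊗ Q'} {f : P ⟶ P'} {g : Q' ⟶ Q}
    (hη : η_ P Q ≫ f ▷ Q = η_ P' Q' ≫ P' ◁ g) (hε : g ▷ P ≫ ε_ P Q = Q' ◁ f ≫ ε_ P' Q')
    (hs : g ≫ s = s' ≫ A ◁ g) : f ≫ coactionMate s' = coactionMate s ≫ f ▷ A := by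
  simp only [coactionMate]
  symm
  calc
    _ = 𝟙 _ ⊗≫ η_ P Q ▷ P ⊗≫ (P ◁ (s ▷ P ⊗≫ A ◁ ε_ P Q ⊗≫ 𝟙 A) ≫ f ▷ A) ⊗≫ 𝟙 _ := by monoidal
    _ = 𝟙 _ ⊗≫ (η_ P Q ≫ f ▷ Q) ▷ P ⊗≫ (P' ◁ (s ▷ P ⊗≫ A ◁ ε_ P Q ⊗≫ 𝟙 A)) ⊗≫ 𝟙 _ := by
      rw [whisker_exchange]; monoidal
    _ = 𝟙 _ ⊗≫ η_ P' Q' ▷ P ⊗≫ (P' ◁ ((g ≫ s) ▷ P ⊗≫ A ◁ ε_ P Q ⊗≫ 𝟙 A)) ⊗≫ 𝟙 _ := by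
      rw [hη]; monoidal
    _ = 𝟙 _ ⊗≫ η_ P' Q' ▷ P ⊗≫ (P' ◁ (s' ▷ P ⊗≫ A ◁ (g ▷ P ≫ ε_ P Q) ⊗≫ 𝟙 A)) ⊗≫ 𝟙 _ := by
      rw [hs]; monoidal
    _ = 𝟙 _ ⊗≫ η_ P' Q' ▷ P ⊗≫ P' ◁ (s' ▷ P ≫ (A ⊗ Q') ◁ f) ⊗≫ P' ◁ A ◁ ε_ P' Q' ⊗≫ 𝟙 _ := by
      rw [hε]; monoidal
    _ = 𝟙 _ ⊗≫ (η_ P' Q' ▷ P ≫ (P' ⊗ Q') ◁ f) ⊗≫ P' ◁ s' ▷ P' ⊗≫ P' ◁ A ◁ ε_ P' Q' ⊗≫ 𝟙 _ := by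
      rw [← whisker_exchange]; monoidal
    _ = _ := by rw [← whisker_exchange]; monoidal

end Mates

/-! ### The antipode -/

section Antipode

variable {C : Type u₁} [Category.{v₁} C] [MonoidalCategory C] [BraidedCategory C]
  {D : Type u₂} [Category.{v₂} D] [MonoidalCategory D] {F : D ⥤ C} [F.Monoidal] {A : C}
  {b : ∀ X, F.obj X ⟶ F.obj X ⊗ A} {d : A ⟶ A ⊗ A} {e : A ⟶ 𝟙_ C} {m : A ⊗ A ⟶ A} {u : 𝟙_ C ⟶ A}

-- `S` represents the family of transposed coactions of the dual objects. Its two identities come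
-- from naturality of `b` at the evaluations and coevaluations of `D`.
attribute [local instance] mapExactPairing in
theorem Reconstructs.exists_antipode [RightRigidCategory D] (U : Universal F A b)
    (h : Reconstructs F b d e m u) :
    ∃ S : A ⟶ A, d ≫ S ▷ A ≫ m = e ≫ u ∧ d ≫ A ◁ S ≫ m = e ≫ u ∧
      ∀ X, b X ≫ F.obj X ◁ S = coactionMate (Q := F.obj Xᘁ) (b Xᘁ ≫ (β_ A (F.obj Xᘁ)).inv) := by
  obtain ⟨S, hS⟩ := U.exists_hom
    (fun X => coactionMate (Q := F.obj Xᘁ) (b Xᘁ ≫ (β_ A (F.obj Xᘁ)).inv)) (fun {X Y} f => by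
      refine coactionMate_naturality (g := F.map (rightAdjointMate f)) ?_ ?_ ?_
      · have := congrArg F.map (coevaluation_comp_rightAdjointMate f)
        change (Functor.LaxMonoidal.ε F ≫ F.map (η_ X Xᘁ) ≫ Functor.OplaxMonoidal.δ F X Xᘁ) ≫ _ =
          (Functor.LaxMonoidal.ε F ≫ F.map (η_ Y Yᘁ) ≫ Functor.OplaxMonoidal.δ F Y Yᘁ) ≫ _
        rw [Functor.map_comp, Functor.map_comp] at this
        simp [← reassoc_of% this]
      · have := congrArg F.map (rightAdjointMate_comp_evaluation f)
        change _ ≫ (Functor.LaxMonoidal.μ F Xᘁ X ≫ F.map (ε_ X Xᘁ) ≫ Functor.OplaxMonoidal.η F) =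
          _ ≫ (Functor.LaxMonoidal.μ F Yᘁ Y ≫ F.map (ε_ Y Yᘁ) ≫ Functor.OplaxMonoidal.η F)
        rw [Functor.map_comp, Functor.map_comp] at this
        simp [reassoc_of% this]
      · rw [reassoc_of% U.naturality, Category.assoc, braiding_inv_naturality_left])
  have hev : ∀ X : D, pair (b Xᘁ) (b X) ≫ (F.obj Xᘁ ⊗ F.obj X) ◁ m ≫
      (ε_ (F.obj X) (F.obj Xᘁ)) ▷ A =
        ε_ (F.obj X) (F.obj Xᘁ) ≫ (λ_ (𝟙_ C)).inv ≫ 𝟙_ C ◁ u := by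
    intro X
    rw [reassoc_of% h.mul, h.one]
    change _ ≫ (Functor.LaxMonoidal.μ F Xᘁ X ≫ F.map (ε_ X Xᘁ) ≫ Functor.OplaxMonoidal.η F) ▷ A =
      (Functor.LaxMonoidal.μ F Xᘁ X ≫ F.map (ε_ X Xᘁ) ≫ Functor.OplaxMonoidal.η F) ≫ _
    rw [comp_whiskerRight, ← reassoc_of% tensorFamily_comp_μ, comp_whiskerRight,
      ← reassoc_of% U.naturality]
    simp [unitFamily]
  have hcoev : ∀ X : D, η_ (F.obj X) (F.obj Xᘁ) ≫ pair (b X) (b Xᘁ) ≫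
      (F.obj X ⊗ F.obj Xᘁ) ◁ m =
        (λ_ (𝟙_ C)).inv ≫ 𝟙_ C ◁ u ≫ (η_ (F.obj X) (F.obj Xᘁ)) ▷ A := by
    intro X
    rw [h.mul, reassoc_of% h.one]
    change (Functor.LaxMonoidal.ε F ≫ F.map (η_ X Xᘁ) ≫ Functor.OplaxMonoidal.δ F X Xᘁ) ≫ _ =
      _ ≫ (Functor.LaxMonoidal.ε F ≫ F.map (η_ X Xᘁ) ≫ Functor.OplaxMonoidal.δ F X Xᘁ) ▷ A
    rw [comp_whiskerRight, ← reassoc_of% unitFamily_comp_ε, comp_whiskerRight,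
      ← reassoc_of% U.naturality]
    simp [tensorFamily]
  refine ⟨S, ?_, ?_, hS⟩
  · refine U.hom_ext fun X => ?_
    have h1 := comp_coactionMate (evaluation_mate_of_pair (hev X))
    rw [← hS X] at h1
    rw [whiskerLeft_comp, whiskerLeft_comp, whiskerLeft_comp, reassoc_of% (h.coaction X).comul,
      reassoc_of% (h.coaction X).counit, ← h1]
    monoidal
  · refine U.hom_ext fun X => ?_
    have h1 := coactionMate_comp (coevaluation_mate_of_pair (hcoev X))
    rw [← hS X] at h1
    rw [whiskerLeft_comp, whiskerLeft_comp, whiskerLeft_comp, reassoc_of% (h.coaction X).comul,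
      reassoc_of% (h.coaction X).counit, ← h1]
    calc _ = b X ≫ (b X ▷ A ≫ (F.obj X ⊗ A) ◁ S) ⊗≫ F.obj X ◁ m := by monoidal
      _ = _ := by rw [← whisker_exchange]; monoidal

end Antipode

/-! ### The reconstructed braided group -/

section Hopf

variable {C : Type u₁} [Category.{v₁} C] [MonoidalCategory C] [BraidedCategory C]
  {D : Type u₂} [Category.{v₂} D] [MonoidalCategory D] {F : D ⥤ C} [F.Monoidal] {A : C}
  {b : ∀ X, F.obj X ⟶ F.obj X ⊗ A}

attribute [local instance] mapExactPairing in
/-- The braided group reconstructed from a monoidal functor. -/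
theorem Universal.exists_hopfObj [RightRigidCategory C] [RightRigidCategory D]
    (U : Universal F A b) :
    ∃ hA : HopfObj A, Reconstructs F b hA.comul hA.counit hA.mul hA.one ∧
      ∀ X, b X ≫ F.obj X ◁ hA.antipode =
        coactionMate (Q := F.obj Xᘁ) (b Xᘁ ≫ (β_ A (F.obj Xᘁ)).inv) := by
  obtain ⟨d, e, m, u, h⟩ := U.exists_reconstructs
  obtain ⟨S, hl, hr, hS⟩ := h.exists_antipode U
  exact ⟨{ one := u
           mul := m
           one_mul := h.one_mul U
           mul_one := h.mul_one U
           mul_assoc := h.mul_assoc U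
           counit := e
           comul := d
           counit_comul := h.counit_comul U
           comul_counit := h.comul_counit U
           comul_assoc := h.comul_assoc U
           mul_comul := h.mul_comul U
           one_comul := h.one_comul
           mul_counit := h.mul_counit U
           one_counit := h.one_counit
           antipode := S
           antipode_left := hl
           antipode_right := hr }, h, hS⟩

theorem Reconstructs.isReconstruction [RightRigidCategory C] {β : F ⟶ F ⋙ tensorRight A}
    (U : Universal F A (fun X => β.app X)) {hA : HopfObj A}
    (h : Reconstructs F (fun X => β.app X) hA.comul hA.counit hA.mul hA.one) :
    IsReconstruction F A β hA where
  represented := U.isRepresentedBy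
  comul X := (h.coaction X).comul
  counit X := (h.coaction X).counit
  mul X Y := h.mul X Y
  one := h.one

end Hopf

/-! ### The reversed tensor product on the source category -/

section Reversed

variable {C : Type u₁} [Category.{v₁} C] [MonoidalCategory C] [BraidedCategory C]
  {D : Type u₂} [Category.{v₂} D] [MonoidalCategory D] (F : D ⥤ C) [F.Monoidal]

/-- Both sides reverse three factors, by the two different sequences of transpositions; the
Yang–Baxter equation identifies them. -/
theorem reversed_associativity (X Y Z : D) :
    ((β_ (F.obj X) (F.obj Y)).hom ≫ Functor.LaxMonoidal.μ F Y X) ▷ F.obj Z ≫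
      ((β_ (F.obj (Y ⊗ X)) (F.obj Z)).hom ≫ Functor.LaxMonoidal.μ F Z (Y ⊗ X)) ≫
        F.map (α_ Z Y X).inv =
    (α_ (F.obj X) (F.obj Y) (F.obj Z)).hom ≫
      F.obj X ◁ ((β_ (F.obj Y) (F.obj Z)).hom ≫ Functor.LaxMonoidal.μ F Z Y) ≫
        (β_ (F.obj X) (F.obj (Z ⊗ Y))).hom ≫ Functor.LaxMonoidal.μ F (Z ⊗ Y) X := by
  rw [comp_whiskerRight, whiskerLeft_comp]
  simp only [Category.assoc]
  rw [braiding_naturality_left_assoc, braiding_naturality_right_assoc,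
    Functor.LaxMonoidal.associativity_inv, braiding_tensor_left_hom, braiding_tensor_right_hom]
  simp only [Category.assoc]
  rw [← reassoc_of% yang_baxter (F.obj X) (F.obj Y) (F.obj Z)]
  simp

/-- A monoidal functor to a braided category, as a monoidal functor for the reversed
tensor product on its source. -/
@[reducible]
def reversedMonoidal : (unmopFunctor D ⋙ F).Monoidal :=
  Functor.CoreMonoidal.toMonoidal
    { εIso := Functor.Monoidal.εIso F
      μIso := fun X Y => β_ (F.obj X.unmop) (F.obj Y.unmop) ≪≫
        Functor.Monoidal.μIso F Y.unmop X.unmop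
      μIso_hom_natural_left := fun {X Y} f Z => by
        change F.map f.unmop ▷ F.obj Z.unmop ≫ (β_ (F.obj Y.unmop) (F.obj Z.unmop)).hom ≫
          Functor.LaxMonoidal.μ F Z.unmop Y.unmop =
            ((β_ (F.obj X.unmop) (F.obj Z.unmop)).hom ≫ Functor.LaxMonoidal.μ F Z.unmop X.unmop) ≫
              F.map (Z.unmop ◁ f.unmop)
        simp
      μIso_hom_natural_right := fun {X Y} Z f => by
        change F.obj Z.unmop ◁ F.map f.unmop ≫ (β_ (F.obj Z.unmop) (F.obj Y.unmop)).hom ≫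
          Functor.LaxMonoidal.μ F Y.unmop Z.unmop =
            ((β_ (F.obj Z.unmop) (F.obj X.unmop)).hom ≫ Functor.LaxMonoidal.μ F X.unmop Z.unmop) ≫
              F.map (f.unmop ▷ Z.unmop)
        simp
      associativity := fun X Y Z => reversed_associativity F X.unmop Y.unmop Z.unmop
      left_unitality := fun X => by
        change (λ_ (F.obj X.unmop)).hom = Functor.LaxMonoidal.ε F ▷ F.obj X.unmop ≫
          ((β_ (F.obj (𝟙_ D)) (F.obj X.unmop)).hom ≫ Functor.LaxMonoidal.μ F X.unmop (𝟙_ D)) ≫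
            F.map (ρ_ X.unmop).hom
        rw [Category.assoc, braiding_naturality_left_assoc, braiding_tensorUnit_left]
        simp
      right_unitality := fun X => by
        change (ρ_ (F.obj X.unmop)).hom = F.obj X.unmop ◁ Functor.LaxMonoidal.ε F ≫
          ((β_ (F.obj X.unmop) (F.obj (𝟙_ D))).hom ≫ Functor.LaxMonoidal.μ F (𝟙_ D) X.unmop) ≫
            F.map (λ_ X.unmop).hom
        rw [Category.assoc, braiding_naturality_right_assoc, braiding_tensorUnit_right]
        simp }

/-- Right duals for the reversed tensor product are left duals. -/
@[reducible]
def reversedRightRigid (D : Type u₂) [Category.{v₂} D] [MonoidalCategory D]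
    [LeftRigidCategory D] : RightRigidCategory Dᴹᵒᵖ where
  rightDual X :=
    { rightDual := .mop (ᘁX.unmop)
      exact :=
        { coevaluation' := (η_ (ᘁX.unmop) X.unmop).mop
          evaluation' := (ε_ (ᘁX.unmop) X.unmop).mop
          coevaluation_evaluation' := by
            apply Quiver.Hom.unmop_inj
            simp
          evaluation_coevaluation' := by
            apply Quiver.Hom.unmop_inj
            simp } }

end Reversed

/-! ### Calculus for moving `A` past an object -/

section Slide

variable {C : Type u₁} [Category.{v₁} C] [MonoidalCategory C] [BraidedCategory C]

/-- Moves `A` past `Q` by the braiding, and then applies `φ : A ⊗ T ⟶ V`. -/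
def slide {A T V : C} (Q : C) (φ : A ⊗ T ⟶ V) : A ⊗ (Q ⊗ T) ⟶ Q ⊗ V :=
  (α_ A Q T).inv ≫ (β_ A Q).hom ▷ T ≫ (α_ Q A T).hom ≫ Q ◁ φ

theorem push_eq_slide {Q A B V : C} (q : Q ⟶ Q ⊗ B) (φ : A ⊗ B ⟶ V) :
    push q φ = A ◁ q ≫ slide Q φ := rfl

theorem slide_whiskerRight_comp {A A' Q T V : C} (f : A' ⟶ A) (φ : A ⊗ T ⟶ V) :
    slide Q (f ▷ T ≫ φ) = f ▷ (Q ⊗ T) ≫ slide Q φ := by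
  simp only [slide, whiskerLeft_comp]
  have := braiding_naturality_left f Q
  calc _ = (α_ A' Q T).inv ≫ ((β_ A' Q).hom ≫ Q ◁ f) ▷ T ⊗≫ Q ◁ φ := by monoidal
    _ = _ := by rw [← this]; monoidal

theorem slide_whiskerLeft_comp {A Q T T' V : C} (f : T' ⟶ T) (φ : A ⊗ T ⟶ V) :
    slide Q (A ◁ f ≫ φ) = A ◁ Q ◁ f ≫ slide Q φ := by
  simp only [slide, whiskerLeft_comp]
  calc _ = (α_ A Q T').inv ≫ ((β_ A Q).hom ▷ T' ≫ (Q ⊗ A) ◁ f) ⊗≫ Q ◁ φ := by monoidal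
    _ = _ := by rw [← whisker_exchange]; monoidal

theorem slide_comp {A Q T V V' : C} (φ : A ⊗ T ⟶ V) (f : V ⟶ V') :
    slide Q (φ ≫ f) = slide Q φ ≫ Q ◁ f := by
  simp [slide]

theorem slide_naturality {A Q Q' T V : C} (f : Q ⟶ Q') (φ : A ⊗ T ⟶ V) :
    A ◁ f ▷ T ≫ slide Q' φ = slide Q φ ≫ f ▷ V := by
  simp only [slide]
  calc _ = (α_ A Q T).inv ≫ (A ◁ f ≫ (β_ A Q').hom) ▷ T ⊗≫ Q' ◁ φ := by monoidal
    _ = (α_ A Q T).inv ≫ (β_ A Q).hom ▷ T ⊗≫ (f ▷ (A ⊗ T) ≫ Q' ◁ φ) := by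
      rw [braiding_naturality_right]; monoidal
    _ = _ := by rw [← whisker_exchange]; monoidal

theorem slide_slide {A Q Q' T V : C} (φ : A ⊗ T ⟶ V) :
    slide Q (slide Q' φ) = A ◁ (α_ Q Q' T).inv ≫ slide (Q ⊗ Q') φ ≫ (α_ Q Q' V).hom := by
  simp only [slide, braiding_tensor_right_hom]
  monoidal

theorem slide_tensor {A A' Q T T' V : C} (ψ : A' ⊗ T ⟶ T') (φ : A ⊗ T' ⟶ V) :
    slide Q ((α_ A A' T).hom ≫ A ◁ ψ ≫ φ) =
      (α_ A A' (Q ⊗ T)).hom ≫ A ◁ slide Q ψ ≫ slide Q φ := by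
  simp only [slide, braiding_tensor_left_hom]
  calc _ = 𝟙 _ ⊗≫ A ◁ (β_ A' Q).hom ▷ T ⊗≫ ((β_ A Q).hom ▷ (A' ⊗ T) ≫ (Q ⊗ A) ◁ ψ) ⊗≫ Q ◁ φ := by
        monoidal
    _ = _ := by rw [← whisker_exchange]; monoidal

theorem push_tensor {A A' Q T T' V : C} (q : Q ⟶ Q ⊗ T) (ψ : A' ⊗ T ⟶ T') (φ : A ⊗ T' ⟶ V) :
    push q ((α_ A A' T).hom ≫ A ◁ ψ ≫ φ) =
      (α_ A A' Q).hom ≫ A ◁ push q ψ ≫ slide Q φ := by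
  simp only [push_eq_slide, slide_tensor]
  simp

theorem push_pair {A Q S B E : C} (q : Q ⟶ Q ⊗ B) (s : S ⟶ S ⊗ E) (R : A ⊗ B ⟶ 𝟙_ C) :
    push (pair q s) ((α_ A B E).inv ≫ R ▷ E ≫ (λ_ E).hom) =
      (α_ A Q S).inv ≫ (push q R ≫ (ρ_ Q).hom) ▷ S ≫ Q ◁ s ≫ (α_ Q S E).inv := by
  simp only [push, pair, tensorμ]
  calc _ = 𝟙 _ ⊗≫ A ◁ (q ⊗ₘ s) ⊗≫ ((A ⊗ Q) ◁ ((β_ B S).hom ▷ E) ≫ (β_ A Q).hom ▷ ((S ⊗ B) ⊗ E)) ⊗≫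
          Q ◁ (β_ A S).hom ▷ B ▷ E ⊗≫ Q ◁ S ◁ R ▷ E ⊗≫ 𝟙 _ := by
        rw [braiding_tensor_right_hom]; monoidal
    _ = 𝟙 _ ⊗≫ A ◁ (q ⊗ₘ s) ⊗≫ (β_ A Q).hom ▷ (B ⊗ S ⊗ E) ⊗≫
          Q ◁ ((β_ (A ⊗ B) S).hom ≫ S ◁ R) ▷ E ⊗≫ 𝟙 _ := by
        rw [whisker_exchange, braiding_tensor_left_hom]; monoidal
    _ = 𝟙 _ ⊗≫ A ◁ q ▷ S ⊗≫ ((A ⊗ Q ⊗ B) ◁ s ≫ ((α_ A Q B).inv ≫ (β_ A Q).hom ▷ B ≫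
          (α_ Q A B).hom ≫ Q ◁ R ≫ (ρ_ Q).hom) ▷ (S ⊗ E)) ⊗≫ 𝟙 _ := by
        rw [← braiding_naturality_left, braiding_tensorUnit_left, MonoidalCategory.tensorHom_def]
        monoidal
    _ = _ := by rw [whisker_exchange]; monoidal

theorem act_pair {P Q A B T U V : C} (p : P ⟶ P ⊗ A) (q : Q ⟶ Q ⊗ B) (ψ : B ⊗ T ⟶ U)
    (φ : A ⊗ U ⟶ V) :
    act (pair p q) ((α_ A B T).hom ≫ A ◁ ψ ≫ φ) =
      (α_ P Q T).hom ≫ P ◁ act q ψ ≫ act p (slide Q φ) ≫ (α_ P Q V).inv := by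
  simp only [act, pair, tensorμ, slide, MonoidalCategory.tensorHom_def']
  calc _ = 𝟙 _ ⊗≫ P ◁ q ▷ T ⊗≫ p ▷ (Q ⊗ B ⊗ T) ⊗≫
          P ◁ ((β_ A Q).hom ▷ (B ⊗ T) ≫ (Q ⊗ A) ◁ ψ) ⊗≫ P ◁ Q ◁ φ ⊗≫ 𝟙 _ := by monoidal
    _ = 𝟙 _ ⊗≫ P ◁ q ▷ T ⊗≫ (p ▷ (Q ⊗ B ⊗ T) ≫ (P ⊗ A) ◁ Q ◁ ψ) ⊗≫
          P ◁ (β_ A Q).hom ▷ U ⊗≫ P ◁ Q ◁ φ ⊗≫ 𝟙 _ := by rw [← whisker_exchange]; monoidal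
    _ = _ := by rw [← whisker_exchange]; monoidal

/-- An action of `P` on `T` across an intermediate `Q` is conjugate, by the braiding of `P` with
`Q`, to the action without `Q`. -/
theorem act_slide {P Q A T V : C} (p : P ⟶ P ⊗ A) (φ : A ⊗ T ⟶ V) :
    act p (slide Q φ) = slide Q (act p φ) ≫ (α_ Q P V).inv ≫ (β_ P Q).inv ▷ V ≫ (α_ P Q V).hom := by
  simp only [act, slide]
  symm
  calc _ = 𝟙 _ ⊗≫ ((β_ P Q).hom ≫ Q ◁ p) ▷ T ⊗≫ Q ◁ P ◁ φ ⊗≫ (β_ P Q).inv ▷ V ⊗≫ 𝟙 _ := by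
        monoidal
    _ = 𝟙 _ ⊗≫ p ▷ (Q ⊗ T) ⊗≫ P ◁ (β_ A Q).hom ▷ T ⊗≫ ((β_ P Q).hom ▷ (A ⊗ T) ≫ (Q ⊗ P) ◁ φ) ⊗≫
          (β_ P Q).inv ▷ V ⊗≫ 𝟙 _ := by
        rw [← braiding_naturality_left, braiding_tensor_left_hom]; monoidal
    _ = 𝟙 _ ⊗≫ p ▷ (Q ⊗ T) ⊗≫ P ◁ (β_ A Q).hom ▷ T ⊗≫ P ◁ Q ◁ φ ⊗≫
          ((β_ P Q).hom ≫ (β_ P Q).inv) ▷ V ⊗≫ 𝟙 _ := by rw [← whisker_exchange]; monoidal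
    _ = _ := by rw [Iso.hom_inv_id]; monoidal

end Slide

/-! ### Convolution on `A ⊗ A` -/

section Nested

variable {C : Type u₁} [Category.{v₁} C] [MonoidalCategory C]

theorem nested_eq {X Y : C} (p : X ⊗ Y ⟶ 𝟙_ C) :
    nested p = (α_ X X (Y ⊗ Y)).hom ≫ X ◁ ((α_ X Y Y).inv ≫ p ▷ Y ≫ (λ_ Y).hom) ≫ p := by
  simp [nested]

variable [BraidedCategory C]

/-- Convolution becomes composition in the reverse order: the operator of `ψ` acts first. -/
theorem pair_tensorComul {P Q A V W : C} {hA : HopfObj A} {p : P ⟶ P ⊗ A} {q : Q ⟶ Q ⊗ A}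
    (hp : p ≫ P ◁ hA.comul = p ≫ p ▷ A ≫ (α_ P A A).hom)
    (hq : q ≫ Q ◁ hA.comul = q ≫ q ▷ A ≫ (α_ Q A A).hom) (φ : A ⊗ A ⟶ V) (ψ : A ⊗ A ⟶ W) :
    pair p q ≫ (P ⊗ Q) ◁ (tensorComul A hA ≫ (φ ⊗ₘ ψ)) =
      (pair p q ≫ (P ⊗ Q) ◁ ψ) ≫ (pair p q ≫ (P ⊗ Q) ◁ φ) ▷ W ≫ (α_ _ _ _).hom := by
  simp only [tensorComul, Category.assoc, whiskerLeft_comp]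
  rw [reassoc_of% pair_whiskerLeft_tensorHom, hp, hq, ← reassoc_of% pair_pair, comp_whiskerRight,
    Category.assoc, whisker_exchange_assoc, MonoidalCategory.tensorHom_def']
  monoidal

end Nested

/-! ### Comparison of the braidings of `D` and `C` -/

section DualQuasitriangular

variable {C : Type u₁} [Category.{v₁} C] [MonoidalCategory C] [BraidedCategory C]
  {D : Type u₂} [Category.{v₂} D] [MonoidalCategory D] [BraidedCategory D]
  (F : D ⥤ C) [F.Monoidal]

/-- The braiding of `D`, as a morphism in `C`. -/
def mapBraiding (X Y : D) : F.obj X ⊗ F.obj Y ⟶ F.obj Y ⊗ F.obj X :=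
  Functor.LaxMonoidal.μ F X Y ≫ F.map (β_ X Y).hom ≫ Functor.OplaxMonoidal.δ F Y X

/-- The comparison of the braidings of `D` and `C`. -/
def compareBraiding (X Y : D) : F.obj X ⊗ F.obj Y ⟶ F.obj X ⊗ F.obj Y :=
  mapBraiding F X Y ≫ (β_ (F.obj X) (F.obj Y)).inv

/-- The inverse of `compareBraiding`. -/
def compareBraidingInv (X Y : D) : F.obj X ⊗ F.obj Y ⟶ F.obj X ⊗ F.obj Y :=
  (β_ (F.obj X) (F.obj Y)).hom ≫ Functor.LaxMonoidal.μ F Y X ≫ F.map (β_ X Y).inv ≫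
    Functor.OplaxMonoidal.δ F X Y

theorem compareBraiding_inv (X Y : D) :
    compareBraiding F X Y ≫ compareBraidingInv F X Y = 𝟙 _ := by
  simp [compareBraiding, compareBraidingInv, mapBraiding]

theorem inv_compareBraiding (X Y : D) :
    compareBraidingInv F X Y ≫ compareBraiding F X Y = 𝟙 _ := by
  simp [compareBraiding, compareBraidingInv, mapBraiding]

omit [BraidedCategory C] in
theorem mapBraiding_naturality {X X' Y Y' : D} (f : X ⟶ X') (g : Y ⟶ Y') :
    (F.map f ⊗ₘ F.map g) ≫ mapBraiding F X' Y' = mapBraiding F X Y ≫ (F.map g ⊗ₘ F.map f) := by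
  simp only [mapBraiding]
  rw [Functor.LaxMonoidal.μ_natural_assoc, ← Functor.map_comp_assoc, braiding_naturality,
    Functor.map_comp_assoc, ← Functor.OplaxMonoidal.δ_natural]
  simp only [Category.assoc]

theorem compareBraiding_naturality {X X' Y Y' : D} (f : X ⟶ X') (g : Y ⟶ Y') :
    (F.map f ⊗ₘ F.map g) ≫ compareBraiding F X' Y' =
      compareBraiding F X Y ≫ (F.map f ⊗ₘ F.map g) := by
  rw [compareBraiding, reassoc_of% mapBraiding_naturality, braiding_inv_naturality,
    compareBraiding, Category.assoc]

theorem compareBraidingInv_naturality {X X' Y Y' : D} (f : X ⟶ X') (g : Y ⟶ Y') :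
    (F.map f ⊗ₘ F.map g) ≫ compareBraidingInv F X' Y' =
      compareBraidingInv F X Y ≫ (F.map f ⊗ₘ F.map g) := by
  have h := compareBraiding_naturality F f g
  have h2 := congrArg (fun t => compareBraidingInv F X Y ≫ t ≫ compareBraidingInv F X' Y') h
  simp only [Category.assoc, compareBraiding_inv, Category.comp_id] at h2
  rw [reassoc_of% inv_compareBraiding] at h2
  exact h2.symm

omit [BraidedCategory C] in
theorem mapBraiding_tensor_right (X Y Z : D) :
    F.obj X ◁ Functor.LaxMonoidal.μ F Y Z ≫ mapBraiding F X (Y ⊗ Z) =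
      ((α_ _ _ _).inv ≫ mapBraiding F X Y ▷ F.obj Z ≫ (α_ _ _ _).hom ≫
        F.obj Y ◁ mapBraiding F X Z ≫ (α_ _ _ _).inv) ≫ Functor.LaxMonoidal.μ F Y Z ▷ F.obj X := by
  simp only [mapBraiding]
  rw [braiding_tensor_right_hom]
  simp only [Functor.map_comp, Functor.Monoidal.map_whiskerLeft, Functor.Monoidal.map_whiskerRight,
    Functor.Monoidal.map_associator, Functor.Monoidal.map_associator_inv, Category.assoc,
    Functor.Monoidal.μ_δ_assoc, Functor.Monoidal.μ_δ,
    Functor.Monoidal.whiskerLeft_μ_δ_assoc, comp_whiskerRight, whiskerLeft_comp, Category.comp_id]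

omit [BraidedCategory C] in
theorem mapBraiding_tensor_left (X Y Z : D) :
    Functor.LaxMonoidal.μ F X Y ▷ F.obj Z ≫ mapBraiding F (X ⊗ Y) Z =
      ((α_ _ _ _).hom ≫ F.obj X ◁ mapBraiding F Y Z ≫ (α_ _ _ _).inv ≫
        mapBraiding F X Z ▷ F.obj Y ≫ (α_ _ _ _).hom) ≫ F.obj Z ◁ Functor.LaxMonoidal.μ F X Y := by
  simp only [mapBraiding]
  rw [braiding_tensor_left_hom]
  simp only [Functor.map_comp, Functor.Monoidal.map_whiskerLeft, Functor.Monoidal.map_whiskerRight,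
    Functor.Monoidal.map_associator, Functor.Monoidal.map_associator_inv, Category.assoc,
    Functor.Monoidal.μ_δ_assoc, Functor.Monoidal.whiskerRight_μ_δ_assoc, Functor.Monoidal.μ_δ,
    comp_whiskerRight, whiskerLeft_comp, Category.comp_id]

/-- The hexagon of `D`, carried over by `F`, divided by the hexagon of `C`. The braidings of `C`
which survive are those that the nested pairing produces. -/
theorem compareBraiding_tensor_right (X Y Z : D) :
    F.obj X ◁ Functor.LaxMonoidal.μ F Y Z ≫ compareBraiding F X (Y ⊗ Z) =
      ((α_ _ _ _).inv ≫ compareBraiding F X Y ▷ F.obj Z ≫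
        (β_ (F.obj X) (F.obj Y)).hom ▷ F.obj Z ≫ (α_ _ _ _).hom ≫
          F.obj Y ◁ compareBraiding F X Z ≫ (α_ _ _ _).inv ≫
            (β_ (F.obj X) (F.obj Y)).inv ▷ F.obj Z ≫ (α_ _ _ _).hom) ≫
              F.obj X ◁ Functor.LaxMonoidal.μ F Y Z := by
  simp only [compareBraiding]
  rw [reassoc_of% mapBraiding_tensor_right, braiding_inv_naturality_left, braiding_tensor_right_inv]
  simp

theorem compareBraiding_tensor_left (X Y Z : D) :
    Functor.LaxMonoidal.μ F Y X ▷ F.obj Z ≫ compareBraiding F (Y ⊗ X) Z =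
      ((α_ _ _ _).hom ≫ F.obj Y ◁ compareBraiding F X Z ≫
        F.obj Y ◁ (β_ (F.obj X) (F.obj Z)).hom ≫ (α_ _ _ _).inv ≫
          compareBraiding F Y Z ▷ F.obj X ≫ (α_ _ _ _).hom ≫
            F.obj Y ◁ (β_ (F.obj X) (F.obj Z)).inv ≫ (α_ _ _ _).inv) ≫
              Functor.LaxMonoidal.μ F Y X ▷ F.obj Z := by
  simp only [compareBraiding]
  rw [reassoc_of% mapBraiding_tensor_left, braiding_inv_naturality_right, braiding_tensor_left_inv]
  simp

end DualQuasitriangular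

/-! ### Operators of the nested pairing -/

section Pairing

variable {C : Type u₁} [Category.{v₁} C] [MonoidalCategory C]

theorem act_associator_whiskerRight {P A T T' E : C} (p : P ⟶ P ⊗ A) (φ : A ⊗ T ⟶ T') :
    act p ((α_ A T E).inv ≫ φ ▷ E) = (α_ P T E).inv ≫ act p φ ▷ E ≫ (α_ P T' E).hom := by
  simp only [act]
  monoidal

variable [BraidedCategory C]

theorem push_whiskerLeft_comp {Q A B B' V : C} (q : Q ⟶ Q ⊗ B) (f : B ⟶ B') (φ : A ⊗ B' ⟶ V) :
    push q (A ◁ f ≫ φ) = push (q ≫ Q ◁ f) φ := by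
  rw [push_eq_slide, push_eq_slide, slide_whiskerLeft_comp]
  simp

theorem push_whiskerRight_comp {Q A A' B V : C} (q : Q ⟶ Q ⊗ B) (f : A ⟶ A') (φ : A' ⊗ B ⟶ V) :
    push q (f ▷ B ≫ φ) = f ▷ Q ≫ push q φ := by
  rw [push_eq_slide, push_eq_slide, slide_whiskerRight_comp, whisker_exchange_assoc]

theorem push_naturality {Q Q' A B V : C} {q : Q ⟶ Q ⊗ B} {q' : Q' ⟶ Q' ⊗ B} {f : Q ⟶ Q'}
    (h : f ≫ q' = q ≫ f ▷ B) (φ : A ⊗ B ⟶ V) :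
    A ◁ f ≫ push q' φ = push q φ ≫ f ▷ V := by
  rw [push_eq_slide, push_eq_slide, ← whiskerLeft_comp_assoc, h, whiskerLeft_comp_assoc,
    slide_naturality, Category.assoc]

theorem push_iterate {A Q B E : C} (q : Q ⟶ Q ⊗ B) (s : Q ⟶ Q ⊗ E) (R : A ⊗ B ⟶ 𝟙_ C) :
    push (s ≫ q ▷ E ≫ (α_ Q B E).hom) ((α_ A B E).inv ≫ R ▷ E ≫ (λ_ E).hom) =
      A ◁ s ≫ (α_ A Q E).inv ≫ (push q R ≫ (ρ_ Q).hom) ▷ E := by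
  simp only [push]
  monoidal

variable {A : C} (R : A ⊗ A ⟶ 𝟙_ C) {X Y Z : C} {x : X ⟶ X ⊗ A} {y : Y ⟶ Y ⊗ A} {z : Z ⟶ Z ⊗ A}

theorem act_slide_push {r : X ⊗ Z ⟶ X ⊗ Z} (hr : pair x z ≫ (X ⊗ Z) ◁ R = r ≫ (ρ_ _).inv) :
    X ◁ (Y ◁ z ≫ (α_ Y Z A).inv) ≫ act x (slide (Y ⊗ Z) R) =
      (α_ X Y Z).inv ≫ (β_ X Y).hom ▷ Z ≫ (α_ Y X Z).hom ≫ Y ◁ r ≫ (α_ Y X Z).inv ≫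
        (β_ X Y).inv ▷ Z ≫ (α_ X Y Z).hom ≫ X ◁ (ρ_ (Y ⊗ Z)).inv := by
  have h : act x (push z R) = r ≫ (ρ_ _).inv ≫ (α_ _ _ _).hom := by
    rw [← reassoc_of% hr, ← Category.assoc, pair_comp]
    simp
  have h2 : A ◁ (Y ◁ z ≫ (α_ Y Z A).inv) ≫ slide (Y ⊗ Z) R =
      slide Y (push z R) ≫ (α_ Y Z (𝟙_ C)).inv := by
    rw [push_eq_slide, slide_whiskerLeft_comp, slide_slide]
    simp
  rw [← act_whiskerLeft_comp, h2, act_comp, act_slide, h]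
  simp only [slide]
  monoidal

/-- The coproduct splits the copy of `A` from `X`. The inner part meets `Y` first, and the outer
part crosses `Y` to meet `Z`. The outcome has the shape of `compareBraiding_tensor_right`. -/
theorem act_push_pair_nested {d : A ⟶ A ⊗ A} {rY : X ⊗ Y ⟶ X ⊗ Y}
    {rZ : X ⊗ Z ⟶ X ⊗ Z} (hx : x ≫ X ◁ d = x ≫ x ▷ A ≫ (α_ X A A).hom)
    (hY : pair x y ≫ (X ⊗ Y) ◁ R = rY ≫ (ρ_ _).inv)
    (hZ : pair x z ≫ (X ⊗ Z) ◁ R = rZ ≫ (ρ_ _).inv) :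
    act x (push (pair y z) (d ▷ (A ⊗ A) ≫ nested R)) =
      (α_ X Y Z).inv ≫ rY ▷ Z ≫ (β_ X Y).hom ▷ Z ≫ (α_ Y X Z).hom ≫ Y ◁ rZ ≫ (α_ Y X Z).inv ≫
        (β_ X Y).inv ▷ Z ≫ (α_ X Y Z).hom ≫ X ◁ (ρ_ (Y ⊗ Z)).inv := by
  have h : act x (push y R ≫ (ρ_ Y).hom) = rY := by
    have := hY
    rw [pair_comp, Iso.comp_inv_eq] at this
    rw [act_comp, this]
    monoidal
  rw [push_whiskerRight_comp, act_whiskerRight_comp, hx, nested_eq, push_tensor, ← act_act,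
    push_pair]
  have h3 : act x ((α_ A Y Z).inv ≫ (push y R ≫ (ρ_ Y).hom) ▷ Z ≫ Y ◁ z ≫ (α_ Y Z A).inv) =
      (α_ X Y Z).inv ≫ rY ▷ Z ≫ (α_ X Y Z).hom ≫ X ◁ (Y ◁ z ≫ (α_ Y Z A).inv) := by
    rw [← Category.assoc, act_comp, act_associator_whiskerRight, h]
    simp
  rw [h3]
  simp only [Category.assoc]
  rw [act_slide_push R hZ]
  simp

theorem act_pair_push_nested {d : A ⟶ A ⊗ A} {rY : Y ⊗ Z ⟶ Y ⊗ Z}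
    {rX : X ⊗ Z ⟶ X ⊗ Z} (hz : z ≫ Z ◁ d = z ≫ z ▷ A ≫ (α_ Z A A).hom)
    (hY : pair y z ≫ (Y ⊗ Z) ◁ R = rY ≫ (ρ_ _).inv)
    (hX : pair x z ≫ (X ⊗ Z) ◁ R = rX ≫ (ρ_ _).inv) :
    act (pair x y) (push z ((A ⊗ A) ◁ d ≫ nested R)) =
      (β_ X Y).hom ▷ Z ≫ (α_ Y X Z).hom ≫ Y ◁ rX ≫ (α_ Y X Z).inv ≫
        (β_ X Y).inv ▷ Z ≫ (α_ X Y Z).hom ≫ X ◁ rY ≫ (α_ X Y Z).inv ≫ (X ⊗ Y) ◁ (ρ_ Z).inv := by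
  have h : act y (push z R ≫ (ρ_ Z).hom) = rY := by
    have := hY
    rw [pair_comp, Iso.comp_inv_eq] at this
    rw [act_comp, this]
    monoidal
  rw [push_whiskerLeft_comp, hz, nested_eq, push_tensor, push_iterate, act_pair,
    act_whiskerLeft_comp, act_associator_whiskerRight, h]
  have h3 : X ◁ (rY ▷ A ≫ (α_ Y Z A).hom) ≫ act x (slide Y (slide Z R)) =
      act x (slide (Y ⊗ Z) R) ≫ X ◁ (rY ▷ 𝟙_ C ≫ (α_ Y Z (𝟙_ C)).hom) := by
    rw [slide_slide, ← act_whiskerLeft_comp, ← act_comp, ← Category.assoc (slide (Y ⊗ Z) R),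
      ← slide_naturality]
    simp
  have h4 := act_slide_push (Y := Y) R hX
  simp only [whiskerLeft_comp, Category.assoc] at h3 h4 ⊢
  rw [reassoc_of% h3, reassoc_of% h4]
  monoidal

end Pairing

/-! ### Opposite product and dual-quasitriangular structure -/

section DualQuasitriangular

variable {C : Type u₁} [Category.{v₁} C] [MonoidalCategory C] [BraidedCategory C]
  {D : Type u₂} [Category.{v₂} D] [MonoidalCategory D] [BraidedCategory D]
  {F : D ⥤ C} [F.Monoidal] {A : C} {b : ∀ X, F.obj X ⟶ F.obj X ⊗ A}

omit [BraidedCategory C] [MonoidalCategory D] [BraidedCategory D] [F.Monoidal] in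
theorem Universal.unmop (U : Universal F A b) :
    Universal (unmopFunctor D ⋙ F) A (fun X => b X.unmop) where
  naturality f := U.naturality f.unmop
  hom_ext h := U.hom_ext fun X => h (.mop X)
  exists_hom a ha := by
    obtain ⟨φ, hφ⟩ := U.exists_hom (fun X => a (.mop X)) (fun f => ha f.mop)
    exact ⟨φ, fun X => hφ X.unmop⟩

/-- The opposite braided group of a reconstructed braided group. -/
theorem Reconstructs.exists_opposite [RightRigidCategory C] [RightRigidCategory D]
    (U : Universal F A b) {hA : HopfObj A}
    (h : Reconstructs F b hA.comul hA.counit hA.mul hA.one) :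
    ∃ op : HopfObj A, op.one = hA.one ∧ op.comul = hA.comul ∧ op.counit = hA.counit ∧
      ∀ X Y, pair (b X) (b Y) ≫ (F.obj X ⊗ F.obj Y) ◁ op.mul =
        (β_ (F.obj X) (F.obj Y)).hom ≫ tensorFamily F b Y X ≫ (β_ (F.obj X) (F.obj Y)).inv ▷ A := by
  -- The opposite braided group is reconstructed from `F` on `Dᴹᵒᵖ`. Its antipode needs right duals
  -- there, which are left duals in `D`; the braiding of `D` supplies them.
  let : LeftRigidCategory D := leftRigidCategoryOfRightRigidCategory
  let := reversedRightRigid D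
  let := reversedMonoidal F
  obtain ⟨op, hop, -⟩ := U.unmop.exists_hopfObj
  refine ⟨op, ?_, ?_, ?_, fun X Y => ?_⟩
  · rw [hop.one_eq, h.one_eq]
    rfl
  · exact U.hom_ext fun X => (hop.coaction (.mop X)).comul.trans (h.coaction X).comul.symm
  · exact U.hom_ext fun X => (hop.coaction (.mop X)).counit.trans (h.coaction X).counit.symm
  · refine (hop.mul (.mop X) (.mop Y)).trans ?_
    change ((β_ (F.obj X) (F.obj Y)).hom ≫ Functor.LaxMonoidal.μ F Y X) ≫ b (Y ⊗ X) ≫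
      (Functor.OplaxMonoidal.δ F Y X ≫ (β_ (F.obj X) (F.obj Y)).inv) ▷ A = _
    simp [tensorFamily]

/-- The dual quasitriangular structure given by the braiding of `D`. -/
theorem Reconstructs.exists_dualQuasitriangular [RightRigidCategory C] [RightRigidCategory D]
    (U : Universal F A b) {hA : HopfObj A}
    (h : Reconstructs F b hA.comul hA.counit hA.mul hA.one) :
    ∃ Q : DualQuasitriangular A hA,
      (∀ X Y, pair (b X) (b Y) ≫ (F.obj X ⊗ F.obj Y) ◁ Q.op.mul =
        (β_ (F.obj X) (F.obj Y)).hom ≫ tensorFamily F b Y X ≫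
          (β_ (F.obj X) (F.obj Y)).inv ▷ A) ∧
      ∀ X Y, pair (b X) (b Y) ≫ (F.obj X ⊗ F.obj Y) ◁ Q.R =
        compareBraiding F X Y ≫ (ρ_ _).inv := by
  obtain ⟨op, hone, hcomul, hcounit, hop⟩ := h.exists_opposite U
  obtain ⟨R, hR⟩ := U.exists_pair U (fun X Y => compareBraiding F X Y ≫ (ρ_ _).inv)
    (fun f Y => by
      have := compareBraiding_naturality F f (𝟙 Y)
      simp only [CategoryTheory.Functor.map_id, tensorHom_id] at this
      rw [reassoc_of% this, Category.assoc, rightUnitor_inv_naturality])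
    (fun X {Y Y'} f => by
      have := compareBraiding_naturality F (𝟙 X) f
      simp only [CategoryTheory.Functor.map_id, id_tensorHom] at this
      rw [reassoc_of% this, Category.assoc, rightUnitor_inv_naturality])
  obtain ⟨R', hR'⟩ := U.exists_pair U (fun X Y => compareBraidingInv F X Y ≫ (ρ_ _).inv)
    (fun f Y => by
      have := compareBraidingInv_naturality F f (𝟙 Y)
      simp only [CategoryTheory.Functor.map_id, tensorHom_id] at this
      rw [reassoc_of% this, Category.assoc, rightUnitor_inv_naturality])
    (fun X {Y Y'} f => by
      have := compareBraidingInv_naturality F (𝟙 X) f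
      simp only [CategoryTheory.Functor.map_id, id_tensorHom] at this
      rw [reassoc_of% this, Category.assoc, rightUnitor_inv_naturality])
  have conv : ∀ (X Y : D) {V W : C} (φ : A ⊗ A ⟶ V) (ψ : A ⊗ A ⟶ W), _ := fun X Y V W φ ψ =>
    pair_tensorComul (h.coaction X).comul (h.coaction Y).comul φ ψ
  have unit : ∀ X Y, pair (b X) (b Y) ≫ (F.obj X ⊗ F.obj Y) ◁
      ((hA.counit ⊗ₘ hA.counit) ≫ (λ_ (𝟙_ C)).hom) = (ρ_ _).inv := fun X Y => by
    rw [← h.mul_counit U, whiskerLeft_comp, reassoc_of% h.mul X Y,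
      (h.tensorFamily_coaction X Y).counit]
  refine ⟨{ op := op
            op_one := hone
            op_comul := hcomul
            op_counit := hcounit
            R := R
            Rinv := R'
            R_mul_Rinv := U.pair_ext U fun X Y => ?_
            Rinv_mul_R := U.pair_ext U fun X Y => ?_
            intertwines := U.pair_ext U fun X Y => ?_
            mul_left := (U.tensor U).pair_ext U fun Z S => ?_
            mul_right := U.pair_ext (U.tensor U) fun X Z => ?_ }, hop, hR⟩
  · rw [unit, ← Category.assoc, whiskerLeft_comp, ← Category.assoc, conv, hR, hR']
    simp only [Category.assoc, comp_whiskerRight]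
    rw [← rightUnitor_inv_naturality_assoc, reassoc_of% inv_compareBraiding]
    monoidal
  · rw [unit, ← Category.assoc, whiskerLeft_comp, ← Category.assoc, conv, hR, hR']
    simp only [Category.assoc, comp_whiskerRight]
    rw [← rightUnitor_inv_naturality_assoc, reassoc_of% compareBraiding_inv]
    monoidal
  · rw [← Category.assoc (tensorComul A hA), ← Category.assoc (tensorComul A hA), whiskerLeft_comp,
      whiskerLeft_comp _ _ (ρ_ A).hom, reassoc_of% conv, reassoc_of% conv, hR, hop, reassoc_of% h.mul X Y,
      reassoc_of% hR X Y]
    -- The coaction is natural at the braiding of `D`; this is the content of the intertwining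
    -- relation.
    have hn : mapBraiding F X Y ≫ tensorFamily F b Y X =
        tensorFamily F b X Y ≫ mapBraiding F X Y ▷ A := by
      have := U.naturality (β_ X Y).hom
      simp only [mapBraiding, tensorFamily, Category.assoc, Functor.Monoidal.δ_μ_assoc,
        comp_whiskerRight, Functor.Monoidal.whiskerRight_δ_μ_assoc]
      rw [reassoc_of% this]
    calc _ = (tensorFamily F b X Y ≫ mapBraiding F X Y ▷ A) ≫
          (β_ (F.obj X) (F.obj Y)).inv ▷ A := by simp [compareBraiding]
      _ = _ := by
        rw [← hn, compareBraiding]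
        simp only [Category.assoc, comp_whiskerRight]
        rw [← rightUnitor_inv_naturality_assoc, ← rightUnitor_inv_naturality_assoc,
          Iso.inv_hom_id_assoc]
        monoidal
  · obtain ⟨X, Y⟩ := Z
    change pair (pair (b X) (b Y)) (b S) ≫ ((F.obj X ⊗ F.obj Y) ⊗ F.obj S) ◁ (op.mul ▷ A ≫ R) =
      pair (pair (b X) (b Y)) (b S) ≫ ((F.obj X ⊗ F.obj Y) ⊗ F.obj S) ◁
        ((A ⊗ A) ◁ hA.comul ≫ nested R)
    rw [pair_comp _ _ ((A ⊗ A) ◁ hA.comul ≫ nested R),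
      act_pair_push_nested R (h.coaction S).comul (hR Y S) (hR X S)]
    have h1 := pair_whiskerLeft_tensorHom (pair (b X) (b Y)) (b S) op.mul (𝟙 A)
    rw [tensorHom_id, whiskerLeft_id, Category.comp_id, hop] at h1
    have h2 := pair_naturality (p' := b (Y ⊗ X))
      (f := (β_ (F.obj X) (F.obj Y)).hom ≫ Functor.LaxMonoidal.μ F Y X)
      (p := (β_ (F.obj X) (F.obj Y)).hom ≫ tensorFamily F b Y X ≫
        (β_ (F.obj X) (F.obj Y)).inv ▷ A) (by
          rw [Category.assoc, tensorFamily_comp_μ]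
          simp [← comp_whiskerRight_assoc]) (q := b S) (q' := b S) (g := 𝟙 _) (by simp)
    have h3 := hR (Y ⊗ X) S
    rw [whiskerLeft_comp, reassoc_of% h1]
    rw [tensorHom_id] at h2
    rw [← cancel_mono (((β_ (F.obj X) (F.obj Y)).hom ≫ Functor.LaxMonoidal.μ F Y X) ▷
      F.obj S ▷ 𝟙_ C), Category.assoc, whisker_exchange, ← reassoc_of% h2, h3, comp_whiskerRight,
      Category.assoc, reassoc_of% compareBraiding_tensor_left]
    -- The hexagon leaves `compareBraiding F Y S` conjugated by the braiding of `X` with `S`, while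
    -- the nested pairing has the braiding of `X` with `Y`. Naturality of the braiding of `X` past
    -- `Y ⊗ S` trades one for the other.
    have h4 := braiding_naturality_right (F.obj X) (compareBraiding F Y S)
    rw [braiding_tensor_right_hom] at h4
    calc _ = (β_ (F.obj X) (F.obj Y)).hom ▷ F.obj S ⊗≫ F.obj Y ◁ compareBraiding F X S ⊗≫
          F.obj Y ◁ (β_ (F.obj X) (F.obj S)).hom ⊗≫ compareBraiding F Y S ▷ F.obj X ⊗≫
          F.obj Y ◁ (β_ (F.obj X) (F.obj S)).inv ⊗≫
          Functor.LaxMonoidal.μ F Y X ▷ F.obj S ⊗≫ 𝟙 _ := by monoidal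
      _ = (β_ (F.obj X) (F.obj Y)).hom ▷ F.obj S ⊗≫ F.obj Y ◁ compareBraiding F X S ⊗≫
          (β_ (F.obj X) (F.obj Y)).inv ▷ F.obj S ⊗≫
          ((α_ (F.obj X) (F.obj Y) (F.obj S)).inv ≫ (β_ (F.obj X) (F.obj Y)).hom ▷ F.obj S ≫
            (α_ _ _ _).hom ≫ F.obj Y ◁ (β_ (F.obj X) (F.obj S)).hom ≫ (α_ _ _ _).inv ≫
              compareBraiding F Y S ▷ F.obj X) ⊗≫
          F.obj Y ◁ (β_ (F.obj X) (F.obj S)).inv ⊗≫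
          Functor.LaxMonoidal.μ F Y X ▷ F.obj S ⊗≫ 𝟙 _ := by
        simp [monoidalComp]
      _ = (β_ (F.obj X) (F.obj Y)).hom ▷ F.obj S ⊗≫ F.obj Y ◁ compareBraiding F X S ⊗≫
          (β_ (F.obj X) (F.obj Y)).inv ▷ F.obj S ⊗≫ F.obj X ◁ compareBraiding F Y S ⊗≫
          (β_ (F.obj X) (F.obj Y)).hom ▷ F.obj S ⊗≫
          F.obj Y ◁ ((β_ (F.obj X) (F.obj S)).hom ≫ (β_ (F.obj X) (F.obj S)).inv) ⊗≫
          Functor.LaxMonoidal.μ F Y X ▷ F.obj S ⊗≫ 𝟙 _ := by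
        simp only [Category.assoc] at h4
        rw [← h4]
        monoidal
      _ = _ := by
        rw [Iso.hom_inv_id]
        monoidal
  · obtain ⟨Y, Z⟩ := Z
    change pair (b X) (pair (b Y) (b Z)) ≫ (F.obj X ⊗ F.obj Y ⊗ F.obj Z) ◁ (A ◁ hA.mul ≫ R) =
      pair (b X) (pair (b Y) (b Z)) ≫ (F.obj X ⊗ F.obj Y ⊗ F.obj Z) ◁
        (hA.comul ▷ (A ⊗ A) ≫ nested R)
    rw [pair_comp _ _ (hA.comul ▷ (A ⊗ A) ≫ nested R),
      act_push_pair_nested R (h.coaction X).comul (hR X Y) (hR X Z)]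
    have h1 := pair_whiskerLeft_tensorHom (b X) (pair (b Y) (b Z)) (𝟙 A) hA.mul
    rw [id_tensorHom, whiskerLeft_id, Category.comp_id, h.mul] at h1
    have h2 := pair_naturality (p := b X) (p' := b X) (f := 𝟙 _) (by simp)
      (tensorFamily_comp_μ b Y Z)
    have h3 := hR X (Y ⊗ Z)
    rw [whiskerLeft_comp, reassoc_of% h1]
    rw [id_tensorHom] at h2
    rw [← cancel_mono ((F.obj X ◁ Functor.LaxMonoidal.μ F Y Z) ▷ 𝟙_ C), Category.assoc,
      whisker_exchange, ← reassoc_of% h2, h3, reassoc_of% compareBraiding_tensor_right]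
    simp only [Category.assoc]
    monoidal

end DualQuasitriangular

/-! ### Adjoint morphisms and the dual braided group -/

section Mates

variable {C : Type u₁} [Category.{v₁} C] [MonoidalCategory C]

/-- The nested pairing of `X₁ ⊗ X₂` with `Y₂ ⊗ Y₁`. -/
def nest {X₁ X₂ Y₁ Y₂ : C} (p : X₁ ⊗ Y₁ ⟶ 𝟙_ C) (q : X₂ ⊗ Y₂ ⟶ 𝟙_ C) :
    (X₁ ⊗ X₂) ⊗ (Y₂ ⊗ Y₁) ⟶ 𝟙_ C :=
  (α_ X₁ X₂ (Y₂ ⊗ Y₁)).hom ≫ X₁ ◁ (α_ X₂ Y₂ Y₁).inv ≫ X₁ ◁ (q ▷ Y₁) ≫ X₁ ◁ (λ_ Y₁).hom ≫ p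

/-- The pairing `p` induces bijections `Hom(Z, W ⊗ X) ≃ Hom(Z ⊗ Y, W)`. -/
def IsPerfect {X Y : C} (p : X ⊗ Y ⟶ 𝟙_ C) : Prop :=
  ∀ (W Z : C) (h : Z ⊗ Y ⟶ W),
    ∃! f : Z ⟶ W ⊗ X, f ▷ Y ≫ (α_ W X Y).hom ≫ W ◁ p ≫ (ρ_ W).hom = h

theorem isPerfect_evaluation (X Y : C) [ExactPairing X Y] : IsPerfect (ε_ X Y) := by
  intro W Z h
  refine ⟨tensorRightHomEquiv Z X Y W h, (tensorRightHomEquiv Z X Y W).symm_apply_apply h,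
    fun f hf => ?_⟩
  rw [← hf]
  exact ((tensorRightHomEquiv Z X Y W).apply_symm_apply f).symm

theorem isPerfect_unit : IsPerfect (λ_ (𝟙_ C)).hom := by
  intro W Z h
  refine ⟨(ρ_ Z).inv ≫ h ≫ (ρ_ W).inv, ?_, fun f hf => ?_⟩
  · simp [unitors_equal]
  · rw [← hf]
    simp [unitors_equal]

theorem IsPerfect.nest {X₁ X₂ Y₁ Y₂ : C} {p : X₁ ⊗ Y₁ ⟶ 𝟙_ C} {q : X₂ ⊗ Y₂ ⟶ 𝟙_ C}
    (hp : IsPerfect p) (hq : IsPerfect q) : IsPerfect (nest p q) := by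
  intro W Z h
  have key : ∀ f : Z ⟶ W ⊗ X₁ ⊗ X₂, f ▷ (Y₂ ⊗ Y₁) ≫ (α_ _ _ _).hom ≫
      W ◁ BraidedReconstruction.nest p q ≫ (ρ_ W).hom =
      (α_ _ _ _).inv ≫ ((f ≫ (α_ _ _ _).inv) ▷ Y₂ ≫ (α_ _ _ _).hom ≫ (W ⊗ X₁) ◁ q ≫ (ρ_ _).hom) ▷ Y₁ ≫
        (α_ _ _ _).hom ≫ W ◁ p ≫ (ρ_ W).hom := fun f => by
    simp only [BraidedReconstruction.nest]
    monoidal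
  obtain ⟨f₁, h₁, u₁⟩ := hp _ _ ((α_ Z Y₂ Y₁).hom ≫ h)
  obtain ⟨f, h₂, u₂⟩ := hq _ _ f₁
  refine ⟨f ≫ (α_ _ _ _).hom, ?_, fun g hg => ?_⟩
  · beta_reduce
    rw [key, Category.assoc, Iso.hom_inv_id, Category.comp_id, h₂, h₁, Iso.inv_hom_id_assoc]
  · beta_reduce at hg
    rw [key] at hg
    have h₃ := u₁ _ ((Iso.inv_comp_eq _).1 hg)
    rw [← u₂ _ h₃, Category.assoc, Iso.inv_hom_id, Category.comp_id]

/-- The morphisms `f` and `g` are adjoint for the pairings `p` and `p'`. -/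
def IsMate {X X' Y Y' : C} (p : X ⊗ Y ⟶ 𝟙_ C) (p' : X' ⊗ Y' ⟶ 𝟙_ C) (f : X ⟶ X') (g : Y' ⟶ Y) :
    Prop :=
  f ▷ Y' ≫ p' = X ◁ g ≫ p

section

variable {X X' X'' Y Y' Y'' : C} {p : X ⊗ Y ⟶ 𝟙_ C} {p' : X' ⊗ Y' ⟶ 𝟙_ C} {p'' : X'' ⊗ Y'' ⟶ 𝟙_ C}

/-- The device by which axioms dualise: the two sides of an axiom of the dual are adjoint to two
composites for the original, which agree by one of its axioms. -/
theorem IsPerfect.mate_unique (hp : IsPerfect p') {f f' : X ⟶ X'} {g g' : Y' ⟶ Y}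
    (h : IsMate p p' f g) (h' : IsMate p p' f' g') (hg : g = g') : f = f' := by
  subst hg
  have key : ∀ f : X ⟶ X', (f ≫ (λ_ X').inv) ▷ Y' ≫ (α_ _ _ _).hom ≫ 𝟙_ C ◁ p' ≫ (ρ_ _).hom =
      f ▷ Y' ≫ p' := fun f => by
    rw [← unitors_equal]
    simp
  obtain ⟨f₀, -, u⟩ := hp _ _ (X ◁ g ≫ p)
  have h1 := u _ ((key f).trans h)
  have h2 := u _ ((key f').trans h')
  rwa [← h2, Iso.cancel_iso_inv_right] at h1

theorem IsPerfect.exists_mate (hp : IsPerfect p') (p : X ⊗ Y ⟶ 𝟙_ C) (g : Y' ⟶ Y) :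
    ∃ f, IsMate p p' f g := by
  obtain ⟨f, hf, -⟩ := hp _ _ (X ◁ g ≫ p)
  refine ⟨f ≫ (λ_ X').hom, ?_⟩
  rw [IsMate, ← hf, ← unitors_equal]
  simp

theorem IsMate.comp {f : X ⟶ X'} {f' : X' ⟶ X''} {g : Y' ⟶ Y} {g' : Y'' ⟶ Y'}
    (h : IsMate p p' f g) (h' : IsMate p' p'' f' g') : IsMate p p'' (f ≫ f') (g' ≫ g) := by
  rw [IsMate] at *
  rw [comp_whiskerRight, Category.assoc, h', ← whisker_exchange_assoc, h]
  simp

theorem isMate_id (p : X ⊗ Y ⟶ 𝟙_ C) : IsMate p p (𝟙 X) (𝟙 Y) := by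
  simp [IsMate]

end

theorem IsMate.tensor {X₁ X₂ Y₁ Y₂ X₁' X₂' Y₁' Y₂' : C} {p₁ : X₁ ⊗ Y₁ ⟶ 𝟙_ C}
    {p₂ : X₂ ⊗ Y₂ ⟶ 𝟙_ C} {p₁' : X₁' ⊗ Y₁' ⟶ 𝟙_ C} {p₂' : X₂' ⊗ Y₂' ⟶ 𝟙_ C} {f₁ : X₁ ⟶ X₁'}
    {f₂ : X₂ ⟶ X₂'} {g₁ : Y₁' ⟶ Y₁} {g₂ : Y₂' ⟶ Y₂} (h₁ : IsMate p₁ p₁' f₁ g₁)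
    (h₂ : IsMate p₂ p₂' f₂ g₂) :
    IsMate (nest p₁ p₂) (nest p₁' p₂') (f₁ ⊗ₘ f₂) (g₂ ⊗ₘ g₁) := by
  simp only [IsMate, nest] at *
  calc _ = 𝟙 _ ⊗≫ f₁ ▷ (X₂ ⊗ Y₂' ⊗ Y₁') ⊗≫ X₁' ◁ (f₂ ▷ Y₂' ≫ p₂') ▷ Y₁' ⊗≫ p₁' := by
        rw [MonoidalCategory.tensorHom_def]; monoidal
    _ = 𝟙 _ ⊗≫ (f₁ ▷ (X₂ ⊗ Y₂' ⊗ Y₁') ≫ X₁' ◁ (X₂ ◁ g₂ ▷ Y₁' ⊗≫ p₂ ▷ Y₁' ⊗≫ 𝟙 Y₁')) ⊗≫ p₁' := by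
        rw [h₂]; monoidal
    _ = 𝟙 _ ⊗≫ X₁ ◁ (X₂ ◁ g₂ ▷ Y₁' ⊗≫ p₂ ▷ Y₁') ⊗≫ (f₁ ▷ Y₁' ≫ p₁') := by
        rw [← whisker_exchange]; monoidal
    _ = 𝟙 _ ⊗≫ X₁ ◁ X₂ ◁ g₂ ▷ Y₁' ⊗≫ X₁ ◁ (p₂ ▷ Y₁' ≫ 𝟙_ C ◁ g₁) ⊗≫ p₁ := by
        rw [h₁]; monoidal
    _ = _ := by rw [← whisker_exchange, MonoidalCategory.tensorHom_def]; monoidal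

theorem isMate_associator {X₁ X₂ X₃ Y₁ Y₂ Y₃ : C} (p₁ : X₁ ⊗ Y₁ ⟶ 𝟙_ C) (p₂ : X₂ ⊗ Y₂ ⟶ 𝟙_ C)
    (p₃ : X₃ ⊗ Y₃ ⟶ 𝟙_ C) :
    IsMate (nest (nest p₁ p₂) p₃) (nest p₁ (nest p₂ p₃)) (α_ X₁ X₂ X₃).hom (α_ Y₃ Y₂ Y₁).hom := by
  simp only [IsMate, nest]
  monoidal

theorem isMate_associator_inv {X₁ X₂ X₃ Y₁ Y₂ Y₃ : C} (p₁ : X₁ ⊗ Y₁ ⟶ 𝟙_ C)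
    (p₂ : X₂ ⊗ Y₂ ⟶ 𝟙_ C) (p₃ : X₃ ⊗ Y₃ ⟶ 𝟙_ C) :
    IsMate (nest p₁ (nest p₂ p₃)) (nest (nest p₁ p₂) p₃) (α_ X₁ X₂ X₃).inv (α_ Y₃ Y₂ Y₁).inv := by
  simp only [IsMate, nest]
  monoidal

theorem isMate_leftUnitor {X Y : C} (p : X ⊗ Y ⟶ 𝟙_ C) :
    IsMate (nest (λ_ (𝟙_ C)).hom p) p (λ_ X).hom (ρ_ Y).inv := by
  simp only [IsMate, nest]
  calc _ = 𝟙 _ ⊗≫ p ⊗≫ 𝟙 _ := by monoidal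
    _ = _ := by monoidal

theorem isMate_rightUnitor {X Y : C} (p : X ⊗ Y ⟶ 𝟙_ C) :
    IsMate (nest p (λ_ (𝟙_ C)).hom) p (ρ_ X).hom (λ_ Y).inv := by
  simp only [IsMate, nest]
  monoidal

theorem isMate_leftUnitor_inv {X Y : C} (p : X ⊗ Y ⟶ 𝟙_ C) :
    IsMate p (nest (λ_ (𝟙_ C)).hom p) (λ_ X).inv (ρ_ Y).hom := by
  simp only [IsMate, nest]
  monoidal

theorem isMate_rightUnitor_inv {X Y : C} (p : X ⊗ Y ⟶ 𝟙_ C) :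
    IsMate p (nest p (λ_ (𝟙_ C)).hom) (ρ_ X).inv (λ_ Y).hom := by
  simp only [IsMate, nest]
  monoidal

variable [BraidedCategory C]

/-- Naturality along `p₁` and `p₂` makes the braidings past a paired couple trivial. Since nesting
reverses the factors, a braiding is adjoint to a braiding and not to an inverse one, so the dual is
a braided group for the same braiding. -/
theorem isMate_braiding {X₁ X₂ Y₁ Y₂ : C} (p₁ : X₁ ⊗ Y₁ ⟶ 𝟙_ C) (p₂ : X₂ ⊗ Y₂ ⟶ 𝟙_ C) :
    IsMate (nest p₁ p₂) (nest p₂ p₁) (β_ X₁ X₂).hom (β_ Y₁ Y₂).hom := by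
  simp only [IsMate, nest]
  calc _ = 𝟙 _ ⊗≫ (β_ X₁ X₂).hom ▷ (Y₁ ⊗ Y₂) ⊗≫ X₂ ◁ p₁ ▷ Y₂ ⊗≫ p₂ := by monoidal
    _ = 𝟙 _ ⊗≫ X₁ ◁ (β_ Y₁ X₂).inv ▷ Y₂ ⊗≫ ((α_ X₁ Y₁ X₂).hom ≫ X₁ ◁ (β_ Y₁ X₂).hom ≫
          (α_ X₁ X₂ Y₁).inv ≫ (β_ X₁ X₂).hom ▷ Y₁ ≫ (α_ X₂ X₁ Y₁).hom ≫ X₂ ◁ p₁) ▷ Y₂ ⊗≫ p₂ := by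
        calc _ = 𝟙 _ ⊗≫ X₁ ◁ ((β_ Y₁ X₂).inv ≫ (β_ Y₁ X₂).hom) ▷ Y₂ ⊗≫
                (β_ X₁ X₂).hom ▷ (Y₁ ⊗ Y₂) ⊗≫ X₂ ◁ p₁ ▷ Y₂ ⊗≫ p₂ := by
              rw [Iso.inv_hom_id]; monoidal
          _ = _ := by monoidal
    _ = 𝟙 _ ⊗≫ X₁ ◁ (β_ Y₁ X₂).inv ▷ Y₂ ⊗≫ (p₁ ▷ (X₂ ⊗ Y₂) ≫ 𝟙_ C ◁ p₂) ⊗≫ 𝟙 _ := by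
        have h := braiding_naturality_left p₁ X₂
        rw [braiding_tensorUnit_left, braiding_tensor_left_hom] at h
        simp only [Category.assoc] at h
        rw [← h]
        monoidal
    _ = 𝟙 _ ⊗≫ X₁ ◁ (β_ Y₁ X₂).inv ▷ Y₂ ⊗≫ X₁ ◁ (Y₁ ◁ p₂ ≫ (β_ Y₁ (𝟙_ C)).hom) ⊗≫
          p₁ := by
        rw [← whisker_exchange, braiding_tensorUnit_right]
        monoidal
    _ = 𝟙 _ ⊗≫ X₁ ◁ ((β_ Y₁ X₂).inv ≫ (β_ Y₁ X₂).hom) ▷ Y₂ ⊗≫ X₁ ◁ X₂ ◁ (β_ Y₁ Y₂).hom ⊗≫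
          X₁ ◁ p₂ ▷ Y₁ ⊗≫ p₁ := by
        rw [braiding_naturality_right, braiding_tensor_right_hom]
        monoidal
    _ = _ := by
        rw [Iso.inv_hom_id]
        monoidal

theorem isMate_tensorμ {X₁ X₂ X₃ X₄ Y₁ Y₂ Y₃ Y₄ : C} (p₁ : X₁ ⊗ Y₁ ⟶ 𝟙_ C)
    (p₂ : X₂ ⊗ Y₂ ⟶ 𝟙_ C) (p₃ : X₃ ⊗ Y₃ ⟶ 𝟙_ C) (p₄ : X₄ ⊗ Y₄ ⟶ 𝟙_ C) :
    IsMate (nest (nest p₁ p₂) (nest p₃ p₄)) (nest (nest p₁ p₃) (nest p₂ p₄))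
      (tensorμ X₁ X₂ X₃ X₄) (tensorμ Y₄ Y₂ Y₃ Y₁) := by
  have e : tensorμ Y₄ Y₂ Y₃ Y₁ = ((((α_ _ _ _).inv ≫ ((α_ Y₄ Y₂ Y₃).hom ⊗ₘ 𝟙 Y₁)) ≫
      ((𝟙 Y₄ ⊗ₘ (β_ Y₂ Y₃).hom) ⊗ₘ 𝟙 Y₁)) ≫ ((α_ _ _ _).inv ⊗ₘ 𝟙 Y₁)) ≫ (α_ _ _ _).hom := by
    simp only [tensorμ]
    monoidal
  have e' : tensorμ X₁ X₂ X₃ X₄ = (α_ _ _ _).hom ≫ (𝟙 X₁ ⊗ₘ (α_ _ _ _).inv) ≫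
      (𝟙 X₁ ⊗ₘ ((β_ X₂ X₃).hom ⊗ₘ 𝟙 X₄)) ≫ (𝟙 X₁ ⊗ₘ (α_ _ _ _).hom) ≫ (α_ _ _ _).inv := by
    simp [tensorμ]
  rw [e, e']
  exact (isMate_associator _ _ _).comp (((isMate_id p₁).tensor (isMate_associator_inv _ _ _)).comp
    (((isMate_id p₁).tensor ((isMate_braiding _ _).tensor (isMate_id p₄))).comp
      (((isMate_id p₁).tensor (isMate_associator _ _ _)).comp (isMate_associator_inv _ _ _))))

theorem exists_dual_hopfObj (A B : C) [ExactPairing A B] (hA : HopfObj A) :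
    ∃ hB : HopfObj B,
      IsMate (nest (ε_ A B) (ε_ A B)) (ε_ A B) hB.mul hA.comul ∧
      IsMate (λ_ (𝟙_ C)).hom (ε_ A B) hB.one hA.counit ∧
      IsMate (ε_ A B) (nest (ε_ A B) (ε_ A B)) hB.comul hA.mul ∧
      IsMate (ε_ A B) (λ_ (𝟙_ C)).hom hB.counit hA.one ∧
      IsMate (ε_ A B) (ε_ A B) hB.antipode hA.antipode := by
  have p := isPerfect_evaluation A B
  have p1 : IsPerfect (λ_ (𝟙_ C)).hom := isPerfect_unit
  have p2 := p.nest p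
  have p3 := p.nest p2
  obtain ⟨m, hm⟩ := p.exists_mate (nest (ε_ A B) (ε_ A B)) hA.comul
  obtain ⟨u, hu⟩ := p.exists_mate (λ_ (𝟙_ C)).hom hA.counit
  obtain ⟨d, hd⟩ := p2.exists_mate (ε_ A B) hA.mul
  obtain ⟨e, he⟩ := p1.exists_mate (ε_ A B) hA.one
  obtain ⟨s, hs⟩ := p.exists_mate (ε_ A B) hA.antipode
  have i := isMate_id (ε_ A B)
  exact ⟨
    { mul := m
      one := u
      comul := d
      counit := e
      antipode := s
      one_mul := by
        rw [← tensorHom_id]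
        exact p.mate_unique ((hu.tensor i).comp hm) (isMate_leftUnitor _) (by simp)
      mul_one := by
        rw [← id_tensorHom]
        exact p.mate_unique ((i.tensor hu).comp hm) (isMate_rightUnitor _) (by simp)
      mul_assoc := by
        rw [← tensorHom_id, ← id_tensorHom]
        exact p.mate_unique ((hm.tensor i).comp hm)
          ((isMate_associator _ _ _).comp ((i.tensor hm).comp hm)) (by simp)
      counit_comul := by
        rw [← tensorHom_id]
        exact (p1.nest p).mate_unique (hd.comp (he.tensor i)) (isMate_leftUnitor_inv _) (by simp)
      comul_counit := by
        rw [← id_tensorHom]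
        exact (p.nest p1).mate_unique (hd.comp (i.tensor he)) (isMate_rightUnitor_inv _) (by simp)
      comul_assoc := by
        rw [← tensorHom_id, ← id_tensorHom]
        exact p3.mate_unique (hd.comp (i.tensor hd))
          (hd.comp ((hd.tensor i).comp (isMate_associator _ _ _))) (by simp)
      mul_comul := p2.mate_unique (hm.comp hd)
        ((hd.tensor hd).comp ((isMate_tensorμ _ _ _ _).comp (hm.tensor hm))) (by simp)
      one_comul := p2.mate_unique (hu.comp hd)
        ((isMate_leftUnitor_inv _).comp (hu.tensor hu)) (by simp [unitors_equal])
      mul_counit := p1.mate_unique (hm.comp he)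
        ((he.tensor he).comp (isMate_leftUnitor _)) (by rw [hA.one_comul, MonObj.tensorObj.one_def, unitors_inv_equal])
      one_counit := p1.mate_unique (hu.comp he) (isMate_id _) (by simp)
      antipode_left := by
        rw [← tensorHom_id]
        exact p.mate_unique (hd.comp ((hs.tensor i).comp hm)) (he.comp hu) (by simp)
      antipode_right := by
        rw [← id_tensorHom]
        exact p.mate_unique (hd.comp ((i.tensor hs).comp hm)) (he.comp hu) (by simp) },
    hm, hu, hd, he, hs⟩

end Mates

/-! ### Adjoint and coadjoint coactions for the identity functor -/

section Adjoint

variable {C : Type u₁} [Category.{v₁} C] [MonoidalCategory C] [BraidedCategory C] {A : C}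
  {b : ∀ X : C, X ⟶ X ⊗ A}

section

variable {d : A ⟶ A ⊗ A} {e : A ⟶ 𝟙_ C} {m : A ⊗ A ⟶ A} {u : 𝟙_ C ⟶ A}
  (h : Reconstructs (𝟭 C) b d e m u)

include h

theorem Reconstructs.pair_mul (X Y : C) : pair (b X) (b Y) ≫ (X ⊗ Y) ◁ m = b (X ⊗ Y) := by
  refine (h.mul X Y).trans ?_
  change 𝟙 (X ⊗ Y) ≫ b (X ⊗ Y) ≫ (𝟙 (X ⊗ Y)) ▷ A = _
  simp

theorem Reconstructs.unit_one : (λ_ (𝟙_ C)).inv ≫ 𝟙_ C ◁ u = b (𝟙_ C) := by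
  refine h.one.trans ?_
  change 𝟙 (𝟙_ C) ≫ b (𝟙_ C) ≫ (𝟙 (𝟙_ C)) ▷ A = _
  simp

/-- Naturality of `b` at the morphism `b X`, the coaction on `X ⊗ A` being computed by `m`. For
ordinary Hopf algebras it reads `a₂⁽⁰⁾ ⊗ a₁ a₂⁽¹⁾ = a₁ ⊗ a₂`. -/
theorem Reconstructs.comul_push (U : Universal (𝟭 C) A b) : d ≫ push (b A) m = d := by
  refine U.hom_ext fun X => ?_
  have h1 := (h.coaction X).comul
  have h2 := U.naturality (b X)
  simp only [Functor.id_obj, Functor.id_map] at h1 h2 ⊢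
  rw [← h.pair_mul, pair_comp] at h2
  rw [whiskerLeft_comp, reassoc_of% h1]
  simp only [act, Category.assoc] at h2
  have h3 := h2 =≫ (α_ X A A).hom
  simp only [Category.assoc, Iso.inv_hom_id, Category.comp_id] at h3
  rw [h3, h1]

end

theorem adjointCoaction_eq_push (hA : HopfObj A) :
    adjointCoaction A hA = hA.comul ≫ hA.antipode ▷ A ≫ push hA.comul hA.mul := by
  simp only [adjointCoaction, push]
  rw [← whisker_exchange_assoc]

/-- The coaction on the reconstructed braided group itself is the adjoint coaction. -/
theorem Reconstructs.adjointCoaction_eq [RightRigidCategory C] {hA : HopfObj A}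
    (h : Reconstructs (𝟭 C) b hA.comul hA.counit hA.mul hA.one) (U : Universal (𝟭 C) A b) :
    adjointCoaction A hA = b A := by
  have h1 : push hA.comul hA.mul =
      A ◁ hA.comul ≫ (α_ A A A).inv ≫ hA.mul ▷ A ≫ push (b A) hA.mul := by
    rw [← push_whiskerRight_comp, h.mul_assoc U, push_tensor, Iso.inv_hom_id_assoc,
      ← whiskerLeft_comp_assoc, h.comul_push U, push_eq_slide]
  -- `S(a₁) a₂ ⊗ a₃ = 1 ⊗ a`: multiplying `comul_push` by the antipode on the left isolates `b A`.
  have h2 : hA.comul ≫ hA.antipode ▷ A ≫ A ◁ hA.comul ≫ (α_ A A A).inv ≫ hA.mul ▷ A =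
      (λ_ A).inv ≫ hA.one ▷ A := by
    have h3 := h.comul_assoc U
    calc _ = hA.comul ≫ (hA.antipode ▷ A ≫ A ◁ hA.comul) ⊗≫ hA.mul ▷ A := by monoidal
      _ = (hA.comul ≫ A ◁ hA.comul) ≫ hA.antipode ▷ (A ⊗ A) ⊗≫ hA.mul ▷ A := by
        rw [← whisker_exchange]; monoidal
      _ = hA.comul ≫ (hA.comul ≫ hA.antipode ▷ A ≫ hA.mul) ▷ A := by
        rw [h3]; monoidal
      _ = (hA.comul ≫ hA.counit ▷ A) ≫ hA.one ▷ A := by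
        rw [hA.antipode_left]; simp
      _ = _ := by rw [h.counit_comul U]
  rw [adjointCoaction_eq_push, h1, reassoc_of% h2, ← push_whiskerRight_comp, h.one_mul U]
  simp only [push]
  rw [← leftUnitor_inv_naturality_assoc, braiding_tensorUnit_left]
  monoidal

omit [BraidedCategory C] in
theorem mapExactPairing_id (X Y : C) [i : ExactPairing X Y] : mapExactPairing (𝟭 C) X Y = i := by
  obtain ⟨coev, ev, h, h'⟩ := i
  simp only [mapExactPairing]
  congr
  · change 𝟙 _ ≫ coev ≫ 𝟙 _ = coev
    simp
  · change 𝟙 _ ≫ ev ≫ 𝟙 _ = ev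
    simp

/-- The coaction on the dual of the reconstructed braided group is the coadjoint coaction. -/
theorem Reconstructs.coadjointCoaction_eq [RightRigidCategory C] {hA : HopfObj A}
    (h : Reconstructs (𝟭 C) b hA.comul hA.counit hA.mul hA.one) (U : Universal (𝟭 C) A b)
    (hS : ∀ X, b X ≫ X ◁ hA.antipode =
      coactionMate (Q := Xᘁ) (b Xᘁ ≫ (β_ A Xᘁ).inv)) :
    coadjointCoaction A hA = b Aᘁ := by
  -- By `hS` the adjoint coaction followed by the antipode is the transpose of the coaction on `Aᘁ`;
  -- transposing back recovers the latter.
  have h1 := coactionMate_adjoint (P := A) (b Aᘁ ≫ (β_ A Aᘁ).inv)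
  rw [← hS A] at h1
  rw [coadjointCoaction, h.adjointCoaction_eq U, dualCoaction]
  rw [← cancel_mono (β_ A Aᘁ).inv, ← h1]
  simp only [Category.assoc, Iso.hom_inv_id, Category.comp_id]
  rw [← leftUnitor_naturality, ← whisker_exchange_assoc]
  monoidal

/-- For the identity functor all morphisms of `C` are comodule maps, so the structure maps of any
coalgebra are equivariant. -/
theorem Reconstructs.comul_equivariant {hA : HopfObj A}
    (h : Reconstructs (𝟭 C) b hA.comul hA.counit hA.mul hA.one) (U : Universal (𝟭 C) A b)
    {B : C} (f : B ⟶ B ⊗ B) :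
    f ≫ (b B ⊗ₘ b B) ≫ tensorμ B A B A ≫ (B ⊗ B) ◁ hA.mul = b B ≫ f ▷ A := by
  have h1 := U.naturality f
  have h2 := h.pair_mul B B
  simp only [pair, Category.assoc] at h2
  rw [h2]
  exact h1

theorem Reconstructs.counit_equivariant {hA : HopfObj A}
    (h : Reconstructs (𝟭 C) b hA.comul hA.counit hA.mul hA.one) (U : Universal (𝟭 C) A b)
    {B : C} (f : B ⟶ 𝟙_ C) :
    b B ≫ f ▷ A = f ≫ (λ_ (𝟙_ C)).inv ≫ 𝟙_ C ◁ hA.one := by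
  rw [h.unit_one]
  exact (U.naturality f).symm

end Adjoint

/-! ### Actions of the dual, and currying of natural families -/

section EvalAct

variable {C : Type u₁} [Category.{v₁} C] [MonoidalCategory C] [BraidedCategory C]

/-- The action on `Q` of a dual of `E`, obtained from `q : Q ⟶ Q ⊗ E` and a pairing. -/
def evalAct {B E Q : C} (q : Q ⟶ Q ⊗ E) (p : B ⊗ E ⟶ 𝟙_ C) : B ⊗ Q ⟶ Q :=
  push q p ≫ (ρ_ Q).hom

theorem evalAct_naturality {B E Q Q' : C} {q : Q ⟶ Q ⊗ E} {q' : Q' ⟶ Q' ⊗ E} {f : Q ⟶ Q'}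
    (h : f ≫ q' = q ≫ f ▷ E) (p : B ⊗ E ⟶ 𝟙_ C) : B ◁ f ≫ evalAct q' p = evalAct q p ≫ f := by
  rw [evalAct, reassoc_of% push_naturality h, evalAct, Category.assoc, rightUnitor_naturality]

theorem push_curry {V W B E Q : C} (q : Q ⟶ Q ⊗ E) (p : B ⊗ E ⟶ 𝟙_ C) (f : V ⟶ W ⊗ B) :
    push q (f ▷ E ≫ (α_ W B E).hom ≫ W ◁ p ≫ (ρ_ W).hom) =
      f ▷ Q ≫ (α_ W B Q).hom ≫ W ◁ evalAct q p ≫ (β_ W Q).hom := by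
  rw [push_whiskerRight_comp, push_tensor]
  simp only [slide, evalAct]
  calc _ = f ▷ Q ≫ (α_ W B Q).hom ≫ W ◁ push q p ≫ (α_ W Q (𝟙_ C)).inv ≫
        (β_ W Q).hom ▷ 𝟙_ C ≫ (ρ_ _).hom := by monoidal
    _ = _ := by rw [rightUnitor_naturality]; monoidal

theorem evalAct_whiskerRight_comp {B B' E Q : C} (q : Q ⟶ Q ⊗ E) (f : B ⟶ B')
    (p : B' ⊗ E ⟶ 𝟙_ C) : evalAct q (f ▷ E ≫ p) = f ▷ Q ≫ evalAct q p := by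
  rw [evalAct, push_whiskerRight_comp, Category.assoc, evalAct]

theorem evalAct_whiskerLeft_comp {B E E' Q : C} (q : Q ⟶ Q ⊗ E) (f : E ⟶ E')
    (p : B ⊗ E' ⟶ 𝟙_ C) : evalAct q (B ◁ f ≫ p) = evalAct (q ≫ Q ◁ f) p := by
  rw [evalAct, push_whiskerLeft_comp, evalAct]

theorem evalAct_pair {X₁ X₂ Y₁ Y₂ Q S : C} (p₁ : X₁ ⊗ Y₁ ⟶ 𝟙_ C) (p₂ : X₂ ⊗ Y₂ ⟶ 𝟙_ C)
    (q : Q ⟶ Q ⊗ Y₂) (s : S ⟶ S ⊗ Y₁) :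
    evalAct (pair q s) (nest p₁ p₂) = (α_ X₁ X₂ (Q ⊗ S)).hom ≫
      X₁ ◁ ((α_ X₂ Q S).inv ≫ evalAct q p₂ ▷ S) ≫ slide Q (evalAct s p₁) := by
  have e : nest p₁ p₂ = (α_ X₁ X₂ (Y₂ ⊗ Y₁)).hom ≫
      X₁ ◁ ((α_ X₂ Y₂ Y₁).inv ≫ p₂ ▷ Y₁ ≫ (λ_ Y₁).hom) ≫ p₁ := by
    simp [nest]
  have h2 : X₁ ◁ (Q ◁ s ≫ (α_ Q S Y₁).inv) ≫ slide (Q ⊗ S) p₁ =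
      slide Q (push s p₁) ≫ (α_ Q S (𝟙_ C)).inv := by
    rw [push_eq_slide, slide_whiskerLeft_comp, slide_slide]
    simp
  rw [evalAct, e, push_tensor, push_pair]
  simp only [whiskerLeft_comp, Category.assoc] at h2 ⊢
  rw [reassoc_of% h2]
  simp only [evalAct, slide_comp]
  simp

theorem evalAct_coaction {A B Q : C} {q : Q ⟶ Q ⊗ A} {d : A ⟶ A ⊗ A}
    (hq : q ≫ Q ◁ d = q ≫ q ▷ A ≫ (α_ Q A A).hom) (p : B ⊗ A ⟶ 𝟙_ C) :
    evalAct q ((B ⊗ B) ◁ d ≫ nest p p) = (α_ B B Q).hom ≫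
      B ◁ (B ◁ q ≫ (α_ B Q A).inv ≫ evalAct q p ▷ A) ≫ slide Q p ≫ (ρ_ Q).hom := by
  have e : nest p p = (α_ B B (A ⊗ A)).hom ≫
      B ◁ ((α_ B A A).inv ≫ p ▷ A ≫ (λ_ A).hom) ≫ p := by
    simp [nest]
  rw [evalAct_whiskerLeft_comp, hq, evalAct, e, push_tensor, push_iterate, Category.assoc,
    Category.assoc]
  rfl

variable {D : Type u₂} [Category.{v₂} D] [RightRigidCategory C] {G : D ⥤ C} {E : C}
  {c : ∀ X, G.obj X ⟶ G.obj X ⊗ E}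

theorem Universal.push_ext (U : Universal G E c) {V W : C} {φ ψ : V ⊗ E ⟶ W}
    (h : ∀ X, push (c X) φ = push (c X) ψ) : φ = ψ := by
  rw [← Iso.cancel_iso_inv_left (β_ V E)]
  refine U.act_ext Vᘁ fun X => ?_
  have := h X
  rwa [push_eq, push_eq, Iso.cancel_iso_hom_left] at this

theorem Universal.exists_push (U : Universal G E c) {V W : C}
    (s : ∀ X, V ⊗ G.obj X ⟶ G.obj X ⊗ W)
    (hs : ∀ {X Y : D} (f : X ⟶ Y), V ◁ G.map f ≫ s Y = s X ≫ G.map f ▷ W) :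
    ∃ φ : V ⊗ E ⟶ W, ∀ X, push (c X) φ = s X := by
  obtain ⟨φ, hφ⟩ := U.exists_act (W := V) Vᘁ (fun X => (β_ V (G.obj X)).inv ≫ s X) (fun f => by
    rw [Category.assoc, ← hs f, braiding_inv_naturality_left_assoc])
  refine ⟨(β_ V E).hom ≫ φ, fun X => ?_⟩
  rw [push_eq, Iso.inv_hom_id_assoc, hφ, Iso.hom_inv_id_assoc]

/-- The pairing makes `V ⟶ W ⊗ B` into `V ⊗ E ⟶ W`, and universality of `E` makes this a natural
family `V ⊗ G X ⟶ W ⊗ G X`. `exists_curry` is the surjectivity of the same correspondence. -/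
theorem Universal.curry_ext (U : Universal G E c) {B V W : C} {p : B ⊗ E ⟶ 𝟙_ C}
    (hp : IsPerfect p) {f f' : V ⟶ W ⊗ B}
    (h : ∀ X, f ▷ G.obj X ≫ (α_ W B (G.obj X)).hom ≫ W ◁ evalAct (c X) p =
      f' ▷ G.obj X ≫ (α_ W B (G.obj X)).hom ≫ W ◁ evalAct (c X) p) : f = f' := by
  obtain ⟨f₀, -, u⟩ := hp _ _ (f ▷ E ≫ (α_ W B E).hom ≫ W ◁ p ≫ (ρ_ W).hom)
  refine (u f rfl).trans (u f' ?_).symm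
  refine U.push_ext fun X => ?_
  rw [push_curry, push_curry, ← Category.assoc, ← Category.assoc, ← Category.assoc,
    ← Category.assoc, Category.assoc (f' ▷ _), ← h X]
  simp

theorem Universal.exists_curry (U : Universal G E c) {B V W : C} {p : B ⊗ E ⟶ 𝟙_ C}
    (hp : IsPerfect p) (t : ∀ X, V ⊗ G.obj X ⟶ W ⊗ G.obj X)
    (ht : ∀ {X Y : D} (f : X ⟶ Y), V ◁ G.map f ≫ t Y = t X ≫ W ◁ G.map f) :
    ∃ f : V ⟶ W ⊗ B, ∀ X, f ▷ G.obj X ≫ (α_ W B (G.obj X)).hom ≫ W ◁ evalAct (c X) p = t X := by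
  obtain ⟨φ, hφ⟩ := U.exists_push (fun X => t X ≫ (β_ W (G.obj X)).hom) (fun f => by
    rw [reassoc_of% ht f, Category.assoc, braiding_naturality_right])
  obtain ⟨f, hf, -⟩ := hp _ _ φ
  refine ⟨f, fun X => ?_⟩
  have h := hφ X
  rw [← hf, push_curry] at h
  rw [← Iso.cancel_iso_hom_right _ _ (β_ W (G.obj X)), ← h]
  simp

end EvalAct

/-! ### Half braidings, and their invertibility from duals -/

section LaxHalfBraiding

variable {C : Type u₁} [Category.{v₁} C] [MonoidalCategory C]

/-- The data of the inverse of a half braiding on `V`, not assumed to be invertible. -/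
structure IsLaxHalfBraiding {V : C} (ν : ∀ X : C, X ⊗ V ⟶ V ⊗ X) : Prop where
  naturality : ∀ {X Y : C} (f : X ⟶ Y), f ▷ V ≫ ν Y = ν X ≫ V ◁ f
  tensor : ∀ X Y : C, ν (X ⊗ Y) =
    (α_ X Y V).hom ≫ X ◁ ν Y ≫ (α_ X V Y).inv ≫ ν X ▷ Y ≫ (α_ V X Y).hom
  unit : ν (𝟙_ C) = (λ_ V).hom ≫ (ρ_ V).inv

namespace IsLaxHalfBraiding

variable {V : C} {ν : ∀ X : C, X ⊗ V ⟶ V ⊗ X}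

/-- The inverse of a lax half braiding at `X`, given a dual `X'` of `X`. -/
def inverse (ν : ∀ X : C, X ⊗ V ⟶ V ⊗ X) (X X' : C) [ExactPairing X X'] : V ⊗ X ⟶ X ⊗ V :=
  (λ_ (V ⊗ X)).inv ≫ η_ X X' ▷ (V ⊗ X) ≫ (α_ X X' (V ⊗ X)).hom ≫ X ◁ (α_ X' V X).inv ≫
    X ◁ (ν X' ▷ X) ≫ X ◁ (α_ V X' X).hom ≫ X ◁ (V ◁ ε_ X X') ≫ X ◁ (ρ_ V).hom

variable (h : IsLaxHalfBraiding ν)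

include h

/-- Naturality at the coevaluation, expanded by the tensor product rule, followed by a zigzag. The
other composite uses the evaluation. -/
theorem inverse_comp (X X' : C) [ExactPairing X X'] : inverse ν X X' ≫ ν X = 𝟙 _ := by
  have hz : η_ X X' ▷ X ⊗≫ X ◁ ε_ X X' = ⊗𝟙.hom := ExactPairing.evaluation_coevaluation'' X X'
  have hn := h.naturality (η_ X X')
  rw [h.tensor, h.unit] at hn
  simp only [inverse]
  calc _ = 𝟙 _ ⊗≫ η_ X X' ▷ (V ⊗ X) ⊗≫ X ◁ (ν X' ▷ X) ⊗≫ ((X ⊗ V) ◁ ε_ X X' ≫ ν X ▷ 𝟙_ C) ⊗≫ 𝟙 _ := by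
        monoidal
    _ = 𝟙 _ ⊗≫ (η_ X X' ▷ V ≫ (α_ X X' V).hom ≫ X ◁ ν X' ≫ (α_ X V X').inv ≫ ν X ▷ X' ≫
          (α_ V X X').hom) ▷ X ⊗≫ V ◁ (X ◁ ε_ X X') ⊗≫ 𝟙 _ := by
        rw [whisker_exchange]; monoidal
    _ = 𝟙 _ ⊗≫ V ◁ (η_ X X' ▷ X ⊗≫ X ◁ ε_ X X') ⊗≫ 𝟙 _ := by
        rw [hn]; monoidal
    _ = _ := by rw [hz]; monoidal

theorem comp_inverse (X X' : C) [ExactPairing X X'] : ν X ≫ inverse ν X X' = 𝟙 _ := by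
  have hz : η_ X X' ▷ X ⊗≫ X ◁ ε_ X X' = ⊗𝟙.hom := ExactPairing.evaluation_coevaluation'' X X'
  have hn := h.naturality (ε_ X X')
  rw [h.tensor, h.unit] at hn
  simp only [inverse]
  calc _ = 𝟙 _ ⊗≫ (𝟙_ C ◁ ν X ≫ η_ X X' ▷ (V ⊗ X)) ⊗≫ X ◁ (ν X' ▷ X) ⊗≫
          X ◁ (V ◁ ε_ X X') ⊗≫ 𝟙 _ := by monoidal
    _ = 𝟙 _ ⊗≫ η_ X X' ▷ (X ⊗ V) ⊗≫ X ◁ (((α_ X' X V).hom ≫ X' ◁ ν X ≫ (α_ X' V X).inv ≫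
          ν X' ▷ X ≫ (α_ V X' X).hom) ≫ V ◁ ε_ X X') ⊗≫ 𝟙 _ := by
        rw [whisker_exchange]; monoidal
    _ = 𝟙 _ ⊗≫ (η_ X X' ▷ X ⊗≫ X ◁ ε_ X X') ▷ V ⊗≫ 𝟙 _ := by
        rw [← hn]; monoidal
    _ = _ := by rw [hz]; monoidal

/-- In a category with duals a lax half braiding is invertible. -/
def halfBraiding [RightRigidCategory C] : HalfBraiding V where
  β X :=
    { hom := inverse ν X Xᘁ
      inv := ν X
      hom_inv_id := h.inverse_comp X Xᘁ
      inv_hom_id := h.comp_inverse X Xᘁ }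
  monoidal X Y := by
    have hX := h.comp_inverse X Xᘁ
    have hY := h.comp_inverse Y Yᘁ
    have hXY := h.inverse_comp (X ⊗ Y) (X ⊗ Y)ᘁ
    dsimp only
    rw [← Category.comp_id (inverse ν (X ⊗ Y) (X ⊗ Y)ᘁ)]
    have e : 𝟙 ((X ⊗ Y) ⊗ V) = ν (X ⊗ Y) ≫ (α_ _ _ _).inv ≫ inverse ν X Xᘁ ▷ Y ≫ (α_ _ _ _).hom ≫
        X ◁ inverse ν Y Yᘁ ≫ (α_ _ _ _).inv := by
      rw [h.tensor]
      simp only [Category.assoc, Iso.hom_inv_id_assoc]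
      rw [← comp_whiskerRight_assoc, hX, id_whiskerRight, Category.id_comp, Iso.inv_hom_id_assoc,
        ← whiskerLeft_comp_assoc, hY]
      simp
    rw [e, reassoc_of% hXY]
  naturality {X Y} f := by
    dsimp only
    calc _ = (inverse ν X Xᘁ ≫ ν X) ≫ V ◁ f ≫ inverse ν Y Yᘁ := by
          rw [h.inverse_comp, Category.id_comp]
      _ = inverse ν X Xᘁ ≫ f ▷ V ≫ ν Y ≫ inverse ν Y Yᘁ := by
          rw [reassoc_of% h.naturality f, Category.assoc]
      _ = _ := by rw [h.comp_inverse, Category.comp_id]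

end IsLaxHalfBraiding

/-- Up to unitors the component at the unit object is an idempotent automorphism of `V`, hence the
identity. -/
theorem halfBraiding_unit {V : C} (σ : HalfBraiding V) :
    (σ.β (𝟙_ C)).hom = (ρ_ V).hom ≫ (λ_ V).inv := by
  have h1 := σ.monoidal (𝟙_ C) (𝟙_ C)
  have h2 := σ.naturality (λ_ (𝟙_ C)).hom
  rw [h1] at h2
  have h3 : (ρ_ V).inv ≫ (σ.β (𝟙_ C)).hom ≫ (λ_ V).hom =
      ((ρ_ V).inv ≫ (σ.β (𝟙_ C)).hom ≫ (λ_ V).hom) ≫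
        ((ρ_ V).inv ≫ (σ.β (𝟙_ C)).hom ≫ (λ_ V).hom) := by
    calc _ = 𝟙 _ ⊗≫ (V ◁ (λ_ (𝟙_ C)).hom ≫ (σ.β (𝟙_ C)).hom) ≫ (λ_ V).hom := by monoidal
      _ = _ := by rw [h2]; monoidal
  have h4 : (ρ_ V).inv ≫ (σ.β (𝟙_ C)).hom ≫ (λ_ V).hom = 𝟙 V := by
    rw [← cancel_epi ((ρ_ V).inv ≫ (σ.β (𝟙_ C)).hom ≫ (λ_ V).hom), ← h3, Category.comp_id]
  rw [← Iso.inv_comp_eq, ← Iso.cancel_iso_hom_right _ _ (λ_ V)]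
  simpa using h4

theorem isLaxHalfBraiding_inv {V : C} (σ : HalfBraiding V) :
    IsLaxHalfBraiding (fun X => (σ.β X).inv) where
  naturality f := by
    rw [Iso.comp_inv_eq, Category.assoc, σ.naturality, Iso.inv_hom_id_assoc]
  tensor X Y := by
    rw [← cancel_epi (σ.β (X ⊗ Y)).hom, Iso.hom_inv_id, σ.monoidal]
    simp
  unit := by
    rw [← cancel_epi (σ.β (𝟙_ C)).hom, Iso.hom_inv_id, halfBraiding_unit]
    simp

end LaxHalfBraiding

/-! ### Half braidings as twists of the braiding -/

section Twist

variable {C : Type u₁} [Category.{v₁} C] [MonoidalCategory C] [BraidedCategory C]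

/-- The compatibility with tensor products of a natural family `t` of endomorphisms of `V ⊗ X` which
comes from a right coaction on `V` of a bialgebra acting on all objects `X`. -/
structure IsMonoidalTwist {V : C} (t : ∀ X : C, V ⊗ X ⟶ V ⊗ X) : Prop where
  naturality : ∀ {X Y : C} (f : X ⟶ Y), V ◁ f ≫ t Y = t X ≫ V ◁ f
  tensor : ∀ X Y : C, t (X ⊗ Y) = (α_ V X Y).inv ≫ t X ▷ Y ≫ (α_ V X Y).hom ≫
    slide X (t Y) ≫ (α_ X V Y).inv ≫ (β_ V X).inv ▷ Y ≫ (α_ V X Y).hom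
  unit : t (𝟙_ C) = 𝟙 _

variable {V : C} {t : ∀ X : C, V ⊗ X ⟶ V ⊗ X}

theorem slide_conj (X : C) {Y : C} (f : V ⊗ Y ⟶ V ⊗ Y) :
    slide X f ≫ (α_ X V Y).inv ≫ (β_ V X).inv ▷ Y ≫ (α_ V X Y).hom =
      V ◁ (β_ Y X).inv ≫ (α_ V Y X).inv ≫ f ▷ X ≫ (α_ V Y X).hom ≫ V ◁ (β_ Y X).hom := by
  have h := braiding_inv_naturality_right X f
  rw [← cancel_mono (V ◁ (β_ Y X).inv)]
  simp only [Category.assoc, whiskerLeft_hom_inv, Category.comp_id]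
  rw [braiding_tensor_left_inv] at h
  rw [← cancel_mono (α_ V Y X).inv]
  simp only [Category.assoc, slide] at h ⊢
  rw [h]
  simp

theorem slide_conj' (X : C) {Y : C} (f : V ⊗ Y ⟶ V ⊗ Y) :
    V ◁ (β_ X Y).hom ≫ (α_ V Y X).inv ≫ f ▷ X ≫ (α_ V Y X).hom ≫ V ◁ (β_ X Y).inv =
      (α_ V X Y).inv ≫ (β_ X V).inv ▷ Y ≫ (α_ X V Y).hom ≫ X ◁ f ≫ (α_ X V Y).inv ≫
        (β_ X V).hom ▷ Y ≫ (α_ V X Y).hom := by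
  have h := braiding_naturality_right X f
  rw [← cancel_mono (V ◁ (β_ X Y).hom)]
  simp only [Category.assoc, whiskerLeft_inv_hom, Category.comp_id]
  rw [braiding_tensor_right_hom] at h
  rw [← cancel_mono (α_ V Y X).inv]
  simp only [Category.assoc] at h ⊢
  rw [h]
  simp

theorem IsMonoidalTwist.isLaxHalfBraiding (h : IsMonoidalTwist t) :
    IsLaxHalfBraiding (fun X => (β_ X V).hom ≫ t X) where
  naturality f := by
    rw [braiding_naturality_left_assoc, h.naturality, Category.assoc]
  unit := by
    rw [h.unit, braiding_tensorUnit_left]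
    simp
  tensor X Y := by
    -- The tensor rule is used at `Y ⊗ X` and carried to `X ⊗ Y` by naturality at the braiding,
    -- which puts the two factors in the order that a half braiding requires.
    have h1 := h.naturality (β_ X Y).hom
    rw [h.tensor Y X, slide_conj] at h1
    have h2 := slide_conj' X (t Y)
    have h3 : t (X ⊗ Y) = V ◁ (β_ X Y).hom ≫ (α_ V Y X).inv ≫ t Y ▷ X ≫ (α_ V Y X).hom ≫
        V ◁ (β_ X Y).inv ≫ (α_ V X Y).inv ≫ t X ▷ Y ≫ (α_ V X Y).hom := by
      rw [← cancel_mono (V ◁ (β_ X Y).hom), ← h1]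
      simp
    rw [h3]
    have h4 := h2 =≫ ((α_ V X Y).inv ≫ t X ▷ Y ≫ (α_ V X Y).hom)
    simp only [Category.assoc] at h4
    rw [h4, braiding_tensor_left_hom]
    simp

theorem IsLaxHalfBraiding.isMonoidalTwist {ν : ∀ X : C, X ⊗ V ⟶ V ⊗ X} (h : IsLaxHalfBraiding ν) :
    IsMonoidalTwist (fun X => (β_ X V).inv ≫ ν X) := by
  have hn : ∀ {X Y : C} (f : X ⟶ Y), V ◁ f ≫ (β_ Y V).inv ≫ ν Y =
      ((β_ X V).inv ≫ ν X) ≫ V ◁ f := fun f => by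
    rw [braiding_inv_naturality_right_assoc, h.naturality, Category.assoc]
  refine ⟨hn, fun X Y => ?_, ?_⟩
  · have h2 : ∀ X Y : C, (β_ (X ⊗ Y) V).inv ≫ ν (X ⊗ Y) =
        V ◁ (β_ X Y).hom ≫ (α_ V Y X).inv ≫ ((β_ Y V).inv ≫ ν Y) ▷ X ≫ (α_ V Y X).hom ≫
          V ◁ (β_ X Y).inv ≫ (α_ V X Y).inv ≫ ((β_ X V).inv ≫ ν X) ▷ Y ≫ (α_ V X Y).hom := by
      intro X Y
      have h4 := slide_conj' X ((β_ Y V).inv ≫ ν Y) =≫ ((α_ V X Y).inv ≫ ((β_ X V).inv ≫ ν X) ▷ Y ≫ (α_ V X Y).hom)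
      simp only [Category.assoc] at h4 ⊢
      rw [h4, h.tensor, braiding_tensor_left_inv]
      simp
    rw [slide_conj]
    have h1 := hn (β_ Y X).hom
    rw [← cancel_epi (V ◁ (β_ Y X).hom), h1, h2]
    simp
  · rw [h.unit, braiding_inv_tensorUnit_left]
    simp

end Twist

/-! ### Twists are comodules of the dual -/

section Comodules

variable {C : Type u₁} [Category.{v₁} C] [MonoidalCategory C] [BraidedCategory C]

/-- The braided group `B` is dual to `A` by the perfect pairing `p`. -/
structure IsDualPair {A B : C} (p : B ⊗ A ⟶ 𝟙_ C) (hA : HopfObj A) (hB : HopfObj B) : Prop where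
  perfect : IsPerfect p
  mul : IsMate (nest p p) p hB.mul hA.comul
  one : IsMate (λ_ (𝟙_ C)).hom p hB.one hA.counit
  comul : IsMate p (nest p p) hB.comul hA.mul
  counit : IsMate p (λ_ (𝟙_ C)).hom hB.counit hA.one

variable {A B : C} {p : B ⊗ A ⟶ 𝟙_ C} {hA : HopfObj A} {hB : HopfObj B} (P : IsDualPair p hA hB)
  {b : ∀ X : C, X ⟶ X ⊗ A} (U : Universal (𝟭 C) A b)
  (h : Reconstructs (𝟭 C) b hA.comul hA.counit hA.mul hA.one)

include P h

/-- The product of `A`, which computes `b` on `X ⊗ Y`, is adjoint to the coproduct of `B`; so `B`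
acts on tensor products through its coproduct. -/
theorem evalAct_tensor (X Y : C) : evalAct (b (X ⊗ Y)) p = hB.comul ▷ (X ⊗ Y) ≫
    (α_ B B (X ⊗ Y)).hom ≫ B ◁ ((α_ B X Y).inv ≫ evalAct (b X) p ▷ Y) ≫
      slide X (evalAct (b Y) p) := by
  have h1 : hB.comul ▷ (A ⊗ A) ≫ nest p p = B ◁ hA.mul ≫ p := P.comul
  rw [← h.pair_mul, ← evalAct_whiskerLeft_comp, ← h1, evalAct_whiskerRight_comp, evalAct_pair]

theorem evalAct_unit : evalAct (b (𝟙_ C)) p = (ρ_ B).hom ≫ hB.counit := by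
  have h1 : hB.counit ▷ 𝟙_ C ≫ (λ_ (𝟙_ C)).hom = B ◁ hA.one ≫ p := P.counit
  rw [← h.unit_one, ← evalAct_whiskerLeft_comp, ← h1, evalAct_whiskerRight_comp]
  simp only [evalAct, push, braiding_tensorUnit_left]
  rw [← rightUnitor_naturality]
  congr 1
  monoidal

theorem evalAct_mul (X : C) : hB.mul ▷ X ≫ evalAct (b X) p = (α_ B B X).hom ≫
    B ◁ (B ◁ b X ≫ (α_ B X A).inv ≫ evalAct (b X) p ▷ A) ≫ slide X p ≫ (ρ_ X).hom := by
  have h1 : hB.mul ▷ A ≫ p = (B ⊗ B) ◁ hA.comul ≫ nest p p := P.mul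
  have h2 : b X ≫ X ◁ hA.comul = b X ≫ b X ▷ A ≫ (α_ X A A).hom := (h.coaction X).comul
  rw [← evalAct_whiskerRight_comp, h1, evalAct_coaction h2]

theorem evalAct_one (X : C) : hB.one ▷ X ≫ evalAct (b X) p = (λ_ X).hom := by
  have h1 : hB.one ▷ A ≫ p = 𝟙_ C ◁ hA.counit ≫ (λ_ (𝟙_ C)).hom := P.one
  have h2 := (h.coaction X).counit
  simp only [Functor.id_obj] at h2
  rw [← evalAct_whiskerRight_comp, h1, evalAct_whiskerLeft_comp, h2]
  simp only [evalAct, push, braiding_tensorUnit_left]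
  monoidal

theorem act_evalAct_tensor {V : C} (κ : V ⟶ V ⊗ B) (X Y : C) :
    act κ (evalAct (b (X ⊗ Y)) p) = act (κ ≫ V ◁ hB.comul) ((α_ B B (X ⊗ Y)).hom ≫
      B ◁ ((α_ B X Y).inv ≫ evalAct (b X) p ▷ Y) ≫ slide X (evalAct (b Y) p)) := by
  rw [evalAct_tensor P h, act_whiskerRight_comp]

omit P h in
theorem act_comul_evalAct {V : C} (κ : V ⟶ V ⊗ B) (X Y : C) :
    act (κ ≫ κ ▷ B ≫ (α_ V B B).hom) ((α_ B B (X ⊗ Y)).hom ≫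
      B ◁ ((α_ B X Y).inv ≫ evalAct (b X) p ▷ Y) ≫ slide X (evalAct (b Y) p)) =
    (α_ V X Y).inv ≫ act κ (evalAct (b X) p) ▷ Y ≫ (α_ V X Y).hom ≫
      slide X (act κ (evalAct (b Y) p)) ≫ (α_ X V Y).inv ≫ (β_ V X).inv ▷ Y ≫
        (α_ V X Y).hom := by
  rw [← act_act, act_associator_whiskerRight, act_slide]
  simp

theorem act_evalAct_unit {V : C} (κ : V ⟶ V ⊗ B) :
    act κ (evalAct (b (𝟙_ C)) p) = (ρ_ V).hom ≫ κ ≫ V ◁ hB.counit := by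
  rw [evalAct_unit P h, act_rightUnitor]

/-- A comodule of the dual of `A` gives a twist. -/
theorem IsCoaction.isMonoidalTwist {V : C} {κ : V ⟶ V ⊗ B}
    (hκ : IsCoaction hB.comul hB.counit κ) (hb : ∀ {X Y : C} (f : X ⟶ Y), f ≫ b Y = b X ≫ f ▷ A) :
    IsMonoidalTwist (fun X => act κ (evalAct (b X) p)) where
  naturality f := by
    rw [← act_whiskerLeft_comp, evalAct_naturality (hb f), act_comp]
  tensor X Y := by
    rw [act_evalAct_tensor P h, hκ.comul, act_comul_evalAct]
  unit := by
    rw [act_evalAct_unit P h, hκ.counit, Iso.hom_inv_id]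

include U in
/-- A twist comes from a comodule of the dual of `A`. -/
theorem IsMonoidalTwist.isCoaction [RightRigidCategory C] {V : C} {κ : V ⟶ V ⊗ B}
    (ht : IsMonoidalTwist (fun X => act κ (evalAct (b X) p))) :
    IsCoaction hB.comul hB.counit κ where
  comul := by
    -- Maps into `V ⊗ (B ⊗ B)` are detected on pairs of objects by the nested pairing, where
    -- coassociativity becomes the tensor rule.
    refine (U.tensor U).curry_ext (P.perfect.nest P.perfect) fun Z => ?_
    obtain ⟨X, Y⟩ := Z
    have e := evalAct_pair p p (b X) (b Y)
    have h1 := ht.tensor X Y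
    beta_reduce at h1
    rw [act_evalAct_tensor P h, ← act_comul_evalAct, ← e] at h1
    exact h1
  counit := by
    have h1 := ht.unit
    beta_reduce at h1
    rw [act_evalAct_unit P h] at h1
    rw [← Iso.cancel_iso_hom_left (ρ_ V), h1, Iso.hom_inv_id]

end Comodules

/-! ### The coaction of the dual on objects of the centre -/

section CenterCoaction

variable {C : Type u₁} [Category.{v₁} C] [MonoidalCategory C] [BraidedCategory C]

/-- The comparison of the braiding of `C` with the half braiding of `V`. -/
def twist (V : Center C) (X : C) : V.1 ⊗ X ⟶ V.1 ⊗ X :=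
  (β_ X V.1).inv ≫ (V.2.β X).inv

theorem isMonoidalTwist_twist (V : Center C) : IsMonoidalTwist (twist V) :=
  (isLaxHalfBraiding_inv V.2).isMonoidalTwist

theorem twist_comm {V W : Center C} (f : V ⟶ W) (X : C) :
    f.f ▷ X ≫ twist W X = twist V X ≫ f.f ▷ X := by
  have h := f.comm X
  rw [← Iso.inv_comp_eq, ← Category.assoc, ← Iso.eq_comp_inv] at h
  rw [twist, braiding_inv_naturality_left_assoc, ← h, twist, Category.assoc]

theorem comm_of_twist_comm {V W : Center C} (f : V.1 ⟶ W.1)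
    (hf : ∀ X, f ▷ X ≫ twist W X = twist V X ≫ f ▷ X) (X : C) :
    f ▷ X ≫ (W.2.β X).hom = (V.2.β X).hom ≫ X ◁ f := by
  have h := hf X
  rw [twist, braiding_inv_naturality_left_assoc, twist, Category.assoc,
    Iso.cancel_iso_inv_left] at h
  rw [← Iso.inv_comp_eq, ← Category.assoc, ← Iso.eq_comp_inv, h]

theorem slide_eq_conj {B W X : C} (e : B ⊗ X ⟶ X) :
    slide W e = B ◁ (β_ X W).inv ≫ (α_ B X W).inv ≫ e ▷ W ≫ (β_ X W).hom := by
  rw [braiding_naturality_left, braiding_tensor_left_hom]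
  simp [slide]

theorem twist_tensor (V W : Center C) (X : C) {B : C} {k : V.1 ⟶ V.1 ⊗ B} {e : B ⊗ X ⟶ X}
    (h : act k e = twist V X) :
    twist (V ⊗ W) X = (α_ V.1 W.1 X).hom ≫ act k (slide W.1 e) ≫ V.1 ◁ twist W X ≫
      (α_ V.1 W.1 X).inv := by
  have h1 : act k (slide W.1 e) = V.1 ◁ (β_ X W.1).inv ≫ (α_ V.1 X W.1).inv ≫ twist V X ▷ W.1 ≫
      (α_ V.1 X W.1).hom ≫ V.1 ◁ (β_ X W.1).hom := by
    rw [slide_eq_conj, act_whiskerLeft_comp, ← Category.assoc (α_ B X W.1).inv, act_comp,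
      act_associator_whiskerRight, h]
    simp
  have h2 : twist (V ⊗ W) X = (β_ X (V.1 ⊗ W.1)).inv ≫ (α_ _ _ _).inv ≫
      (V.2.β X).inv ▷ W.1 ≫ (α_ _ _ _).hom ≫ V.1 ◁ (W.2.β X).inv ≫ (α_ _ _ _).inv := by
    change (β_ X (V.1 ⊗ W.1)).inv ≫ ((V ⊗ W).2.β X).inv = _
    simp
  rw [h1, h2, braiding_tensor_right_inv]
  simp [twist]

theorem twist_unit (X : C) : twist (𝟙_ (Center C)) X = 𝟙 (𝟙_ C ⊗ X) := by
  change (β_ X (𝟙_ C)).inv ≫ ((𝟙_ (Center C)).2.β X).inv = _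
  rw [braiding_inv_tensorUnit_right]
  exact (by simp : ((λ_ X).hom ≫ (ρ_ X).inv) ≫ (ρ_ X).hom ≫ (λ_ X).inv = 𝟙 (𝟙_ C ⊗ X))

theorem slide_evalAct_comp {A B W X : C} (q : X ⟶ X ⊗ A) (p : B ⊗ A ⟶ 𝟙_ C)
    (t : W ⊗ X ⟶ W ⊗ X) : slide W (evalAct q p) ≫ t =
      B ◁ (W ◁ q ≫ (α_ W X A).inv ≫ t ▷ A ≫ (α_ W X A).hom) ≫
        slide W (slide X p ≫ (ρ_ X).hom) := by
  have h := slide_naturality t p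
  have h1 : slide W (evalAct q p) = B ◁ W ◁ q ≫ slide W (slide X p ≫ (ρ_ X).hom) := by
    rw [evalAct, push_eq_slide, Category.assoc, slide_whiskerLeft_comp]
  rw [h1, slide_comp, slide_slide]
  simp only [whiskerLeft_comp, Category.assoc, whiskerLeft_hom_inv_assoc]
  rw [reassoc_of% h]
  simp

variable {A B : C} {p : B ⊗ A ⟶ 𝟙_ C} {hA : HopfObj A} {hB : HopfObj B} (P : IsDualPair p hA hB)
  {b : ∀ X : C, X ⟶ X ⊗ A} (U : Universal (𝟭 C) A b)
  (h : Reconstructs (𝟭 C) b hA.comul hA.counit hA.mul hA.one)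

/-- The coaction of the dual of `A` on the objects of the centre. -/
structure IsCenterCoaction (p : B ⊗ A ⟶ 𝟙_ C) (b : ∀ X : C, X ⟶ X ⊗ A)
    (k : ∀ V : Center C, V.1 ⟶ V.1 ⊗ B) : Prop where
  act_eq : ∀ V X, act (k V) (evalAct (b X) p) = twist V X

variable [RightRigidCategory C]

include P U in
theorem exists_isCenterCoaction : ∃ k, IsCenterCoaction p b k := by
  have h1 : ∀ V : Center C, ∃ k : V.1 ⟶ V.1 ⊗ B, ∀ X, act k (evalAct (b X) p) = twist V X :=
    fun V => U.exists_curry P.perfect (twist V) (isMonoidalTwist_twist V).naturality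
  choose k hk using h1
  exact ⟨k, ⟨hk⟩⟩

variable {k : ∀ V : Center C, V.1 ⟶ V.1 ⊗ B} (K : IsCenterCoaction p b k)

namespace IsCenterCoaction

include K P U

theorem isCoaction (h : Reconstructs (𝟭 C) b hA.comul hA.counit hA.mul hA.one) (V : Center C) :
    IsCoaction hB.comul hB.counit (k V) := by
  have h1 := isMonoidalTwist_twist V
  have h2 : twist V = fun X => act (k V) (evalAct (b X) p) := funext fun X => (K.act_eq V X).symm
  rw [h2] at h1
  exact h1.isCoaction P U h

theorem naturality {V W : Center C} (f : V ⟶ W) : f.f ≫ k W = k V ≫ f.f ▷ B := by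
  refine U.curry_ext P.perfect fun X => ?_
  have h1 := twist_comm f X
  rw [← K.act_eq, ← K.act_eq] at h1
  simp only [act, Functor.id_obj, Category.assoc, comp_whiskerRight] at h1 ⊢
  rw [h1, associator_naturality_left_assoc, whisker_exchange]

theorem tensor (h : Reconstructs (𝟭 C) b hA.comul hA.counit hA.mul hA.one) (V W : Center C) :
    k (V ⊗ W) = pair (k V) (k W) ≫ (V.1 ⊗ W.1) ◁ hB.mul := by
  refine U.curry_ext P.perfect fun X => ?_
  change act (k (V ⊗ W)) (evalAct (b X) p) =
    act (pair (k V) (k W) ≫ (V.1 ⊗ W.1) ◁ hB.mul) (evalAct (b X) p)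
  rw [K.act_eq, twist_tensor V W X (K.act_eq V X), ← act_whiskerRight_comp, evalAct_mul P h,
    act_pair, act_whiskerLeft_comp, act_associator_whiskerRight, K.act_eq]
  have h1 := congrArg (act (k V)) (slide_evalAct_comp (b X) p (twist W X))
  rw [act_comp, act_whiskerLeft_comp] at h1
  rw [reassoc_of% h1]

theorem unit (h : Reconstructs (𝟭 C) b hA.comul hA.counit hA.mul hA.one) :
    k (𝟙_ (Center C)) = (λ_ (𝟙_ C)).inv ≫ 𝟙_ C ◁ hB.one := by
  refine U.curry_ext P.perfect fun X => ?_
  change act (k (𝟙_ (Center C))) (evalAct (b X) p) =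
    act ((λ_ (𝟙_ C)).inv ≫ 𝟙_ C ◁ hB.one) (evalAct (b X) p)
  rw [K.act_eq, twist_unit, ← act_whiskerRight_comp, evalAct_one P h]
  simp only [act]
  exact (by simp : 𝟙 (𝟙_ C ⊗ X) = (λ_ (𝟙_ C)).inv ▷ X ≫ (α_ (𝟙_ C) (𝟙_ C) X).hom ≫
    𝟙_ C ◁ (λ_ X).hom)

-- The coaction determines the half braiding through `act_eq`, so comodule maps are morphisms of the
-- centre.
omit P U [RightRigidCategory C] in
theorem comm {V W : Center C} (f : V.1 ⟶ W.1) (hf : f ≫ k W = k V ≫ f ▷ B) (X : C) :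
    f ▷ X ≫ (W.2.β X).hom = (V.2.β X).hom ≫ X ◁ f := by
  refine comm_of_twist_comm f (fun X => ?_) X
  rw [← K.act_eq, ← K.act_eq, act_naturality hf]

end IsCenterCoaction

end CenterCoaction

/-! ### Duals in the centre -/

section CenterDuals

variable {C : Type u₁} [Category.{v₁} C] [MonoidalCategory C] {V W : C} [ExactPairing W V]
  (σ : HalfBraiding V)

/-- The inverse of the half braiding on a dual object. -/
def dualHalfBraidingInv (W : C) [ExactPairing W V] (X : C) : X ⊗ W ⟶ W ⊗ X :=
  (λ_ (X ⊗ W)).inv ≫ η_ W V ▷ (X ⊗ W) ≫ (α_ W V (X ⊗ W)).hom ≫ W ◁ (α_ V X W).inv ≫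
    W ◁ ((σ.β X).hom ▷ W) ≫ W ◁ (α_ X V W).hom ≫ W ◁ (X ◁ ε_ W V) ≫ W ◁ (ρ_ X).hom

theorem whiskerLeft_coevaluation_dualHalfBraidingInv (X : C) :
    (ρ_ X).inv ≫ X ◁ η_ W V ≫ (α_ X W V).inv ≫ dualHalfBraidingInv σ W X ▷ V =
      (λ_ X).inv ≫ η_ W V ▷ X ≫ (α_ W V X).hom ≫ W ◁ (σ.β X).hom ≫ (α_ W X V).inv := by
  have hz : V ◁ η_ W V ⊗≫ ε_ W V ▷ V = ⊗𝟙.hom := ExactPairing.coevaluation_evaluation'' W V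
  simp only [dualHalfBraidingInv]
  calc _ = 𝟙 _ ⊗≫ (𝟙_ C ◁ X ◁ η_ W V ≫ η_ W V ▷ (X ⊗ W ⊗ V)) ⊗≫ W ◁ ((σ.β X).hom ▷ (W ⊗ V)) ⊗≫
        W ◁ (X ◁ ε_ W V ▷ V) ⊗≫ 𝟙 _ := by monoidal
    _ = 𝟙 _ ⊗≫ η_ W V ▷ X ⊗≫ W ◁ ((V ⊗ X) ◁ η_ W V ≫ (σ.β X).hom ▷ (W ⊗ V)) ⊗≫
        W ◁ (X ◁ ε_ W V ▷ V) ⊗≫ 𝟙 _ := by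
      rw [whisker_exchange]; monoidal
    _ = 𝟙 _ ⊗≫ η_ W V ▷ X ⊗≫ W ◁ (σ.β X).hom ⊗≫
        W ◁ X ◁ (V ◁ η_ W V ⊗≫ ε_ W V ▷ V) ⊗≫ 𝟙 _ := by
      rw [whisker_exchange]; monoidal
    _ = _ := by rw [hz]; monoidal

theorem dualHalfBraidingInv_evaluation (X : C) :
    V ◁ dualHalfBraidingInv σ W X ≫ (α_ V W X).inv ≫ ε_ W V ▷ X ≫ (λ_ X).hom =
      (α_ V X W).inv ≫ (σ.β X).hom ▷ W ≫ (α_ X V W).hom ≫ X ◁ ε_ W V ≫ (ρ_ X).hom := by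
  have hz : V ◁ η_ W V ⊗≫ ε_ W V ▷ V = ⊗𝟙.hom := ExactPairing.coevaluation_evaluation'' W V
  simp only [dualHalfBraidingInv]
  calc _ = 𝟙 _ ⊗≫ V ◁ η_ W V ▷ (X ⊗ W) ⊗≫ ((V ⊗ W) ◁ ((σ.β X).hom ▷ W ⊗≫ X ◁ ε_ W V) ≫
        ε_ W V ▷ (X ⊗ 𝟙_ C)) ⊗≫ 𝟙 _ := by monoidal
    _ = 𝟙 _ ⊗≫ (V ◁ η_ W V ⊗≫ ε_ W V ▷ V) ▷ (X ⊗ W) ⊗≫ (σ.β X).hom ▷ W ⊗≫ X ◁ ε_ W V ⊗≫ 𝟙 _ := by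
      rw [whisker_exchange]; monoidal
    _ = _ := by rw [hz]; monoidal

/-- Transposing a half braiding of `V` gives only the inverse direction for its dual; invertibility
is left to `IsLaxHalfBraiding.halfBraiding`. -/
theorem isLaxHalfBraiding_dual : IsLaxHalfBraiding (dualHalfBraidingInv σ W) where
  naturality {X Y} f := by
    have hn := σ.naturality f
    simp only [dualHalfBraidingInv]
    calc _ = 𝟙 _ ⊗≫ (𝟙_ C ◁ f ▷ W ≫ η_ W V ▷ (Y ⊗ W)) ⊗≫ W ◁ ((σ.β Y).hom ▷ W) ⊗≫
          W ◁ (Y ◁ ε_ W V) ⊗≫ 𝟙 _ := by monoidal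
      _ = 𝟙 _ ⊗≫ η_ W V ▷ (X ⊗ W) ⊗≫ W ◁ ((V ◁ f ≫ (σ.β Y).hom) ▷ W) ⊗≫
          W ◁ (Y ◁ ε_ W V) ⊗≫ 𝟙 _ := by
        rw [whisker_exchange]; monoidal
      _ = 𝟙 _ ⊗≫ η_ W V ▷ (X ⊗ W) ⊗≫ W ◁ ((σ.β X).hom ▷ W) ⊗≫
          W ◁ (f ▷ (V ⊗ W) ≫ Y ◁ ε_ W V) ⊗≫ 𝟙 _ := by
        rw [hn]; monoidal
      _ = _ := by rw [← whisker_exchange]; monoidal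
  tensor X Y := by
    have h1 := whiskerLeft_coevaluation_dualHalfBraidingInv (W := W) σ X
    symm
    calc _ = 𝟙 _ ⊗≫ ((ρ_ X).inv ≫ X ◁ η_ W V ≫ (α_ X W V).inv) ▷ (Y ⊗ W) ⊗≫
          (X ⊗ W) ◁ ((σ.β Y).hom ▷ W ⊗≫ Y ◁ ε_ W V) ⊗≫
            dualHalfBraidingInv σ W X ▷ (Y ⊗ 𝟙_ C) ⊗≫ 𝟙 _ := by
          simp only [dualHalfBraidingInv]; monoidal
      _ = 𝟙 _ ⊗≫ ((ρ_ X).inv ≫ X ◁ η_ W V ≫ (α_ X W V).inv) ▷ (Y ⊗ W) ⊗≫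
          ((X ⊗ W) ◁ ((σ.β Y).hom ▷ W ⊗≫ Y ◁ ε_ W V) ≫
            dualHalfBraidingInv σ W X ▷ (Y ⊗ 𝟙_ C)) ⊗≫ 𝟙 _ := by monoidal
      _ = 𝟙 _ ⊗≫ ((ρ_ X).inv ≫ X ◁ η_ W V ≫ (α_ X W V).inv ≫ dualHalfBraidingInv σ W X ▷ V) ▷
          (Y ⊗ W) ⊗≫ (W ⊗ X) ◁ ((σ.β Y).hom ▷ W ⊗≫ Y ◁ ε_ W V) ⊗≫ 𝟙 _ := by
        rw [whisker_exchange]; monoidal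
      _ = _ := by
        rw [h1, dualHalfBraidingInv, σ.monoidal]; monoidal
  unit := by
    have hz : η_ W V ▷ W ⊗≫ W ◁ ε_ W V = ⊗𝟙.hom := ExactPairing.evaluation_coevaluation'' W V
    rw [dualHalfBraidingInv, halfBraiding_unit]
    calc _ = 𝟙 _ ⊗≫ (η_ W V ▷ W ⊗≫ W ◁ ε_ W V) ⊗≫ 𝟙 _ := by monoidal
      _ = _ := by rw [hz]; monoidal

theorem coevaluation_comm (τ : HalfBraiding W)
    (h : ∀ X, (τ.β X).inv = dualHalfBraidingInv σ W X) (X : C) :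
    η_ W V ▷ X ≫ ((α_ W V X).hom ≫ W ◁ (σ.β X).hom ≫ (α_ W X V).inv ≫ (τ.β X).hom ▷ V ≫
      (α_ X W V).hom) = ((λ_ X).hom ≫ (ρ_ X).inv) ≫ X ◁ η_ W V := by
  have h1 := whiskerLeft_coevaluation_dualHalfBraidingInv (W := W) σ X
  rw [← h] at h1
  have h2 := (λ_ X).hom ≫= h1 =≫ ((τ.β X).hom ▷ V ≫ (α_ X W V).hom)
  simp only [Category.assoc, Iso.hom_inv_id_assoc, inv_hom_whiskerRight_assoc, Iso.inv_hom_id,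
    Category.comp_id] at h2
  simp only [Category.assoc]
  exact h2.symm

theorem evaluation_comm (τ : HalfBraiding W)
    (h : ∀ X, (τ.β X).inv = dualHalfBraidingInv σ W X) (X : C) :
    ε_ W V ▷ X ≫ ((λ_ X).hom ≫ (ρ_ X).inv) =
      ((α_ V W X).hom ≫ V ◁ (τ.β X).hom ≫ (α_ V X W).inv ≫ (σ.β X).hom ▷ W ≫ (α_ X V W).hom) ≫
        X ◁ ε_ W V := by
  have h1 := dualHalfBraidingInv_evaluation (W := W) σ X
  rw [← h] at h1
  have h2 := ((α_ V W X).hom ≫ V ◁ (τ.β X).hom) ≫= h1 =≫ (ρ_ X).inv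
  simp only [Category.assoc, whiskerLeft_hom_inv_assoc, Iso.hom_inv_id_assoc, Iso.hom_inv_id,
    Category.comp_id] at h2
  simp only [Category.assoc]
  exact h2

variable [RightRigidCategory C]

/-- The left dual of an object of the centre. -/
def centerDual (V : Center C) (W : C) [ExactPairing W V.1] : Center C :=
  ⟨W, (isLaxHalfBraiding_dual V.2 (W := W)).halfBraiding⟩

/-- Duality in the centre. -/
@[reducible]
def centerExactPairing (V : Center C) (W : C) [ExactPairing W V.1] :
    ExactPairing (centerDual V W) V where
  coevaluation' :=
    { f := η_ W V.1
      comm := coevaluation_comm (W := W) V.2 (centerDual V W).2 fun _ => rfl }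
  evaluation' :=
    { f := ε_ W V.1
      comm := evaluation_comm (W := W) V.2 (centerDual V W).2 fun _ => rfl }
  coevaluation_evaluation' := by
    apply Center.ext
    simp only [Center.comp_f, Center.whiskerLeft_f, Center.whiskerRight_f, Center.associator_inv_f,
      Center.rightUnitor_hom_f, Center.leftUnitor_inv_f]
    exact ExactPairing.coevaluation_evaluation W V.1
  evaluation_coevaluation' := by
    apply Center.ext
    simp only [Center.comp_f, Center.whiskerLeft_f, Center.whiskerRight_f, Center.associator_hom_f,
      Center.leftUnitor_hom_f, Center.rightUnitor_inv_f]
    exact ExactPairing.evaluation_coevaluation W V.1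

/-- The centre of a braided category with duals has duals. -/
@[reducible]
def centerRightRigid [BraidedCategory C] : RightRigidCategory (Center C) :=
  -- The braiding of `C` makes `V.1ᘁ` a left dual too. It lifts to a left dual in the centre, and
  -- the braiding of the centre turns left duals into right duals.
  let := fun V : Center C => exactPairing_swap V.1 V.1ᘁ
  let : LeftRigidCategory (Center C) :=
    { leftDual := fun V => { leftDual := centerDual V V.1ᘁ, exact := centerExactPairing V V.1ᘁ } }
  rightRigidCategoryOfLeftRigidCategory

end CenterDuals

/-! ### Universality for the forgetful functor of the centre -/

section CenterUniversal

variable {C : Type u₁} [Category.{v₁} C] [MonoidalCategory C] [BraidedCategory C]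

/-- The coaction of `A ⊗ B` given by coactions of `A` and of `B`. -/
def composite {A B X : C} (b : X ⟶ X ⊗ A) (κ : X ⟶ X ⊗ B) : X ⟶ X ⊗ (A ⊗ B) :=
  κ ≫ b ▷ B ≫ (α_ X A B).hom

omit [BraidedCategory C] in
theorem composite_comp {A B X Z : C} (b : X ⟶ X ⊗ A) (κ : X ⟶ X ⊗ B) (φ : A ⊗ B ⟶ Z) :
    composite b κ ≫ X ◁ φ = κ ≫ act b φ := by
  simp [composite, act]

/-- The cofree coaction of `B`. -/
def cofree {B : C} (hB : HopfObj B) (X : C) : X ⊗ B ⟶ (X ⊗ B) ⊗ B :=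
  X ◁ hB.comul ≫ (α_ X B B).inv

/-- The projection from the cofree comodule. -/
def cofreeProj {B : C} (hB : HopfObj B) (X : C) : X ⊗ B ⟶ X :=
  X ◁ hB.counit ≫ (ρ_ X).hom

theorem isCoaction_cofree {B : C} (hB : HopfObj B) (X : C) :
    IsCoaction hB.comul hB.counit (cofree hB X) where
  comul := by
    have h := hB.comul_assoc
    calc _ = X ◁ (hB.comul ≫ B ◁ hB.comul) ≫ (α_ X B (B ⊗ B)).inv := by
          simp only [cofree]; monoidal
      _ = _ := by
        rw [h]; simp only [cofree]; monoidal
  counit := by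
    have h := hB.comul_counit
    calc _ = X ◁ (hB.comul ≫ B ◁ hB.counit) ≫ (α_ X B (𝟙_ C)).inv := by
          simp only [cofree]; monoidal
      _ = _ := by rw [h]; monoidal

theorem cofree_comp_cofreeProj {B : C} (hB : HopfObj B) (X : C) :
    cofree hB X ≫ cofreeProj hB X ▷ B = 𝟙 (X ⊗ B) := by
  have h := hB.counit_comul
  calc _ = X ◁ (hB.comul ≫ hB.counit ▷ B) ⊗≫ 𝟙 _ := by
        simp only [cofree, cofreeProj]; monoidal
    _ = _ := by rw [h]; monoidal

theorem cofree_naturality {B X Y : C} (hB : HopfObj B) (f : X ⟶ Y) :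
    f ▷ B ≫ cofree hB Y = cofree hB X ≫ (f ▷ B) ▷ B := by
  simp only [cofree]
  rw [← whisker_exchange_assoc]
  simp

theorem cofreeProj_naturality {B X Y : C} (hB : HopfObj B) (f : X ⟶ Y) :
    f ▷ B ≫ cofreeProj hB Y = cofreeProj hB X ≫ f := by
  simp only [cofreeProj]
  rw [← whisker_exchange_assoc]
  simp

variable [RightRigidCategory C] {A B : C} {p : B ⊗ A ⟶ 𝟙_ C} {hA : HopfObj A} {hB : HopfObj B}
  {b : ∀ X : C, X ⟶ X ⊗ A} {k : ∀ V : Center C, V.1 ⟶ V.1 ⊗ B}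

/-- A comodule gives a twist, hence a half braiding invertible by duals; composing with the inverse
braiding recovers the twist, and so the coaction. -/
theorem IsCenterCoaction.exists_halfBraiding (K : IsCenterCoaction p b k)
    (P : IsDualPair p hA hB) (U : Universal (𝟭 C) A b)
    (h : Reconstructs (𝟭 C) b hA.comul hA.counit hA.mul hA.one) {V : C} {κ : V ⟶ V ⊗ B}
    (hκ : IsCoaction hB.comul hB.counit κ) :
    ∃ σ : HalfBraiding V, k ⟨V, σ⟩ = κ := by
  have ht := hκ.isMonoidalTwist P h U.naturality
  refine ⟨ht.isLaxHalfBraiding.halfBraiding, U.curry_ext P.perfect fun X => ?_⟩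
  exact (K.act_eq (⟨V, ht.isLaxHalfBraiding.halfBraiding⟩ : Center C) X).trans
    (Iso.inv_hom_id_assoc (β_ X V) _)

/-- A natural family on the centre is determined by its values at the cofree comodules `X ⊗ B`.
Followed by the counit, these form a natural family `X ⊗ B ⟶ X ⊗ Z` in `C`, which is a map `A ⊗ B ⟶
Z` by universality of `A`. -/
theorem IsCenterCoaction.universal (K : IsCenterCoaction p b k)
    (P : IsDualPair p hA hB) (U : Universal (𝟭 C) A b)
    (h : Reconstructs (𝟭 C) b hA.comul hA.counit hA.mul hA.one) :
    Universal (Center.forget C) (A ⊗ B) (fun V => composite (b V.1) (k V)) := by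
  have hn : ∀ {X Y : C} (f : X ⟶ Y), f ≫ b Y = b X ≫ f ▷ A := U.naturality
  have hc : ∀ X : C, ∃ σ : HalfBraiding (X ⊗ B), k ⟨X ⊗ B, σ⟩ = cofree hB X :=
    fun X => K.exists_halfBraiding P U h (isCoaction_cofree hB X)
  choose σ hσ using hc
  constructor
  · intro V W f
    change f.f ≫ composite (b W.1) (k W) = composite (b V.1) (k V) ≫ f.f ▷ (A ⊗ B)
    have h1 := K.naturality P U f
    simp only [composite]
    rw [reassoc_of% h1, ← comp_whiskerRight_assoc, hn]
    simp
  · intro Z φ ψ hφ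
    refine U.act_ext Bᘁ fun X => ?_
    have h1 : ∀ φ : A ⊗ B ⟶ Z, (composite (b (X ⊗ B)) (cofree hB X) ≫ (X ⊗ B) ◁ φ) ≫
        cofreeProj hB X ▷ Z = act (b X) φ := fun φ => by
      rw [composite_comp, Category.assoc, ← act_naturality (hn (cofreeProj hB X)),
        reassoc_of% cofree_comp_cofreeProj]
    have h2 : composite (b (X ⊗ B)) (k ⟨X ⊗ B, σ X⟩) ≫ (X ⊗ B) ◁ φ =
        composite (b (X ⊗ B)) (k ⟨X ⊗ B, σ X⟩) ≫ (X ⊗ B) ◁ ψ := hφ ⟨X ⊗ B, σ X⟩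
    rw [hσ] at h2
    change act (b X) φ = act (b X) ψ
    rw [← h1, ← h1, h2]
  · intro Z a ha
    let a' : ∀ V : Center C, V.1 ⟶ V.1 ⊗ Z := a
    have ha' : ∀ {V W : Center C} (f : V.1 ⟶ W.1), f ≫ k W = k V ≫ f ▷ B →
        f ≫ a' W = a' V ≫ f ▷ Z := fun {V W} f hf => ha ⟨f, K.comm f hf⟩
    obtain ⟨φ, hφ⟩ := U.exists_act Bᘁ
      (fun X => a' ⟨X ⊗ B, σ X⟩ ≫ cofreeProj hB X ▷ Z) (fun {X Y} f => by
        have h1 := ha' (V := ⟨X ⊗ B, σ X⟩) (W := ⟨Y ⊗ B, σ Y⟩) (f ▷ B)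
          (by rw [hσ, hσ]; exact cofree_naturality hB f)
        change f ▷ B ≫ a' ⟨Y ⊗ B, σ Y⟩ ≫ cofreeProj hB Y ▷ Z =
          (a' ⟨X ⊗ B, σ X⟩ ≫ cofreeProj hB X ▷ Z) ≫ f ▷ Z
        rw [reassoc_of% h1, ← comp_whiskerRight, cofreeProj_naturality]
        simp)
    refine ⟨φ, fun V => ?_⟩
    change composite (b V.1) (k V) ≫ V.1 ◁ φ = a' V
    have hk := K.isCoaction P U h V
    -- Coassociativity makes `k V` a morphism of the centre from `V` to the cofree object, and the
    -- counit splits it in `C`.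
    have h1 := ha' (V := V) (W := ⟨V.1 ⊗ B, σ V.1⟩) (k V) (by
      rw [hσ, cofree, reassoc_of% hk.comul, Iso.hom_inv_id, Category.comp_id])
    have h2 : k V ≫ cofreeProj hB V.1 = 𝟙 _ := by
      rw [cofreeProj, reassoc_of% hk.counit, Iso.inv_hom_id]
    have h3 : act (b V.1) φ = a' ⟨V.1 ⊗ B, σ V.1⟩ ≫ cofreeProj hB V.1 ▷ Z := hφ V.1
    rw [composite_comp, h3, reassoc_of% h1, ← comp_whiskerRight, h2, id_whiskerRight,
      Category.comp_id]

end CenterUniversal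

/-! ### Identification with the cross coproduct -/

section CrossCoproduct

variable {C : Type u₁} [Category.{v₁} C] [MonoidalCategory C] [BraidedCategory C]

theorem composite_pair {A B V W : C} (b : V ⟶ V ⊗ A) (k : V ⟶ V ⊗ B) (b' : W ⟶ W ⊗ A)
    (k' : W ⟶ W ⊗ B) (m : A ⊗ A ⟶ A) (n : B ⊗ B ⟶ B) :
    pair (composite b k) (composite b' k') ≫ (V ⊗ W) ◁ (tensorμ A B A B ≫ (m ⊗ₘ n)) =
      composite (pair b b' ≫ (V ⊗ W) ◁ m) (pair k k' ≫ (V ⊗ W) ◁ n) := by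
  have h1 := pair_pair k k' b b'
  simp only [composite, whiskerLeft_comp, Category.assoc] at h1 ⊢
  rw [← reassoc_of% h1, MonoidalCategory.tensorHom_def']
  calc _ = pair k k' ≫ (pair b b' ▷ (B ⊗ B) ≫ ((V ⊗ W) ⊗ A ⊗ A) ◁ n) ⊗≫
        (V ⊗ W) ◁ m ▷ B := by monoidal
    _ = _ := by rw [← whisker_exchange]; monoidal

omit [BraidedCategory C] in
theorem composite_unit {A B : C} (u : 𝟙_ C ⟶ A) (v : 𝟙_ C ⟶ B) :
    composite ((λ_ (𝟙_ C)).inv ≫ 𝟙_ C ◁ u) ((λ_ (𝟙_ C)).inv ≫ 𝟙_ C ◁ v) =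
      (λ_ (𝟙_ C)).inv ≫ 𝟙_ C ◁ ((λ_ (𝟙_ C)).inv ≫ (u ⊗ₘ v)) := by
  simp only [composite, MonoidalCategory.tensorHom_def']
  monoidal

omit [BraidedCategory C] in
theorem composite_counit {A B V : C} {b : V ⟶ V ⊗ A} {k : V ⟶ V ⊗ B} {e : A ⟶ 𝟙_ C}
    {e' : B ⟶ 𝟙_ C} (hb : b ≫ V ◁ e = (ρ_ V).inv) (hk : k ≫ V ◁ e' = (ρ_ V).inv) :
    composite b k ≫ V ◁ ((e ⊗ₘ e') ≫ (λ_ (𝟙_ C)).hom) = (ρ_ V).inv := by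
  simp only [composite, MonoidalCategory.tensorHom_def]
  calc _ = k ≫ (b ≫ V ◁ e) ▷ B ⊗≫ V ◁ e' ⊗≫ 𝟙 _ := by monoidal
    _ = (k ≫ V ◁ e') ⊗≫ 𝟙 _ := by rw [hb]; monoidal
    _ = _ := by rw [hk]; monoidal

/-- Iterating the composite coaction puts an `A`-coaction before a `B`-coaction; `h` restores the
order, at the price of the coaction `c` on `B` and a product in `A`. -/
theorem composite_comul {A B V : C} {hA : HopfObj A} {hB : HopfObj B} {b : V ⟶ V ⊗ A}
    {k : V ⟶ V ⊗ B} {c : B ⟶ B ⊗ A} (hb : IsCoaction hA.comul hA.counit b)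
    (hk : IsCoaction hB.comul hB.counit k)
    (h : b ≫ k ▷ A = k ≫ pair b c ≫ (V ⊗ B) ◁ hA.mul) :
    composite b k ≫ V ◁ crossComul A B hA hB c =
      composite b k ≫ composite b k ▷ (A ⊗ B) ≫ (α_ V (A ⊗ B) (A ⊗ B)).hom := by
  have h1 := hb.comul
  have h2 := hk.comul
  simp only [composite, crossComul, MonoidalCategory.tensorHom_def']
  symm
  calc _ = k ⊗≫ (b ≫ k ▷ A) ▷ B ⊗≫ b ▷ (B ⊗ A ⊗ B) ⊗≫ 𝟙 _ := by monoidal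
    _ = k ⊗≫ k ▷ B ⊗≫ (b ▷ B ≫ (V ⊗ A) ◁ c) ▷ B ⊗≫ (V ◁ ((β_ A B).hom ▷ (A ⊗ B)) ⊗≫
          V ◁ B ◁ hA.mul ▷ B) ⊗≫ b ▷ (B ⊗ A ⊗ B) ⊗≫ 𝟙 _ := by
      rw [h, pair, MonoidalCategory.tensorHom_def, tensorμ]; monoidal
    _ = k ⊗≫ k ▷ B ⊗≫ b ▷ (B ⊗ B) ⊗≫ (V ◁ (A ◁ c ▷ B ⊗≫ (β_ A B).hom ▷ (A ⊗ B) ⊗≫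
          B ◁ hA.mul ▷ B) ≫ b ▷ (B ⊗ A ⊗ B)) ⊗≫ 𝟙 _ := by monoidal
    _ = k ⊗≫ k ▷ B ⊗≫ (b ≫ b ▷ A ≫ (α_ V A A).hom) ▷ (B ⊗ B) ⊗≫
          V ◁ A ◁ (A ◁ c ▷ B ⊗≫ (β_ A B).hom ▷ (A ⊗ B) ⊗≫ B ◁ hA.mul ▷ B) ⊗≫ 𝟙 _ := by
      rw [whisker_exchange]; monoidal
    _ = (k ≫ k ▷ B ≫ (α_ V B B).hom) ⊗≫ b ▷ (B ⊗ B) ⊗≫ V ◁ hA.comul ▷ (B ⊗ B) ⊗≫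
          V ◁ A ◁ (A ◁ c ▷ B ⊗≫ (β_ A B).hom ▷ (A ⊗ B) ⊗≫ B ◁ hA.mul ▷ B) ⊗≫ 𝟙 _ := by
      rw [← h1]; monoidal
    _ = k ⊗≫ (V ◁ hB.comul ≫ b ▷ (B ⊗ B)) ⊗≫ V ◁ hA.comul ▷ (B ⊗ B) ⊗≫
          V ◁ A ◁ (A ◁ c ▷ B ⊗≫ (β_ A B).hom ▷ (A ⊗ B) ⊗≫ B ◁ hA.mul ▷ B) ⊗≫ 𝟙 _ := by
      rw [← h2]; monoidal
    _ = _ := by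
      rw [whisker_exchange]; monoidal

variable [RightRigidCategory C] {A B : C} {p : B ⊗ A ⟶ 𝟙_ C} {hA : HopfObj A} {hB : HopfObj B}
  {b : ∀ X : C, X ⟶ X ⊗ A} {k : ∀ V : Center C, V.1 ⟶ V.1 ⊗ B}

theorem IsCenterCoaction.isCrossCoproduct (K : IsCenterCoaction p b k)
    (P : IsDualPair p hA hB) (U : Universal (𝟭 C) A b)
    (h : Reconstructs (𝟭 C) b hA.comul hA.counit hA.mul hA.one) {hK : HopfObj (A ⊗ B)}
    (h' : Reconstructs (Center.forget C) (fun V => composite (b V.1) (k V)) hK.comul hK.counit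
      hK.mul hK.one) :
    IsCrossCoproduct A B hA hB (b B) hK := by
  have U' := K.universal P U h
  have hc : ∀ X : C, IsCoaction hA.comul hA.counit (b X) := h.coaction
  have hk := K.isCoaction P U h
  refine ⟨(hc B).comul, (hc B).counit, ?_, h.counit_equivariant U hB.counit, ?_, ?_, ?_, ?_⟩
  · have h1 := h.comul_equivariant U hB.comul
    simpa [pair] using h1
  · have e : ∀ X Y : C, ∀ f : X ⟶ X ⊗ Y, 𝟙 X ≫ f ≫ 𝟙 X ▷ Y = f := fun X Y f => by simp
    refine U'.pair_ext U' fun V W => (h'.mul V W).trans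
      ((e (V.1 ⊗ W.1) (A ⊗ B) (composite (b (V.1 ⊗ W.1)) (k (V ⊗ W)))).trans ?_)
    have h1 := K.tensor P U h V W
    rw [← h.pair_mul V.1 W.1, h1]
    exact (composite_pair (b V.1) (k V) (b W.1) (k W) hA.mul hB.mul).symm
  · have e : ∀ X Y : C, ∀ f : X ⟶ X ⊗ Y, 𝟙 X ≫ f ≫ 𝟙 X ▷ Y = f := fun X Y f => by simp
    have h0 : (λ_ (𝟙_ C)).inv ≫ 𝟙_ C ◁ hK.one = composite (b (𝟙_ C)) (k (𝟙_ (Center C))) :=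
      h'.one.trans (e (𝟙_ C) (A ⊗ B) _)
    have h2 := K.unit P U h
    rw [← h.unit_one, h2, composite_unit, Iso.cancel_iso_inv_left] at h0
    rwa [whiskerLeft_iff] at h0
  · refine U'.hom_ext fun V => (h'.coaction V).comul.trans ?_
    -- `k V` is a morphism of `C`, so `b` is natural at it. Here the coaction of `A` on `B` enters
    -- the coproduct.
    have h1 : k V ≫ b (V.1 ⊗ B) = b V.1 ≫ k V ▷ A := U.naturality (k V)
    have h2 := h.pair_mul V.1 B
    rw [← h2] at h1
    exact (composite_comul (hc V.1) (hk V) h1.symm).symm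
  · refine U'.hom_ext fun V => (h'.coaction V).counit.trans ?_
    exact (composite_counit (hc V.1).counit (hk V).counit).symm

omit [RightRigidCategory C] in
theorem isReconstructedFromBraiding_of_pair {D : Type u₂} [Category.{v₂} D] [MonoidalCategory D]
    [BraidedCategory D] (F : D ⥤ C) [F.Monoidal] {A : C} (β : F ⟶ F ⋙ tensorRight A)
    {hA : HopfObj A} {Q : DualQuasitriangular A hA}
    (h1 : ∀ X Y, pair (β.app X) (β.app Y) ≫ (F.obj X ⊗ F.obj Y) ◁ Q.op.mul =
      (β_ (F.obj X) (F.obj Y)).hom ≫ tensorFamily F (fun X => β.app X) Y X ≫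
        (β_ (F.obj X) (F.obj Y)).inv ▷ A)
    (h2 : ∀ X Y, pair (β.app X) (β.app Y) ≫ (F.obj X ⊗ F.obj Y) ◁ Q.R =
      compareBraiding F X Y ≫ (ρ_ (F.obj X ⊗ F.obj Y)).inv) :
    IsReconstructedFromBraiding F A β hA Q where
  op_mul X Y := (h1 X Y).trans (by simp [tensorFamily])
  R X Y := by
    have h3 := h2 X Y =≫ (ρ_ (F.obj X ⊗ F.obj Y)).hom
    rw [Category.assoc, Category.assoc, Iso.inv_hom_id, Category.comp_id] at h3
    exact h3.trans (by simp [compareBraiding, mapBraiding])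

end CrossCoproduct

theorem IsDualPair.isDualBraidedGroup {C : Type u₁} [Category.{v₁} C] [MonoidalCategory C]
    [BraidedCategory C] {A : C} [HasRightDual A] {hA : HopfObj A} {hB : HopfObj Aᘁ}
    (P : IsDualPair (ε_ A Aᘁ) hA hB)
    (hS : IsMate (ε_ A Aᘁ) (ε_ A Aᘁ) hB.antipode hA.antipode) : IsDualBraidedGroup A hA hB := by
  refine ⟨P.mul, ?_, P.comul, ?_, hS⟩
  · have hu := P.one
    rw [IsMate] at hu
    rw [hu]
    simp
  · have he := P.counit
    rw [IsMate] at he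
    rw [← he, unitors_equal]
    simp

end BraidedReconstruction

end

/-! ### The main theorem -/

open BraidedReconstruction in
theorem proposition3p1 {C : Type*} [Category C] [MonoidalCategory C]
    [BraidedCategory C] [RightRigidCategory C]
    (A : C) (β : 𝟭 C ⟶ 𝟭 C ⋙ tensorRight A) (hβ : IsRepresentedBy (𝟭 C) A β) :
    ∃ hA : HopfObj A, IsReconstruction (𝟭 C) A β hA ∧
    ∃ hA' : HopfObj (Aᘁ), IsDualBraidedGroup A hA hA' ∧
    ∃ hK : HopfObj (A ⊗ Aᘁ),
      IsCrossCoproduct A (Aᘁ) hA hA' (coadjointCoaction A hA) hK ∧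
    ∃ β' : Center.forget C ⟶ Center.forget C ⋙ tensorRight (A ⊗ Aᘁ),
      IsReconstruction (Center.forget C) (A ⊗ Aᘁ) β' hK ∧
    ∃ Q : DualQuasitriangular (A ⊗ Aᘁ) hK,
      IsReconstructedFromBraiding (Center.forget C) (A ⊗ Aᘁ) β' hK Q := by
  let b : ∀ X : C, X ⟶ X ⊗ A := β.app
  have U : Universal (𝟭 C) A b := hβ.universal
  obtain ⟨hA, h, hS⟩ := U.exists_hopfObj
  obtain ⟨hB, hm, hu, hd, he, hs⟩ := exists_dual_hopfObj A Aᘁ hA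
  have P : IsDualPair (ε_ A Aᘁ) hA hB := ⟨isPerfect_evaluation A Aᘁ, hm, hu, hd, he⟩
  obtain ⟨k, K⟩ := exists_isCenterCoaction P U
  have U' := K.universal P U h
  -- Duals in the centre provide the antipodes of `K` for both products.
  let _ : RightRigidCategory (Center C) := centerRightRigid
  obtain ⟨hK, h', -⟩ := U'.exists_hopfObj
  have hc : coadjointCoaction A hA = b Aᘁ := h.coadjointCoaction_eq U fun X => by
    have h1 := hS X
    -- The antipode was described with duals transported along the identity functor; these are the
    -- given duals.
    rw [mapExactPairing_id] at h1
    exact h1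
  let β' : Center.forget C ⟶ Center.forget C ⋙ tensorRight (A ⊗ Aᘁ) :=
    { app := fun V => composite (b V.1) (k V)
      naturality := fun _ _ f => U'.naturality f }
  obtain ⟨Q, hQ, hR⟩ := h'.exists_dualQuasitriangular U'
  refine ⟨hA, h.isReconstruction (β := β) U, hB, P.isDualBraidedGroup hs, hK, ?_, β',
    h'.isReconstruction (β := β') U', Q, isReconstructedFromBraiding_of_pair _ β' hQ hR⟩
  rw [hc]
  exact K.isCrossCoproduct P U h h'
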